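/- **Setting and notation.** Points of $\mathbb R^3$ are $x=(x_1,x_2,x_3)$. Let $\mathcal B(R_1,R_2,R_3)=R_3\log(R+R_3)-R$ with $R=\sqrt{R_1^2+R_2^2+R_3^2}$. Let sources $\xi^i=(\xi^i_1,\xi^i_2,\xi^i_3)$, $i=1,\dots,N$, lie in the lower half-space ($\xi^i_3<0$), with image source locations $Q_i=(\xi^i_1,\xi^i_2,-\xi^i_3)$. For an image source location $q$ and a target $x$ write $\mathcal B(x;q)=\mathcal B(x_1-q_1,\,x_2-q_2,\,q_3-x_3)$. For single-layer force vectors $F^i\in\mathbb R^3$, the $\mathcal B$-image potential is $$\Phi_{\mathcal B}(x)=\sum_{i=1}^N F^i\cdot\nabla_q\mathcal B(x;q)\big|_{q=Q_i}.$$ For double-layer sources with dislocation vectors $D^i$, orientation vectors $\nu^i$ and Lamé coefficients $\lambda,\mu$, it is $\Phi_{\mathcal B}(x)=\sum_{i}\mathcal L_i\,\mathcal B(x;q)|_{q=Q_i}$, where $$\mathcal L_i g=2\mu\big[D^i_1\nu^i_1 g_{11}+D^i_2\nu^i_2 g_{22}-D^i_3\nu^i_3 g_{33}+(D^i_2\nu^i_1+D^i_1\nu^i_2)g_{12}\big]-2\lambda(\nu^i\cdot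 D^i)\,g_{33},\qquad g_{jk}=\frac{\partial^2 g}{\partial q_j\partial q_k}.$$ Spherical harmonics are, for $|m|\le n$, $$Y_n^m(\theta,\phi)=\sqrt{\tfrac{2n+1}{4\pi}}\sqrt{\tfrac{(n-|m|)!}{(n+|m|)!}}\;P_n^{|m|}(\cos\theta)\,e^{im\phi},\qquad P_n^m(t)=(-1)^m(1-t^2)^{m/2}\frac{d^m}{dt^m}P_n(t),$$ with $P_n$ the Legendre polynomial. On a set $U$ that contains with each point the vertical half-line below it, $G=\partial_{x_3}^{-2}f$ means that $\partial^2G/\partial x_3^2=f$ on $U$ and that, for each $x\in U$, there are constants $c_1,c_2\in\mathbb C$ with $$G(x_1,x_2,x_3-t)-c_1\,(t\log 2t-t)-c_2\log 2t\to0\qquad(t\to\infty).$$ There is at most one such $G$ on $U$; this is the choice of the constants of integration for which $\partial_{x_3}^{-2}(1/R)=\mathcal B$. **Lemma 3.6.** Let $S\in\mathbb R^3$ (the center of a source box containing the $Q_i$) and let $b\in\mathbb R$ satisfy $|Q_i-S|<b$ for all $i$. In the single-layer case put $$M_n^m=\frac{4\pi}{2n+1}\sum_{i=1}^N F^i\cdot\nabla\big(\rho^n\,Y_n^{-m}(\alpha,\beta)\big)\Big|_{Q_i},$$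 and in the double-layer case put $$M_n^m=\frac{4\pi}{2n+1}\sum_{i=1}^N \mathcal L_i\big(\rho^n\,Y_n^{-m}(\alpha,\beta)\big)\Big|_{Q_i},$$ where $(\rho,\alpha,\beta)$ are the spherical coordinates with respect to $S$. Let $$\Sigma_p(x)=\sum_{n=0}^p\sum_{m=-n}^n M_n^m\,\frac{Y_n^m(\theta,\phi)}{r^{n+1}},$$ with $(r,\theta,\phi)$ the spherical coordinates of $x$ with respect to $S$. Then, in both cases, $\Phi_{\mathcal B}\approx\partial_{x_3}^{-2}\Sigma_p$ in the far field, in the following sense. 1. For every $p$, $\partial_{x_3}^{-2}\Sigma_p$ exists on $U=\{x: x_3<0,\ x_3<S_3\}$ (which is the whole lower half-space if $S_3\ge0$). 2. As $p\to\infty$, $\partial_{x_3}^{-2}\Sigma_p\to\Phi_{\mathcal B}$ uniformly on $\{x\in U: |x-S|\ge b\}$. 3. $\partial^2\Phi_{\mathcal B}/\partial x_3^2$ exists on $\{x_3<0\}$, and as $p\to\infty$, $\Sigma_p\to\partial^2\Phi_{\mathcal B}/\partial x_3^2$ uniformly on $\{x: x_3<0,\ |x-S|\ge b\}$. -/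

import Mathlib

open Filter Topology

noncomputable section

/-- Points and vectors of three-dimensional Euclidean space; the coordinates
`x₁, x₂, x₃` are `x 0, x 1, x 2`. -/
abbrev E3 : Type := EuclideanSpace ℝ (Fin 3)

/-- The unit vector in the `x₃` direction. -/
def vert : E3 := EuclideanSpace.single 2 1

/-- The image source location `(ξ₁, ξ₂, -ξ₃)` of a source `ξ`. -/
def imagePt (ξ : E3) : E3 := !₂[ξ 0, ξ 1, -ξ 2]

/-- The scalar potential `𝓑(R₁, R₂, R₃) = R₃ log (R + R₃) - R`, `R = √(R₁² + R₂² + R₃²)`. -/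
def potB (R₁ R₂ R₃ : ℝ) : ℝ :=
  R₃ * Real.log (√(R₁ ^ 2 + R₂ ^ 2 + R₃ ^ 2) + R₃) - √(R₁ ^ 2 + R₂ ^ 2 + R₃ ^ 2)

/-- `F · ∇ g` at the point `q`. -/
def dipole {V : Type*} [NormedAddCommGroup V] [NormedSpace ℝ V]
    (F : E3) (g : E3 → V) (q : E3) : V :=
  fderiv ℝ g q F

/-- The second partial derivative `∂²g/∂q_j∂q_k` at the point `q`. -/
def partial2 {V : Type*} [NormedAddCommGroup V] [NormedSpace ℝ V]
    (j k : Fin 3) (g : E3 → V) (q : E3) : V :=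
  dipole (EuclideanSpace.single j 1) (fun y => dipole (EuclideanSpace.single k 1) g y) q

/-- The second-order operator of a double-layer source with dislocation vector `D` and orientation
vector `ν`, for the Lamé coefficients `lam`, `mu`, applied to `g` at the point `q`:
`2μ [D₁ν₁ g₁₁ + D₂ν₂ g₂₂ - D₃ν₃ g₃₃ + (D₂ν₁ + D₁ν₂) g₁₂] - 2λ (ν · D) g₃₃`. -/
def quadrupole {V : Type*} [NormedAddCommGroup V] [NormedSpace ℝ V]
    (lam mu : ℝ) (D ν : E3) (g : E3 → V) (q : E3) : V :=
  (2 * mu) • ((D 0 * ν 0) • partial2 0 0 g q + (D 1 * ν 1) • partial2 1 1 g q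
      - (D 2 * ν 2) • partial2 2 2 g q + (D 1 * ν 0 + D 0 * ν 1) • partial2 0 1 g q)
    - (2 * lam * (ν 0 * D 0 + ν 1 * D 1 + ν 2 * D 2)) • partial2 2 2 g q

/-- The potential `𝓑(R₁, R₂, R₃)` at the target `x` as a function of the image source location
`q = (ξ₁, ξ₂, -ξ₃)`: here `R₁ = x₁ - ξ₁`, `R₂ = x₂ - ξ₂`, `R₃ = -(x₃ + ξ₃)`, that is
`R₁ = x₁ - q₁`, `R₂ = x₂ - q₂`, `R₃ = q₃ - x₃`. -/
def imageB (x q : E3) : ℝ := potB (x 0 - q 0) (x 1 - q 1) (q 2 - x 2)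

/-- The `𝓑`-image potential at the target `x` of the single-layer forces `F i` at the sources
`ξ i`: the sum of `F i · ∇ 𝓑`, where the gradient is with respect to the image source location. -/
def PhiB {N : ℕ} (F ξ : Fin N → E3) (x : E3) : ℝ :=
  ∑ i, dipole (F i) (imageB x) (imagePt (ξ i))

/-- The `𝓑`-image potential at the target `x` of the double-layer sources with dislocation vectors
`D i` and orientation vectors `ν i` at the sources `ξ i`. (The derivatives are with respect to the
image source location; as the third coordinate is differentiated an even number of times, they
agree with those with respect to the source location.) -/
def PhiBDouble {N : ℕ} (lam mu : ℝ) (D ν ξ : Fin N → E3) (x : E3) : ℝ :=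
  ∑ i, quadrupole lam mu (D i) (ν i) (imageB x) (imagePt (ξ i))

/-- The Legendre polynomial `P_n = (1 / (2ⁿ n!)) (d/dx)ⁿ (x² - 1)ⁿ`. -/
def legendreP (n : ℕ) : Polynomial ℝ :=
  Polynomial.C (1 / (2 ^ n * (n.factorial : ℝ))) *
    Polynomial.derivative^[n] ((Polynomial.X ^ 2 - 1) ^ n)

/-- The associated Legendre function
`P_n^m(x) = (-1)^m (1 - x²)^{m/2} (d/dx)^m P_n(x)`, for `-1 ≤ x ≤ 1`. -/
def assocLegendre (n m : ℕ) (x : ℝ) : ℝ :=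
  (-1) ^ m * √(1 - x ^ 2) ^ m * (Polynomial.derivative^[m] (legendreP n)).eval x

/-- The spherical harmonic `Y_n^m(θ, φ)` (for `|m| ≤ n`). -/
def sphY (n : ℕ) (m : ℤ) (θ φ : ℝ) : ℂ :=
  ((√((2 * n + 1) / (4 * Real.pi)) *
      √(((n - m.natAbs).factorial : ℝ) / ((n + m.natAbs).factorial : ℝ)) *
      assocLegendre n m.natAbs (Real.cos θ) : ℝ) : ℂ) *
    Complex.exp (Complex.I * m * φ)

/-- The polar angle `θ ∈ [0, π]` of `v`, measured from the positive `x₃` axis. -/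
def polarAngle (v : E3) : ℝ := Real.arccos (v 2 / ‖v‖)

/-- The azimuthal angle `φ` of `v`. -/
def azimuth (v : E3) : ℝ := Complex.arg (v 0 + v 1 * Complex.I)

/-- The solid harmonic `ρ^n Y_n^m(α, β)`, where `(ρ, α, β)` are the spherical coordinates of `q`
with respect to `S`. -/
def solidY (S : E3) (n : ℕ) (m : ℤ) (q : E3) : ℂ :=
  (‖q - S‖ : ℂ) ^ n * sphY n m (polarAngle (q - S)) (azimuth (q - S))

/-- The multipole coefficient about `S` of the single-layer forces:
`M_n^m = 4π / (2n+1) * ∑ i, F i · ∇ (ρ^n Y_n^{-m})`, evaluated at the image sources. -/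
def coeffSingle {N : ℕ} (F ξ : Fin N → E3) (S : E3) (n : ℕ) (m : ℤ) : ℂ :=
  ((4 * Real.pi / (2 * n + 1) : ℝ) : ℂ) *
    ∑ i, dipole (F i) (solidY S n (-m)) (imagePt (ξ i))

/-- The multipole coefficient about `S` of the double-layer sources: the same with `F i · ∇`
replaced by the second-order operator of the `i`-th source. -/
def coeffDouble {N : ℕ} (lam mu : ℝ) (D ν ξ : Fin N → E3) (S : E3) (n : ℕ) (m : ℤ) : ℂ :=
  ((4 * Real.pi / (2 * n + 1) : ℝ) : ℂ) *
    ∑ i, quadrupole lam mu (D i) (ν i) (solidY S n (-m)) (imagePt (ξ i))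

/-- The truncated multipole expansion
`∑_{n ≤ p} ∑_{|m| ≤ n} M_n^m Y_n^m(θ, φ) / r^{n+1}`, where `(r, θ, φ)` are the spherical
coordinates of `x` with respect to `S`. -/
def multipoleSum (M : ℕ → ℤ → ℂ) (S : E3) (p : ℕ) (x : E3) : ℂ :=
  ∑ n ∈ Finset.range (p + 1), ∑ m ∈ Finset.Icc (-(n : ℤ)) n,
    M n m * (sphY n m (polarAngle (x - S)) (azimuth (x - S)) / (‖x - S‖ : ℂ) ^ (n + 1))

/-- `∂²G/∂x₃² = f` on `U`: at each point of `U` the first partial derivative `G'` of `G` in the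
direction `x₃` exists, and there the partial derivative of `G'` is `f`. -/
def HasD3Sq (U : Set E3) (G f : E3 → ℂ) : Prop :=
  ∃ G' : E3 → ℂ, ∀ x ∈ U,
    HasDerivAt (fun t : ℝ => G (x + t • vert)) (G' x) 0 ∧
    HasDerivAt (fun t : ℝ => G' (x + t • vert)) (f x) 0

/-- `G = ∂_{x₃}^{-2} f` on `U`, where `U` is a set that contains with each point the whole vertical
half-line below it: `∂²G/∂x₃² = f`, and the constants of integration on each vertical line are
those for which `∂_{x₃}^{-2} (1/R) = 𝓑`. Since
`𝓑 = R₃ log (2 R₃) - R₃ + o(1)` as `R₃ → ∞`, this says that as `x₃ → -∞` the function `G` is, up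
to `o(1)`, a combination of `t log (2t) - t` and its derivative `log (2t)`, `t` being the depth,
without any additional constant or linear term. (The origin of the depth `t` is immaterial,
and at most one such `G` exists on `U`.) -/
def IsInvD3Sq (U : Set E3) (f G : E3 → ℂ) : Prop :=
  HasD3Sq U G f ∧
  ∀ x ∈ U, ∃ c₁ c₂ : ℂ,
    Tendsto (fun t : ℝ => G (x - t • vert) -
        (c₁ * ((t * Real.log (2 * t) - t : ℝ) : ℂ) + c₂ * ((Real.log (2 * t) : ℝ) : ℂ)))
      atTop (𝓝 0)

/-- The far-field representation
`Φ(x) ≈ ∂_{x₃}^{-2} ∑_{n ≤ p} ∑_{|m| ≤ n} M_n^m Y_n^m(θ, φ) / r^{n+1}` about `S`, for targets `x` in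
the lower half-space at distance at least `b` from `S`:
the truncated sums have an antiderivative `∂_{x₃}^{-2}` on the part of the lower half-space below
`S` (all of it if `S` is not below the surface), and as `p → ∞` these antiderivatives converge to
`Φ` uniformly at distance at least `b`; moreover, the truncated sums themselves converge to
`∂²Φ/∂x₃²` uniformly on the whole lower half-space at distance at least `b`. -/
def HasFarField (Φ : E3 → ℝ) (M : ℕ → ℤ → ℂ) (S : E3) (b : ℝ) : Prop :=
  (∀ p : ℕ, ∃ G : E3 → ℂ,
    IsInvD3Sq {x : E3 | x 2 < 0 ∧ x 2 < S 2} (multipoleSum M S p) G) ∧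
  (∀ G : ℕ → E3 → ℂ,
    (∀ p : ℕ, IsInvD3Sq {x : E3 | x 2 < 0 ∧ x 2 < S 2} (multipoleSum M S p) (G p)) →
    TendstoUniformlyOn G (fun x => (Φ x : ℂ)) atTop
      {x : E3 | x 2 < 0 ∧ x 2 < S 2 ∧ b ≤ dist x S}) ∧
  (∃ f : E3 → ℂ,
    HasD3Sq {x : E3 | x 2 < 0} (fun x => (Φ x : ℂ)) f ∧
    TendstoUniformlyOn (multipoleSum M S) f atTop {x : E3 | x 2 < 0 ∧ b ≤ dist x S})

end

/-! Two vertical derivatives turn `𝓑` into `1/R`, and they commute with derivatives in the image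
point `q`. Hence `∂²Φ/∂x₃²` is the source operator applied to `1/|x - q|`, for which the classical
expansion `∑ ρ^n P_n(cos γ) / r^(n+1)` about `S` is available when `|q - S| < |x - S|`. The addition
theorem splits each `P_n(cos γ)` into spherical harmonics. Applying the source operator in `q` then
shows that the degree-`n` part of `multipoleSum` is the operator applied to the `n`-th term
`multipole n S x`. The expansion and its first two `q`-derivatives are obtained with explicit
majorants (`hasSum_dipole_multipole`, `hasSum_dipole_dipole_multipole`).

The point of the lemma is to undo the two vertical derivatives. The degree-0 term is constant in
`q`, so every source operator kills it. After the source operator acts, terms of degree at least 2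
are `O(r^(-3))`, with constants that are summable in the degree and uniform for `r ≥ b`. So the
remainder after degree `p ≥ 1` is at most `ε / r^3` with `ε → 0`, and integrating it twice along the
vertical line from `-∞` gives a function `W` that vanishes at infinity and is `O(ε / b)`
(`exists_hasD3Sq_of_norm_le`). Below `S` the distance to `S` grows along the downward half-line, so
the decay estimate holds on all of it once it holds at the top.

Since `Φ` itself is a multiple of `log (2t)` up to `o(1)` at depth `t`, the function `Φ - W`
satisfies the normalization of `∂_{x₃}^{-2}` for the truncated sum. The normalization fixes the
antiderivative, because an affine function that agrees up to `o(1)` with a combination of `t log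
(2t) - t` and `log (2t)` has zero constant term (`IsInvD3Sq.eqOn`). So `Φ - W` is the only
antiderivative, and the bound on `W` is the uniform convergence.

Three ingredients carry the expansion. The addition theorem comes from the uniqueness of polynomial
solutions of the associated Legendre equation. The generating function comes from factoring `1 - 2cz
+ vz²` over `ℂ` and multiplying two series of type `(1 - z)^(-1/2)`. Smoothness of the solid
harmonics comes from writing them as polynomials in the coordinates. -/

noncomputable section

/-! ### Legendre polynomials: recurrences and the differential equation -/

open Polynomial in
/-- Leibniz' rule for the iterated derivative of a product with `X`. -/
theorem iterate_derivative_X_mul_succ (n : ℕ) (p : ℝ[X]) :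
    derivative^[n + 1] (X * p) =
      X * derivative^[n + 1] p + ((n : ℝ[X]) + 1) * derivative^[n] p := by
  rw [mul_comm, iterate_derivative_mul_X]
  simp [nsmul_eq_mul]
  ring

open Polynomial in
theorem iterate_derivative_X_sq_sub_one_mul (n : ℕ) (p : ℝ[X]) :
    derivative^[n + 2] ((X ^ 2 - 1) * p) =
      (X ^ 2 - 1) * derivative^[n + 2] p + 2 * ((n : ℝ[X]) + 2) * X * derivative^[n + 1] p
        + ((n : ℝ[X]) + 2) * ((n : ℝ[X]) + 1) * derivative^[n] p := by
  have : (X ^ 2 - 1 : ℝ[X]) * p = X * (X * p) - p := by ring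
  rw [this, iterate_derivative_sub, iterate_derivative_X_mul_succ,
    iterate_derivative_X_mul_succ, iterate_derivative_X_mul_succ]
  push_cast
  ring

open Polynomial in
theorem derivative_X_sq_sub_one_pow (n : ℕ) :
    derivative ((X ^ 2 - 1 : ℝ[X]) ^ (n + 1)) =
      C (2 * ((n : ℝ) + 1)) * (X * (X ^ 2 - 1) ^ n) := by
  rw [derivative_pow_succ, derivative_sub, derivative_X_sq, derivative_one]
  simp only [C_mul, C_add, C_1, C_eq_natCast, sub_zero]
  ring

open Polynomial in
theorem legendreP_zero : legendreP 0 = 1 := by simp [legendreP]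

open Polynomial in
theorem legendreP_one : legendreP 1 = X := by
  simp only [legendreP, pow_one, Function.iterate_one, derivative_sub, derivative_X_sq,
    derivative_one, sub_zero, ← mul_assoc, ← C_mul]
  norm_num

theorem legendreP_const (n : ℕ) : (1 / (2 ^ (n + 1) * ((n + 1).factorial : ℝ))) * (2 * ((n : ℝ) + 1))
    = 1 / (2 ^ n * (n.factorial : ℝ)) := by
  have : (n.factorial : ℝ) ≠ 0 := by positivity
  rw [Nat.factorial_succ]
  push_cast
  field_simp
  ring

-- One of the `n + 2` derivatives is spent on the power of `X ^ 2 - 1`, which produces a factor `X`;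
-- Leibniz' rule for multiplication by `X` does the rest.
open Polynomial in
theorem derivative_legendreP_succ (n : ℕ) :
    derivative (legendreP (n + 1)) =
      X * derivative (legendreP n) + ((n : ℝ[X]) + 1) * legendreP n := by
  have h : derivative (legendreP (n + 1)) =
      C (1 / (2 ^ n * (n.factorial : ℝ))) * derivative^[n + 1] (X * (X ^ 2 - 1) ^ n) := by
    rw [legendreP, derivative_C_mul, ← Function.iterate_succ_apply' derivative,
      Function.iterate_succ_apply, derivative_X_sq_sub_one_pow, iterate_derivative_C_mul,
      ← mul_assoc, ← C_mul, legendreP_const]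
  rw [h, iterate_derivative_X_mul_succ, legendreP, derivative_C_mul,
    ← Function.iterate_succ_apply' derivative]
  ring

-- The Rodrigues formula is expanded in two ways: by Leibniz with the factor `X ^ 2 - 1` split off,
-- and by first differentiating the power once. A combination of the two eliminates the lowest
-- derivative.
open Polynomial in
theorem succ_mul_legendreP_succ (n : ℕ) :
    ((n : ℝ[X]) + 1) * legendreP (n + 1) =
      ((n : ℝ[X]) + 1) * X * legendreP n + (X ^ 2 - 1) * derivative (legendreP n) := by
  rcases n with _ | n
  · simp [legendreP_zero, legendreP_one]
  set a : ℝ := 1 / (2 ^ (n + 2) * ((n + 2).factorial : ℝ)) with ha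
  set q : ℝ[X] := (X ^ 2 - 1) ^ (n + 1) with hq
  have e1 : legendreP (n + 2) = C a * ((X ^ 2 - 1) * derivative^[n + 2] q
      + 2 * ((n : ℝ[X]) + 2) * X * derivative^[n + 1] q
      + ((n : ℝ[X]) + 2) * ((n : ℝ[X]) + 1) * derivative^[n] q) := by
    rw [legendreP, ← iterate_derivative_X_sq_sub_one_mul, pow_succ' (X ^ 2 - 1 : ℝ[X]), ← ha]
  have e2 : legendreP (n + 2) = C a * (2 * ((n : ℝ[X]) + 2) * (X * derivative^[n + 1] q
      + ((n : ℝ[X]) + 1) * derivative^[n] q)) := by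
    rw [legendreP, Function.iterate_succ_apply, derivative_X_sq_sub_one_pow,
      iterate_derivative_C_mul, iterate_derivative_X_mul_succ, ← ha]
    have : C (2 * (((n + 1 : ℕ) : ℝ) + 1)) = 2 * ((n : ℝ[X]) + 2) := by
      simp only [C_mul, C_add, C_1, C_eq_natCast, C_ofNat]
      push_cast
      ring
    rw [this]
  have e3 : legendreP (n + 1) = C (2 * ((n : ℝ) + 2)) * C a * derivative^[n + 1] q := by
    rw [legendreP, ← C_mul, ← legendreP_const (n + 1), ha]
    congr 2
    push_cast
    ring
  have e4 : derivative (legendreP (n + 1)) = C (2 * ((n : ℝ) + 2)) * C a * derivative^[n + 2] q := by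
    rw [e3, ← C_mul, derivative_C_mul, ← Function.iterate_succ_apply' derivative]
  have hC : C (2 * ((n : ℝ) + 2)) = 2 * ((n : ℝ[X]) + 2) := by
    simp only [C_mul, C_add, C_eq_natCast, C_ofNat]
  rw [hC] at e3 e4
  rw [e4, e3]
  push_cast
  -- Twice the expansion `e1` minus the expansion `e2` cancels the term with `derivative^[n] q`.
  have : ((n : ℝ[X]) + 1 + 1) * legendreP (n + 1 + 1) = ((n : ℝ[X]) + 2) * (2 * legendreP (n + 2) - legendreP (n + 2)) := by
    ring
  rw [this]
  nth_rewrite 1 [e1]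
  rw [e2]
  ring

open Polynomial in
theorem legendreP_recurrence (n : ℕ) :
    ((n : ℝ[X]) + 2) * legendreP (n + 2) =
      (2 * (n : ℝ[X]) + 3) * X * legendreP (n + 1) - ((n : ℝ[X]) + 1) * legendreP n := by
  have h1 := succ_mul_legendreP_succ (n + 1)
  have h2 := succ_mul_legendreP_succ n
  rw [derivative_legendreP_succ] at h1
  push_cast at h1
  linear_combination h1 - X * h2

open Polynomial in
theorem legendreP_eval_one (n : ℕ) : (legendreP n).eval 1 = 1 := by
  induction n with
  | zero => simp [legendreP_zero]
  | succ n ih =>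
    have h := congrArg (eval 1) (succ_mul_legendreP_succ n)
    simp [ih] at h
    have : (n : ℝ) + 1 ≠ 0 := by positivity
    exact (mul_eq_left₀ this).1 h

open Polynomial in
/-- The Legendre differential equation. -/
theorem legendreP_ode (n : ℕ) :
    (1 - X ^ 2) * derivative^[2] (legendreP n) - 2 * X * derivative (legendreP n)
      + (n : ℝ[X]) * ((n : ℝ[X]) + 1) * legendreP n = 0 := by
  have h2 := congrArg derivative (succ_mul_legendreP_succ n)
  have h1 := derivative_legendreP_succ n
  simp only [derivative_add, derivative_sub, derivative_mul, derivative_X_sq, h1,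
    derivative_one, derivative_X, derivative_natCast, C_ofNat] at h2
  simp only [Function.iterate_succ, Function.iterate_zero, Function.comp, id]
  linear_combination h2

/-! ### Polynomial solutions of the associated Legendre equation -/

open Polynomial in
/-- The operator `(1 - X²) f'' - 2 (m + 1) X f' + (n (n + 1) - m (m + 1)) f`, which annihilates
the `m`-th derivative of the `n`-th Legendre polynomial. -/
def legendreOp (n m : ℕ) (f : ℝ[X]) : ℝ[X] :=
  (1 - X ^ 2) * derivative (derivative f) - 2 * ((m : ℝ[X]) + 1) * X * derivative f
    + ((n : ℝ[X]) * ((n : ℝ[X]) + 1) - (m : ℝ[X]) * ((m : ℝ[X]) + 1)) * f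

open Polynomial in
theorem legendreOp_derivative (n m : ℕ) (f : ℝ[X]) :
    legendreOp n (m + 1) (derivative f) = derivative (legendreOp n m f) := by
  simp only [legendreOp, derivative_add, derivative_sub, derivative_mul, derivative_X_sq,
      derivative_one, derivative_X, derivative_natCast, derivative_ofNat, C_ofNat]
  push_cast
  ring

open Polynomial in
theorem legendreOp_iterate_derivative_legendreP (n k : ℕ) :
    legendreOp n k (derivative^[k] (legendreP n)) = 0 := by
  induction k with
  | zero => simpa [legendreOp] using legendreP_ode n
  | succ k ih =>
    rw [Function.iterate_succ_apply', legendreOp_derivative, ih, derivative_zero]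

-- The leading coefficient `1 - X ^ 2` vanishes at the singular point `1`, so there the equation
-- ties the derivative to the value.
open Polynomial in
theorem eval_one_derivative_of_legendreOp_eq_zero {n m : ℕ} {f : ℝ[X]}
    (h : legendreOp n m f = 0) :
    2 * ((m : ℝ) + 1) * (derivative f).eval 1 = (n * (n + 1) - m * (m + 1)) * f.eval 1 := by
  have h := congrArg (eval 1) h
  simp [legendreOp] at h
  linear_combination -h

-- Each derivative of a solution solves the equation with `m` raised by one. The relation at the
-- singular point therefore propagates the zero at `1` to every derivative, and a polynomial is
-- determined by its Taylor coefficients at `1`. This uniqueness is what proves the addition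
-- theorem.
open Polynomial in
theorem eq_zero_of_legendreOp_eq_zero {n m : ℕ} {f : ℝ[X]} (h : legendreOp n m f = 0)
    (h1 : f.eval 1 = 0) : f = 0 := by
  have key : ∀ k, legendreOp n (m + k) (derivative^[k] f) = 0 ∧ (derivative^[k] f).eval 1 = 0 := by
    intro k
    induction k with
    | zero => exact ⟨h, h1⟩
    | succ k ih =>
      rw [Function.iterate_succ_apply', ← add_assoc, legendreOp_derivative, ih.1, derivative_zero]
      refine ⟨rfl, ?_⟩
      have := eval_one_derivative_of_legendreOp_eq_zero ih.1
      rw [ih.2, mul_zero] at this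
      refine (mul_eq_zero.1 this).resolve_left ?_
      positivity
  refine eq_zero_of_hasseDeriv_eq_zero f 1 fun k => ?_
  have h2 := congrArg (eval 1) (congrFun (factorial_smul_hasseDeriv (R := ℝ) k) f)
  rw [(key k).2] at h2
  simpa [Nat.factorial_ne_zero] using h2

open Polynomial in
theorem legendreOp_sub (n m : ℕ) (f g : ℝ[X]) :
    legendreOp n m (f - g) = legendreOp n m f - legendreOp n m g := by
  simp only [legendreOp, derivative_sub]; ring

open Polynomial in
theorem legendreOp_C_mul (n m : ℕ) (a : ℝ) (f : ℝ[X]) :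
    legendreOp n m (C a * f) = C a * legendreOp n m f := by
  simp only [legendreOp, derivative_C_mul]; ring

open Polynomial in
theorem legendreOp_sum {ι : Type*} (n m : ℕ) (s : Finset ι) (f : ι → ℝ[X]) :
    legendreOp n m (∑ i ∈ s, f i) = ∑ i ∈ s, legendreOp n m (f i) := by
  simp only [legendreOp, derivative_sum, Finset.mul_sum, Finset.sum_add_distrib,
    Finset.sum_sub_distrib]

-- With `d_k` the value at `1`, the relation at the singular point reads `2 (k + 1) d_(k+1) = (n -
-- k) (n + k + 1) d_k`, starting from `P_n(1) = 1`.
open Polynomial in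
theorem iterate_derivative_legendreP_eval_one (n k : ℕ) (hk : k ≤ n) :
    (derivative^[k] (legendreP n)).eval 1 =
      ((n + k).factorial : ℝ) / (2 ^ k * k.factorial * (n - k).factorial) := by
  induction k with
  | zero =>
    have : (n.factorial : ℝ) ≠ 0 := by positivity
    simp [legendreP_eval_one, this]
  | succ k ih =>
    have h := eval_one_derivative_of_legendreOp_eq_zero
      (legendreOp_iterate_derivative_legendreP n k)
    rw [← Function.iterate_succ_apply' derivative] at h
    rw [ih (by omega)] at h
    obtain ⟨j, rfl⟩ := Nat.exists_eq_add_of_lt hk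
    rw [show k + j + 1 - (k + 1) = j by omega] 
    rw [show k + j + 1 - k = j + 1 by omega, Nat.factorial_succ j] at h
    rw [show k + j + 1 + (k + 1) = (k + j + 1 + k) + 1 by ring, Nat.factorial_succ, Nat.factorial_succ k]
    push_cast at h ⊢
    have h1 : (k : ℝ) + 1 ≠ 0 := by positivity
    have h2 : (j : ℝ) + 1 ≠ 0 := by positivity
    have h3 : (k.factorial : ℝ) ≠ 0 := by positivity
    have h4 : (j.factorial : ℝ) ≠ 0 := by positivity
    field_simp at h ⊢
    rw [pow_succ]
    apply mul_left_cancel₀ h2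
    linear_combination h

open Polynomial in
theorem natDegree_legendreP_le (n : ℕ) : (legendreP n).natDegree ≤ n := by
  refine (natDegree_C_mul_le _ _).trans ((natDegree_iterate_derivative _ _).trans ?_)
  have : ((X ^ 2 - 1 : ℝ[X]) ^ n).natDegree ≤ n * 2 := by
    refine natDegree_pow_le_of_le n ?_
    compute_degree
  omega

-- The parity of `P_n` is needed to turn `κ ^ d p (c / κ)` into a polynomial in `c` and `κ ^ 2`.
open Polynomial in
theorem legendreP_coeff_eq_zero (n : ℕ) : ∀ j, ¬ Even (n + j) → (legendreP n).coeff j = 0 := by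
  induction n using Nat.twoStepInduction with
  | zero =>
    intro j hj
    rw [legendreP_zero, coeff_one, if_neg]
    rintro rfl; simp at hj
  | one =>
    intro j hj
    rw [legendreP_one, coeff_X, if_neg]
    rintro rfl; simp at hj
  | more n h0 h1 =>
    intro j hj
    have h := congrArg (fun p => coeff p j) (legendreP_recurrence n)
    have e1 : ((n : ℝ[X]) + 2) = C ((n : ℝ) + 2) := by simp; rfl
    have e2 : (2 * (n : ℝ[X]) + 3) = C (2 * (n : ℝ) + 3) := by simp; rfl
    have e3 : ((n : ℝ[X]) + 1) = C ((n : ℝ) + 1) := by simp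
    rw [e1, e2, e3, mul_assoc] at h
    simp only [coeff_sub, coeff_C_mul] at h
    rw [h0 j (by intro h; apply hj; grind)] at h
    have : (X * legendreP (n + 1)).coeff j = 0 := by
      rcases j with _ | j
      · simp
      · rw [coeff_X_mul]
        exact h1 j (by intro h; apply hj; grind)
    rw [this] at h
    have h5 : (n : ℝ) + 2 ≠ 0 := by positivity
    simpa [h5] using h

/-! ### The addition theorem for Legendre functions -/

-- Here `g k` stands for `P_n^(k)(v X)`, and `ode` is the equation it satisfies. The result involves
-- only two neighbouring functions, `g (m + 2 * j)` and `g (m + 2 * j + 2)`, which makes the sum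
-- over `j` telescope. For `j = 0` the truncated exponent `j - 1` is harmless because of the factor
-- `j`.
open Polynomial in
theorem legendreOp_comp_mul_pow (n m j : ℕ) (v : ℝ) (g : ℕ → ℝ[X])
    (hg : ∀ k, derivative (g k) = C v * g (k + 1))
    (ode : ∀ k : ℕ, (1 - (C v * X) ^ 2) * g (k + 2)
      - 2 * ((k : ℝ[X]) + 1) * (C v * X) * g (k + 1)
      + ((n : ℝ[X]) * ((n : ℝ[X]) + 1) - (k : ℝ[X]) * ((k : ℝ[X]) + 1)) * g k = 0) :
    legendreOp n m (g (m + 2 * j) * (C (1 - v ^ 2) * (1 - X ^ 2)) ^ j) =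
      C (1 - v ^ 2) * (4 * (j : ℝ[X]) * ((j : ℝ[X]) + (m : ℝ[X])) * g (m + 2 * j)
          * (C (1 - v ^ 2) * (1 - X ^ 2)) ^ (j - 1)
        - g (m + 2 * j + 2) * (C (1 - v ^ 2) * (1 - X ^ 2)) ^ j) := by
  have hode := ode (m + 2 * j)
  have hv : (C (1 - v ^ 2) : ℝ[X]) = 1 - C v ^ 2 := by simp
  rw [hv]
  rcases j with _ | j
  · simp only [legendreOp, mul_zero, add_zero, pow_zero, mul_one, hg, derivative_C_mul] at hode ⊢
    push_cast
    linear_combination hode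
  · have hA : derivative ((1 - C v ^ 2) * (1 - X ^ 2) : ℝ[X]) = - 2 * (1 - C v ^ 2) * X := by
      rw [← hv, derivative_C_mul, derivative_sub, derivative_one, derivative_X_sq, C_ofNat]
      ring
    have hA2 : derivative (- 2 * (1 - C v ^ 2) * X : ℝ[X]) = - 2 * (1 - C v ^ 2) := by
      rw [← hv, show (-2 : ℝ[X]) = C (-2) by rw [C_neg, C_ofNat], ← C_mul, derivative_C_mul, derivative_X, mul_one]
    set A : ℝ[X] := (1 - C v ^ 2) * (1 - X ^ 2) with hAdef
    have hd : A * derivative (A ^ j) = (j : ℝ[X]) * A ^ j * (- 2 * (1 - C v ^ 2) * X) := by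
      rcases j with _ | j
      · simp
      · rw [derivative_pow_succ, hA]
        simp only [C_add, C_eq_natCast, C_1]
        push_cast
        ring
    have h1 : derivative (A ^ (j + 1)) = ((j : ℝ[X]) + 1) * A ^ j * (- 2 * (1 - C v ^ 2) * X) := by
      rw [derivative_pow_succ, hA]
      simp only [C_add, C_eq_natCast, C_1]
    simp only [legendreOp, derivative_mul, derivative_add, h1, hA2, hg, derivative_natCast,
      derivative_one, derivative_C, add_tsub_cancel_right]
    rw [pow_succ A j]
    generalize derivative (A ^ j) = dB at *
    generalize A ^ j = B at *
    push_cast at hode ⊢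
    rw [hAdef] at hd ⊢
    linear_combination (1 - C v ^ 2) * (1 - X ^ 2) * B * hode
      - 2 * X * g (m + 2 * (j + 1)) * ((j : ℝ[X]) + 1) * hd

open Polynomial in
/-- The coefficient of `z ^ m` in `P_n (u v + (z + A / z) / 2)`, where
`A = (1 - u ^ 2) (1 - v ^ 2)`, as a polynomial in `u`. -/
def legendreCoeff (n m : ℕ) (v : ℝ) : ℝ[X] :=
  ∑ j ∈ Finset.range (n + 1), C ((1 : ℝ) / (2 ^ (m + 2 * j) * j.factorial * (m + j).factorial)) *
    ((derivative^[m + 2 * j] (legendreP n)).comp (C v * X) *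
      (C (1 - v ^ 2) * (1 - X ^ 2)) ^ j)

open Polynomial in
theorem C_legendreCoeff_const (m j : ℕ) :
(C ((1 : ℝ) / (2 ^ (m + 2 * (j + 1)) * (j + 1).factorial * (m + (j + 1)).factorial)) : ℝ[X])
 * (4 * ((j : ℝ[X]) + 1) * ((j : ℝ[X]) + 1 + (m : ℝ[X]))) =
 C ((1 : ℝ) / (2 ^ (m + 2 * j) * j.factorial * (m + j).factorial)) := by
  have : (4 * ((j : ℝ[X]) + 1) * ((j : ℝ[X]) + 1 + (m : ℝ[X])))
      = C (4 * ((j : ℝ) + 1) * ((j : ℝ) + 1 + m)) := by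
    simp only [C_mul, C_add, C_eq_natCast, C_1, C_ofNat]
  rw [this, ← C_mul]
  congr 1
  rw [Nat.factorial_succ, ← add_assoc, Nat.factorial_succ]
  have h1 : (j.factorial : ℝ) ≠ 0 := by positivity
  have h2 : ((m + j).factorial : ℝ) ≠ 0 := by positivity
  push_cast
  have h3 : (j : ℝ) + 1 ≠ 0 := by positivity
  have h4 : (m : ℝ) + j + 1 ≠ 0 := by positivity
  have h5 : (j : ℝ) + 1 + m ≠ 0 := by positivity
  field_simp
  ring

open Polynomial in
theorem legendreOp_legendreCoeff (n m : ℕ) (v : ℝ) :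
    legendreOp n m (legendreCoeff n m v) = 0 := by
  set g : ℕ → ℝ[X] := fun k => (derivative^[k] (legendreP n)).comp (C v * X) with hgdef
  have hg : ∀ k, derivative (g k) = C v * g (k + 1) := by
    intro k
    simp only [hgdef, derivative_comp, derivative_C_mul, derivative_X, mul_one,
      Function.iterate_succ_apply']
  have ode : ∀ k : ℕ, (1 - (C v * X) ^ 2) * g (k + 2)
      - 2 * ((k : ℝ[X]) + 1) * (C v * X) * g (k + 1)
      + ((n : ℝ[X]) * ((n : ℝ[X]) + 1) - (k : ℝ[X]) * ((k : ℝ[X]) + 1)) * g k = 0 := by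
    intro k
    have h : (legendreOp n k (derivative^[k] (legendreP n))).comp (C v * X) = 0 := by
      rw [legendreOp_iterate_derivative_legendreP, zero_comp]
    rw [legendreOp, ← Function.iterate_succ_apply' derivative,
      ← Function.iterate_succ_apply' derivative] at h
    simp only [add_comp, sub_comp, mul_comp, pow_comp, X_comp, one_comp, natCast_comp,
      ofNat_comp] at h
    exact h
  set A : ℝ[X] := C (1 - v ^ 2) * (1 - X ^ 2) with hA
  -- The part of the `j`-th term that lowers the power of `A`. By `C_legendreCoeff_const` the other
  -- part is `s (j + 1)`, so the sum collapses to its two ends: one has the factor `0`, the other a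
  -- derivative of order greater than `n`.
  set s : ℕ → ℝ[X] := fun j => C ((1 : ℝ) / (2 ^ (m + 2 * j) * j.factorial * (m + j).factorial)) *
    (C (1 - v ^ 2) * (4 * (j : ℝ[X]) * ((j : ℝ[X]) + (m : ℝ[X])) * g (m + 2 * j) * A ^ (j - 1)))
    with hs
  have hterm : ∀ j, legendreOp n m
      (C ((1 : ℝ) / (2 ^ (m + 2 * j) * j.factorial * (m + j).factorial)) * (g (m + 2 * j) * A ^ j)) =
      s j - s (j + 1) := by
    intro j
    rw [legendreOp_C_mul, hA, legendreOp_comp_mul_pow n m j v g hg ode, hs]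
    have hc := C_legendreCoeff_const m j
    simp only [add_tsub_cancel_right]
    rw [← hc, show m + 2 * (j + 1) = m + 2 * j + 2 by ring]
    push_cast
    ring
  rw [legendreCoeff, legendreOp_sum, Finset.sum_congr rfl fun j _ => hterm j,
    Finset.sum_range_sub']
  have h0 : s 0 = 0 := by simp [hs]
  have h1 : s (n + 1) = 0 := by
    have : g (m + 2 * (n + 1)) = 0 := by
      have : derivative^[m + 2 * (n + 1)] (legendreP n) = 0 := by
        apply iterate_derivative_eq_zero
        have := natDegree_legendreP_le n
        omega
      simp [hgdef, this]
    simp [hs, this]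
  rw [h0, h1, sub_zero]

-- Both sides solve the same associated Legendre equation in `u`, so it suffices to compare them at
-- `u = 1`. There `1 - u ^ 2` vanishes and only the term `j = 0` of the sum survives.
open Polynomial in
theorem eval_legendreCoeff (n m : ℕ) (hm : m ≤ n) (u v : ℝ) :
    (legendreCoeff n m v).eval u = ((n - m).factorial : ℝ) / (n + m).factorial *
      (derivative^[m] (legendreP n)).eval u * (derivative^[m] (legendreP n)).eval v := by
  have h : legendreCoeff n m v - C (((n - m).factorial : ℝ) / (n + m).factorial *
      (derivative^[m] (legendreP n)).eval v) * derivative^[m] (legendreP n) = 0 := by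
    refine eq_zero_of_legendreOp_eq_zero (n := n) (m := m) ?_ ?_
    · rw [legendreOp_sub, legendreOp_C_mul, legendreOp_legendreCoeff,
        legendreOp_iterate_derivative_legendreP]
      simp
    · rw [eval_sub, eval_C_mul, iterate_derivative_legendreP_eval_one n m hm, legendreCoeff,
        eval_finsetSum, Finset.sum_eq_single 0]
      · have h1 : ((n - m).factorial : ℝ) ≠ 0 := by positivity
        have h2 : ((n + m).factorial : ℝ) ≠ 0 := by positivity
        have h3 : (m.factorial : ℝ) ≠ 0 := by positivity
        simp
        field_simp
        ring
      · intro j _ hj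
        simp [hj]
      · simp
  have := congrArg (eval u) h
  simp only [eval_sub, eval_C_mul, eval_zero] at this
  linear_combination this

theorem cos_pow_eq_sum_antidiagonal (k : ℕ) (ψ : ℝ) :
    (Complex.cos ψ) ^ k = ∑ p ∈ Finset.HasAntidiagonal.antidiagonal k, (k.choose p.1 : ℂ) / 2 ^ k *
      Complex.exp (Complex.I * (((p.1 : ℤ) - (p.2 : ℤ) : ℤ) : ℂ) * ψ) := by
  have : Complex.cos ψ = (Complex.exp (ψ * Complex.I) + Complex.exp (-ψ * Complex.I)) / 2 := rfl
  rw [this, div_pow, (Commute.all _ _).add_pow', Finset.sum_div]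
  refine Finset.sum_congr rfl fun p _ => ?_
  rw [← Complex.exp_nat_mul, ← Complex.exp_nat_mul, ← Complex.exp_add, nsmul_eq_mul,
    mul_div_right_comm]
  congr 2
  push_cast
  ring

open Polynomial in
theorem eval_add_eq_sum_iterate_derivative (p : ℝ[X]) (n : ℕ) (hp : p.natDegree ≤ n) (t w : ℝ) :
    p.eval (t + w) =
      ∑ k ∈ Finset.range (n + 1), (derivative^[k] p).eval t / k.factorial * w ^ k := by
  rw [add_comm, ← taylor_eval, eval_eq_sum_range' (n := n + 1) (by rw [natDegree_taylor]; omega)]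
  refine Finset.sum_congr rfl fun k _ => ?_
  rw [taylor_coeff]
  have h2 := congrArg (eval t) (congrFun (factorial_smul_hasseDeriv (R := ℝ) k) p)
  have : (k.factorial : ℝ) ≠ 0 := by positivity
  rw [← h2]
  rw [show (k.factorial • hasseDeriv k) p = k.factorial • hasseDeriv k p from rfl, eval_smul,
    nsmul_eq_mul, mul_div_cancel_left₀ _ this]

open Polynomial in
/-- The addition theorem for the associated Legendre functions. -/
theorem legendreP_addition (n : ℕ) (u v s ψ : ℝ) (hs : s ^ 2 = (1 - u ^ 2) * (1 - v ^ 2)) :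
    (((legendreP n).eval (u * v + s * Real.cos ψ) : ℝ) : ℂ) =
      ∑ m ∈ Finset.Icc (-(n : ℤ)) n,
        ((((n - m.natAbs).factorial : ℝ) / (n + m.natAbs).factorial *
          (derivative^[m.natAbs] (legendreP n)).eval u *
          (derivative^[m.natAbs] (legendreP n)).eval v * s ^ m.natAbs : ℝ) : ℂ) *
        Complex.exp (Complex.I * m * ψ) := by
  -- Taylor expansion at `u * v` in the increment `s cos ψ`. The powers of the cosine are expanded
  -- in exponentials, which gives a sum over pairs `(a, b)` with frequency `a - b`; regrouping by `a
  -- - b = m` yields the coefficient `legendreCoeff`.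
  set d : ℕ → ℝ := fun k => (derivative^[k] (legendreP n)).eval (u * v) with hd
  have hd0 : ∀ k, n < k → d k = 0 := by
    intro k hk
    have : derivative^[k] (legendreP n) = 0 := by
      apply iterate_derivative_eq_zero
      have := natDegree_legendreP_le n
      omega
    simp [hd, this]
  set H : ℕ × ℕ → ℂ := fun p => ((d (p.1 + p.2) / (2 ^ (p.1 + p.2) * p.1.factorial *
    p.2.factorial) * s ^ (p.1 + p.2) : ℝ) : ℂ) *
    Complex.exp (Complex.I * (((p.1 : ℤ) - (p.2 : ℤ) : ℤ) : ℂ) * ψ) with hH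
  -- A square of pairs is convenient for regrouping; outside the triangle `a + b ≤ n` the terms
  -- vanish since `P_n` has degree at most `n`.
  set S := Finset.range (n + 1) ×ˢ Finset.range (n + 1) with hS
  have hL : (((legendreP n).eval (u * v + s * Real.cos ψ) : ℝ) : ℂ) = ∑ p ∈ S, H p := by
    rw [eval_add_eq_sum_iterate_derivative _ n (natDegree_legendreP_le n)]
    have h1 : ∑ p ∈ S, H p = ∑ p ∈ S with p.1 + p.2 ≤ n, H p := by
      rw [Finset.sum_filter_of_ne]
      intro p _ hp
      by_contra h
      apply hp
      simp [hH, hd0 _ (not_le.1 h)]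
    rw [h1, ← Finset.sum_fiberwise_of_maps_to (t := Finset.range (n + 1))
      (g := fun p : ℕ × ℕ => p.1 + p.2) (by intro p hp; simp at hp ⊢; omega)]
    push_cast
    refine Finset.sum_congr rfl fun k hk => ?_
    have h2 : ({p ∈ {p ∈ S | p.1 + p.2 ≤ n} | p.1 + p.2 = k}) = Finset.HasAntidiagonal.antidiagonal k := by
      ext p
      simp [hS] at hk ⊢
      omega
    rw [h2, mul_pow, cos_pow_eq_sum_antidiagonal, Finset.mul_sum, Finset.mul_sum]
    refine Finset.sum_congr rfl fun p hp => ?_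
    rw [Finset.HasAntidiagonal.mem_antidiagonal] at hp
    have h3 : (k.choose p.1 : ℂ) = k.factorial / (p.1.factorial * p.2.factorial) := by
      rw [← hp, Nat.cast_add_choose]
    rw [h3]
    simp only [hH, hp]
    push_cast
    have h4 : (k.factorial : ℂ) ≠ 0 := by exact_mod_cast k.factorial_ne_zero
    have h5 : (p.1.factorial : ℂ) ≠ 0 := by exact_mod_cast p.1.factorial_ne_zero
    have h6 : (p.2.factorial : ℂ) ≠ 0 := by exact_mod_cast p.2.factorial_ne_zero
    simp only [hd]
    field_simp
  rw [hL, ← Finset.sum_fiberwise_of_maps_to (t := Finset.Icc (-(n : ℤ)) n)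
      (g := fun p : ℕ × ℕ => (p.1 : ℤ) - p.2) (by intro p hp; simp [hS] at hp ⊢; omega)]
  refine Finset.sum_congr rfl fun m hm => ?_
  have hmn : m.natAbs ≤ n := by simp at hm; omega
  have hm2 : ((n - m.natAbs).factorial : ℝ) / (n + m.natAbs).factorial *
          (derivative^[m.natAbs] (legendreP n)).eval u *
          (derivative^[m.natAbs] (legendreP n)).eval v * s ^ m.natAbs =
      ∑ j ∈ Finset.range (n + 1), d (m.natAbs + 2 * j) / (2 ^ (m.natAbs + 2 * j) * j.factorial *
        (m.natAbs + j).factorial) * s ^ (m.natAbs + 2 * j) := by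
    rw [← eval_legendreCoeff n _ hmn, legendreCoeff, eval_finsetSum, Finset.sum_mul]
    refine Finset.sum_congr rfl fun j _ => ?_
    have : s ^ (m.natAbs + 2 * j) = s ^ m.natAbs * ((1 - v ^ 2) * (1 - u ^ 2)) ^ j := by
      rw [pow_add, pow_mul, hs, mul_comm (1 - u ^ 2)]
    rw [this]
    simp [hd, mul_comm v u]
    ring
  rw [hm2]
  push_cast
  rw [Finset.sum_mul]
  -- A pair with difference `m` is determined by its smaller entry `j`, the larger one being `|m| +
  -- j`. Indices `j` that come from no pair in the square have `|m| + 2j > n` and contribute zero.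
  refine Finset.sum_of_injOn (fun p => min p.1 p.2) ?_ ?_ ?_ ?_
  · intro p hp q hq h
    simp at hp hq h
    ext <;> omega
  · intro p hp
    simp [hS] at hp ⊢
    omega
  · intro j hj hj2
    rw [hd0]
    · simp
    by_contra hlt
    apply hj2
    simp only [Set.mem_image, Finset.coe_filter, Set.mem_ofPred_eq, hS, Finset.mem_product,
      Finset.mem_range]
    rcases le_total 0 m with h | h
    · exact ⟨(m.natAbs + j, j), by refine ⟨⟨⟨?_, ?_⟩, ?_⟩, ?_⟩ <;> dsimp only <;> omega⟩
    · exact ⟨(j, m.natAbs + j), by refine ⟨⟨⟨?_, ?_⟩, ?_⟩, ?_⟩ <;> dsimp only <;> omega⟩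
  · intro p hp
    simp [hS] at hp
    have e1 : m.natAbs + 2 * min p.1 p.2 = p.1 + p.2 := by omega
    have e2 : (min p.1 p.2).factorial * (m.natAbs + min p.1 p.2).factorial =
        p.1.factorial * p.2.factorial := by
      rcases le_total p.1 p.2 with h | h
      · rw [min_eq_left h, show m.natAbs + p.1 = p.2 by omega]
      · rw [min_eq_right h, show m.natAbs + p.2 = p.1 by omega, mul_comm]
    have e3 : ((min p.1 p.2).factorial : ℂ) * ((m.natAbs + min p.1 p.2).factorial : ℂ) =
        p.1.factorial * p.2.factorial := by exact_mod_cast e2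
    rw [e1, mul_assoc (2 ^ (p.1 + p.2) : ℂ), e3, ← hp.2]
    simp only [hH]
    push_cast
    ring

/-! ### Homogenized Legendre polynomials and their derivatives -/

/-- The homogenized Legendre polynomial `v ^ (n / 2) P_n (c / √v)`, as a polynomial in `c` and `v`,
defined by the three-term recurrence. -/
def zonal : ℕ → ℝ → ℝ → ℝ
  | 0, _, _ => 1
  | 1, c, _ => c
  | n + 2, c, v =>
    ((2 * (n : ℝ) + 3) * c * zonal (n + 1) c v - ((n : ℝ) + 1) * v * zonal n c v) / ((n : ℝ) + 2)

/-- The derivative of `zonal n` with respect to its first variable. -/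
def zonalD : ℕ → ℝ → ℝ → ℝ
  | 0, _, _ => 0
  | 1, _, _ => 1
  | n + 2, c, v => (2 * (n : ℝ) + 3) * zonal (n + 1) c v + v * zonalD n c v

/-- The second derivative of `zonal n` with respect to its first variable. -/
def zonalDD : ℕ → ℝ → ℝ → ℝ
  | 0, _, _ => 0
  | 1, _, _ => 0
  | n + 2, c, v => (2 * (n : ℝ) + 3) * zonalD (n + 1) c v + v * zonalDD n c v

theorem zonal_add_two (n : ℕ) (c v : ℝ) : ((n : ℝ) + 2) * zonal (n + 2) c v =
    (2 * (n : ℝ) + 3) * c * zonal (n + 1) c v - ((n : ℝ) + 1) * v * zonal n c v := by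
  rw [zonal]; field_simp

theorem zonal_eq_legendreP (n : ℕ) (κ t : ℝ) :
    zonal n (κ * t) (κ ^ 2) = κ ^ n * (legendreP n).eval t := by
  induction n using Nat.twoStepInduction with
  | zero => simp [zonal, legendreP_zero]
  | one => simp [zonal, legendreP_one]
  | more n h0 h1 =>
    have h := congrArg (Polynomial.eval t) (legendreP_recurrence n)
    simp at h
    have h2 : (n : ℝ) + 2 ≠ 0 := by positivity
    apply mul_left_cancel₀ h2
    rw [zonal_add_two, h0, h1]
    linear_combination (-κ ^ (n + 2)) * h

/-- Homogenized forms of `x P'_(n+1) - P'_n = (n + 1) P_(n+1)` and `P'_(n+1) = x P'_n + (n + 1)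
P_n`. They are proved jointly since the induction step of each uses the other. -/
theorem zonalD_identities (n : ℕ) (c v : ℝ) :
    c * zonalD (n + 1) c v - v * zonalD n c v = ((n : ℝ) + 1) * zonal (n + 1) c v ∧
      zonalD (n + 1) c v = c * zonalD n c v + ((n : ℝ) + 1) * zonal n c v := by
  induction n with
  | zero => simp [zonal, zonalD]
  | succ n ih =>
    have h := zonal_add_two n c v
    have hd : zonalD (n + 2) c v = (2 * (n : ℝ) + 3) * zonal (n + 1) c v + v * zonalD n c v := rfl
    push_cast
    constructor
    · rw [hd]
      linear_combination (-v) * ih.2 - h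
    · rw [hd]
      linear_combination -ih.1

section deriv

variable {E : Type*} [NormedAddCommGroup E] [NormedSpace ℝ E] {f g : E → ℝ} {f' g' : E →L[ℝ] ℝ}
  {x : E}

/-- The derivative in the second variable is minus half of `zonalD (n - 1)`. This matches Euler's
identity `c ∂_c + 2 v ∂_v = n` combined with the first of `zonalD_identities`. For `n = 0` the
truncated index is harmless because `zonalD 0` is zero. -/
theorem HasFDerivAt.zonal (hf : HasFDerivAt f f' x) (hg : HasFDerivAt g g' x) (n : ℕ) :
    HasFDerivAt (fun y => zonal n (f y) (g y))
      (zonalD n (f x) (g x) • f' - (zonalD (n - 1) (f x) (g x) / 2) • g') x := by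
  induction n using Nat.twoStepInduction with
  | zero => simpa [_root_.zonal, zonalD] using hasFDerivAt_const (1 : ℝ) x
  | one => simpa [_root_.zonal, zonalD] using hf
  | more n h0 h1 =>
    have h := (((hf.mul h1).const_mul (2 * (n : ℝ) + 3)).sub
      ((hg.mul h0).const_mul ((n : ℝ) + 1))).mul_const ((n : ℝ) + 2)⁻¹
    have hid := (zonalD_identities n (f x) (g x)).1
    have hid2 : g x * zonalD (n - 1) (f x) (g x) =
        f x * zonalD n (f x) (g x) - n * _root_.zonal n (f x) (g x) := by
      rcases n with _ | n
      · simp [zonalD]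
      · have := (zonalD_identities n (f x) (g x)).1
        push_cast
        linear_combination -this
    have hid3 := (zonalD_identities n (f x) (g x)).2
    have hd : zonalD (n + 2) (f x) (g x) =
      (2 * (n : ℝ) + 3) * _root_.zonal (n + 1) (f x) (g x) + g x * zonalD n (f x) (g x) := rfl
    have hn : (n : ℝ) + 2 ≠ 0 := by positivity
    refine HasFDerivAt.congr_fderiv (h.congr_of_eventuallyEq (.of_forall fun y => ?_)) ?_
    · simp only [_root_.zonal, Pi.mul_apply, Pi.sub_apply]
      ring
    · ext w
      simp only [smul_apply, sub_apply,
        add_apply, smul_eq_mul, add_tsub_cancel_right, hd]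
      rw [show n + 2 - 1 = n + 1 by omega]
      apply mul_left_cancel₀ hn
      field_simp
      linear_combination (2 * (2 * (n : ℝ) + 3) * f' w) * hid + ((n : ℝ) + 1) * g' w * hid2
        + ((n : ℝ) + 2) * g' w * hid3

theorem HasFDerivAt.zonalD (hf : HasFDerivAt f f' x) (hg : HasFDerivAt g g' x) (n : ℕ) :
    HasFDerivAt (fun y => zonalD n (f y) (g y))
      (zonalDD n (f x) (g x) • f' - (zonalDD (n - 1) (f x) (g x) / 2) • g') x := by
  induction n using Nat.twoStepInduction with
  | zero => simpa [_root_.zonalD, zonalDD] using hasFDerivAt_const (0 : ℝ) x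
  | one => simpa [_root_.zonalD, zonalDD] using hasFDerivAt_const (1 : ℝ) x
  | more n h0 h1 =>
    have h := ((hf.zonal hg (n + 1)).const_mul (2 * (n : ℝ) + 3)).add (hg.mul h0)
    have hd : zonalDD (n + 2) (f x) (g x) =
      (2 * (n : ℝ) + 3) * _root_.zonalD (n + 1) (f x) (g x) + g x * zonalDD n (f x) (g x) := rfl
    have hd1 : zonalDD (n + 1) (f x) (g x) = (2 * (n : ℝ) + 1) * _root_.zonalD n (f x) (g x)
        + g x * zonalDD (n - 1) (f x) (g x) := by
      rcases n with _ | n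
      · simp [zonalDD, _root_.zonalD]
      · simp only [zonalDD, add_tsub_cancel_right]; push_cast; ring
    refine HasFDerivAt.congr_fderiv (h.congr_of_eventuallyEq (.of_forall fun y => ?_)) ?_
    · simp only [_root_.zonalD, Pi.mul_apply, Pi.add_apply]
    · ext w
      simp only [smul_apply, sub_apply,
        add_apply, smul_eq_mul, add_tsub_cancel_right, hd]
      rw [show n + 2 - 1 = n + 1 by omega, hd1]
      ring

end deriv

/-! ### The generating function and bounds for Legendre polynomials -/

/-- The coefficients of `(1 - z) ^ (-1/2)`. -/
def invSqrtCoeff (j : ℕ) : ℝ := j.centralBinom / 4 ^ j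

theorem invSqrtCoeff_nonneg (j : ℕ) : 0 ≤ invSqrtCoeff j := by unfold invSqrtCoeff; positivity

theorem invSqrtCoeff_succ (j : ℕ) :
    2 * ((j : ℝ) + 1) * invSqrtCoeff (j + 1) = (2 * j + 1) * invSqrtCoeff j := by
  have h : ((j : ℝ) + 1) * (j + 1).centralBinom = 2 * (2 * j + 1) * j.centralBinom := by
    exact_mod_cast Nat.succ_mul_centralBinom_succ j
  rw [invSqrtCoeff, invSqrtCoeff, pow_succ]
  field_simp
  linear_combination 2 * h

-- The formal power series of `(1 - α z) ^ (-1/2)` is handled through its first-order equation,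
-- which avoids any choice of root.
open PowerSeries in
theorem invSqrt_ode (α : ℂ) :
    2 * (1 - C α * X) * (d⁄dX ℂ) (mk fun j => (invSqrtCoeff j : ℂ) * α ^ j) =
      C α * mk fun j => (invSqrtCoeff j : ℂ) * α ^ j := by
  ext n
  have h : 2 * ((n : ℂ) + 1) * (invSqrtCoeff (n + 1) : ℂ) = (2 * n + 1) * invSqrtCoeff n := by
    exact_mod_cast invSqrtCoeff_succ n
  have e : 2 * (1 - C α * X) * (d⁄dX ℂ) (mk fun j => (invSqrtCoeff j : ℂ) * α ^ j) =
    C (2 : ℂ) * ((d⁄dX ℂ) (mk fun j => (invSqrtCoeff j : ℂ) * α ^ j) -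
      C α * (X * (d⁄dX ℂ) (mk fun j => (invSqrtCoeff j : ℂ) * α ^ j))) := by
    rw [show (C (2 : ℂ) : ℂ⟦X⟧) = 2 from map_ofNat _ 2]; ring
  rw [e, coeff_C_mul, coeff_C_mul, map_sub, coeff_C_mul, coeff_derivative, coeff_mk, coeff_mk]
  rcases n with _ | n
  · simp at h ⊢
    linear_combination α * h
  · rw [coeff_succ_X_mul, coeff_derivative, coeff_mk]
    push_cast at h ⊢
    linear_combination α ^ (n + 2) * h

-- If `1 - 2cz + vz² = (1 - αz)(1 - α'z)`, the product `G` of the two inverse square root series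
-- satisfies `(1 - 2cz + vz²) G' = (c - vz) G`. Comparing coefficients gives the three-term
-- recurrence of `zonal`.
open PowerSeries in
theorem zonal_eq_sum_antidiagonal (n : ℕ) (α α' : ℂ) (c v : ℝ) (hc : α + α' = 2 * c)
    (hv : α * α' = v) :
    (zonal n c v : ℂ) = ∑ p ∈ Finset.HasAntidiagonal.antidiagonal n,
      ((invSqrtCoeff p.1 : ℂ) * α ^ p.1) * ((invSqrtCoeff p.2 : ℂ) * α' ^ p.2) := by
  set G : ℂ⟦X⟧ := (mk fun j => (invSqrtCoeff j : ℂ) * α ^ j) *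
    (mk fun j => (invSqrtCoeff j : ℂ) * α' ^ j) with hG
  have hode : (d⁄dX ℂ) G - C (2 * c : ℂ) * (X * (d⁄dX ℂ) G) + C (v : ℂ) * (X * (X * (d⁄dX ℂ) G))
      = C (c : ℂ) * G - C (v : ℂ) * (X * G) := by
    have h1 := invSqrt_ode α
    have h2 := invSqrt_ode α'
    have hCc : C (2 * c : ℂ) = C α + C α' := by rw [← hc, map_add]
    have hCv : C (v : ℂ) = C α * C α' := by rw [← hv, map_mul]
    have h2c : 2 * C (c : ℂ) = C α + C α' := by
      rw [← hCc, map_mul]; congr 1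
    have h20 : (C (2 : ℂ) : ℂ⟦X⟧) = 2 := map_ofNat _ 2
    have h2ne : (2 : ℂ⟦X⟧) ≠ 0 := by
      rw [← h20]; intro h; have := congrArg (coeff 0) h; simp at this
    apply mul_left_cancel₀ h2ne
    rw [hCc, hCv, hG, Derivation.leibniz, smul_eq_mul, smul_eq_mul]
    linear_combination (1 - C α' * X) * (mk fun j => (invSqrtCoeff j : ℂ) * α' ^ j) * h1
      + (1 - C α * X) * (mk fun j => (invSqrtCoeff j : ℂ) * α ^ j) * h2
      - (mk fun j => (invSqrtCoeff j : ℂ) * α ^ j) * (mk fun j => (invSqrtCoeff j : ℂ) * α' ^ j)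
        * h2c
  have hrec : ∀ n : ℕ, ((n : ℂ) + 2) * coeff (n + 2) G =
      (2 * (n : ℂ) + 3) * c * coeff (n + 1) G - ((n : ℂ) + 1) * v * coeff n G := by
    intro n
    have h := congrArg (coeff (n + 1)) hode
    simp only [map_add, map_sub, coeff_C_mul, coeff_succ_X_mul, coeff_derivative] at h
    have h3 : coeff n (X * (d⁄dX ℂ) G) = n * coeff n G := by
      rcases n with _ | n
      · simp
      · rw [coeff_succ_X_mul, coeff_derivative]; push_cast; ring
    rw [h3] at h
    push_cast at h
    linear_combination h
  have key : ∀ n, (zonal n c v : ℂ) = coeff n G := by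
    intro n
    induction n using Nat.twoStepInduction with
    | zero => simp [zonal, hG, coeff_mul, invSqrtCoeff]
    | one =>
      have h := congrArg (coeff 0) hode
      have h0 : coeff 0 G = 1 := by
        simp [hG, coeff_mul, invSqrtCoeff]
      rw [map_add, map_sub, map_sub, coeff_C_mul, coeff_C_mul, coeff_C_mul, coeff_C_mul,
        coeff_zero_X_mul, coeff_zero_X_mul, coeff_zero_X_mul, coeff_derivative, h0] at h
      simp at h
      rw [h, zonal]
    | more n h0 h1 =>
      have h2 : (n : ℂ) + 2 ≠ 0 := by exact_mod_cast (by positivity : (n : ℝ) + 2 ≠ 0)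
      apply mul_left_cancel₀ h2
      rw [hrec, ← h0, ← h1]
      exact_mod_cast zonal_add_two n c v
  rw [key, hG, coeff_mul]
  simp only [coeff_mk]

theorem zonal_one_one (n : ℕ) : zonal n 1 1 = 1 := by
  simpa [legendreP_eval_one] using zonal_eq_legendreP n 1 1

/-- The square of `(1 - z) ^ (-1/2)` is the geometric series; here this is read off from `P_n(1) =
1`. -/
theorem sum_antidiagonal_invSqrtCoeff (n : ℕ) :
    ∑ p ∈ Finset.HasAntidiagonal.antidiagonal n, invSqrtCoeff p.1 * invSqrtCoeff p.2 = 1 := by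
  have h := zonal_eq_sum_antidiagonal n 1 1 1 1 (by norm_num) (by norm_num)
  rw [zonal_one_one] at h
  simp at h
  exact_mod_cast h.symm

theorem invSqrtCoeff_le_one (n : ℕ) : invSqrtCoeff n ≤ 1 := by
  have h := Finset.single_le_sum (f := fun p : ℕ × ℕ => invSqrtCoeff p.1 * invSqrtCoeff p.2)
    (s := Finset.HasAntidiagonal.antidiagonal n)
    (fun p _ => mul_nonneg (invSqrtCoeff_nonneg _) (invSqrtCoeff_nonneg _))
    (a := (n, 0)) (by simp)
  rw [sum_antidiagonal_invSqrtCoeff] at h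
  simpa [invSqrtCoeff] using h

/-- The complex number with real part `c` and squared modulus `v`. -/
theorem exists_complex_of_sq_le {c v : ℝ} (h : c ^ 2 ≤ v) :
    ∃ α : ℂ, α + (starRingEnd ℂ) α = 2 * c ∧ α * (starRingEnd ℂ) α = v ∧ ‖α‖ ^ 2 = v ∧
      Complex.normSq (1 - α) = 1 - 2 * c + v := by
  have hs : √(v - c ^ 2) ^ 2 = v - c ^ 2 := Real.sq_sqrt (by linarith)
  refine ⟨⟨c, √(v - c ^ 2)⟩, ?_, ?_, ?_, ?_⟩
  · rw [Complex.add_conj]; push_cast; rfl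
  · rw [Complex.mul_conj, Complex.normSq_mk]; congr 1; nlinarith
  · rw [← Complex.normSq_eq_norm_sq, Complex.normSq_mk]; nlinarith
  · rw [Complex.normSq_apply]; simp; nlinarith

/-- The homogenized bound `|P_n| ≤ 1`. With `α` and its conjugate as roots of modulus `κ`, every
term of the convolution has modulus `κ ^ n` times a nonnegative weight, and the weights add up to
`1`. -/
theorem abs_zonal_le {c κ : ℝ} (hκ : 0 ≤ κ) (h : c ^ 2 ≤ κ ^ 2) (n : ℕ) :
    |zonal n c (κ ^ 2)| ≤ κ ^ n := by
  obtain ⟨α, h1, h2, h3, -⟩ := exists_complex_of_sq_le h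
  have hα : ‖α‖ = κ := by
    rwa [sq_eq_sq₀ (norm_nonneg _) hκ] at h3
  have h4 := zonal_eq_sum_antidiagonal n α _ c (κ ^ 2) h1 h2
  rw [← Real.norm_eq_abs, ← Complex.norm_real, h4]
  refine (norm_sum_le _ _).trans (le_of_eq ?_)
  rw [← mul_one (κ ^ n), ← sum_antidiagonal_invSqrtCoeff n, Finset.mul_sum]
  refine Finset.sum_congr rfl fun p hp => ?_
  rw [Finset.HasAntidiagonal.mem_antidiagonal] at hp
  rw [norm_mul, norm_mul, norm_mul, norm_pow, norm_pow, RCLike.norm_conj, hα, Complex.norm_real,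
    Complex.norm_real, Real.norm_of_nonneg (invSqrtCoeff_nonneg _),
    Real.norm_of_nonneg (invSqrtCoeff_nonneg _), ← hp, pow_add]
  ring

/-- The Cauchy product of the inverse square root series at `α` and at its conjugate is `|w| ^ 2`,
where `w` is the first of them. Since `w ^ 2 = (1 - α)⁻¹`, it follows that `|w| ^ 2 = 1 / |1 - α|`,
and no branch of the square root has to be chosen. -/
theorem hasSum_zonal {c κ : ℝ} (hκ : 0 ≤ κ) (hκ1 : κ < 1) (h : c ^ 2 ≤ κ ^ 2) :
    HasSum (fun n => zonal n c (κ ^ 2)) (1 / √(1 - 2 * c + κ ^ 2)) := by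
  obtain ⟨α, h1, h2, h3, h5⟩ := exists_complex_of_sq_le h
  have hα : ‖α‖ = κ := by
    rwa [sq_eq_sq₀ (norm_nonneg _) hκ] at h3
  have hsum : ∀ a : ℂ, ‖a‖ = κ → Summable fun j => ‖(invSqrtCoeff j : ℂ) * a ^ j‖ := by
    intro a ha
    refine Summable.of_nonneg_of_le (fun _ => norm_nonneg _) (fun j => ?_)
      (summable_geometric_of_lt_one hκ hκ1)
    rw [norm_mul, norm_pow, ha, Complex.norm_real, Real.norm_of_nonneg (invSqrtCoeff_nonneg _)]
    exact mul_le_of_le_one_left (by positivity) (invSqrtCoeff_le_one j)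
  have hα' : ‖(starRingEnd ℂ) α‖ = κ := by rw [RCLike.norm_conj, hα]
  have hsq : (∑' j, (invSqrtCoeff j : ℂ) * α ^ j) * (∑' j, (invSqrtCoeff j : ℂ) * α ^ j) =
      (1 - α)⁻¹ := by
    rw [tsum_mul_tsum_eq_tsum_sum_antidiagonal_of_summable_norm (hsum α hα) (hsum α hα),
      ← tsum_geometric_of_norm_lt_one (by rw [hα]; exact hκ1)]
    refine tsum_congr fun n => ?_
    rw [← one_mul (α ^ n), ← Complex.ofReal_one, ← sum_antidiagonal_invSqrtCoeff n]
    push_cast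
    rw [Finset.sum_mul]
    refine Finset.sum_congr rfl fun p hp => ?_
    rw [Finset.HasAntidiagonal.mem_antidiagonal] at hp
    rw [← hp, pow_add]
    ring
  have hconj : (∑' j, (invSqrtCoeff j : ℂ) * ((starRingEnd ℂ) α) ^ j) =
      (starRingEnd ℂ) (∑' j, (invSqrtCoeff j : ℂ) * α ^ j) := by
    rw [Complex.conj_tsum]
    simp
  set w := ∑' j, (invSqrtCoeff j : ℂ) * α ^ j with hw
  have hprod : HasSum (fun n => (zonal n c (κ ^ 2) : ℂ)) ((Complex.normSq w : ℝ) : ℂ) := by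
    have := (summable_norm_sum_mul_antidiagonal_of_summable_norm (hsum α hα)
      (hsum _ hα')).of_norm.hasSum
    rw [← tsum_mul_tsum_eq_tsum_sum_antidiagonal_of_summable_norm (hsum α hα) (hsum _ hα'), hconj,
      Complex.mul_conj] at this
    simpa only [zonal_eq_sum_antidiagonal _ α _ c (κ ^ 2) h1 h2] using this
  have hval : Complex.normSq w = 1 / √(1 - 2 * c + κ ^ 2) := by
    rw [← h5, one_div, ← Real.sqrt_inv, ← map_inv₀ Complex.normSq, ← hsq, map_mul,
      Real.sqrt_mul_self (Complex.normSq_nonneg _)]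
  rw [← hval]
  exact_mod_cast hprod

theorem abs_zonalD_succ_le {c κ : ℝ} (hκ : 0 ≤ κ) (h : c ^ 2 ≤ κ ^ 2) (n : ℕ) :
    |zonalD (n + 1) c (κ ^ 2)| ≤ ((n : ℝ) + 1) ^ 2 * κ ^ n := by
  induction n using Nat.twoStepInduction with
  | zero => simp [zonalD]
  | one =>
    have : |c| ≤ κ := abs_le_of_sq_le_sq h hκ
    simp [zonalD, zonal, abs_mul]
    nlinarith [abs_nonneg c]
  | more n h0 h1 =>
    rw [show zonalD (n + 2 + 1) c (κ ^ 2) = (2 * ((n + 1 : ℕ) : ℝ) + 3) * zonal (n + 2) c (κ ^ 2)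
      + κ ^ 2 * zonalD (n + 1) c (κ ^ 2) from rfl]
    refine (abs_add_le _ _).trans ?_
    rw [abs_mul, abs_mul, abs_of_nonneg (by positivity : (0 : ℝ) ≤ 2 * ((n + 1 : ℕ) : ℝ) + 3),
      abs_of_nonneg (sq_nonneg κ)]
    calc _ ≤ (2 * ((n + 1 : ℕ) : ℝ) + 3) * κ ^ (n + 2) + κ ^ 2 * (((n : ℝ) + 1) ^ 2 * κ ^ n) := by
          gcongr
          exact abs_zonal_le hκ h _
      _ = (2 * ((n + 1 : ℕ) : ℝ) + 3 + ((n : ℝ) + 1) ^ 2) * κ ^ (n + 2) := by ring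
      _ ≤ _ := by
          gcongr
          push_cast
          nlinarith

theorem abs_zonalDD_add_two_le {c κ : ℝ} (hκ : 0 ≤ κ) (h : c ^ 2 ≤ κ ^ 2) (n : ℕ) :
    |zonalDD (n + 2) c (κ ^ 2)| ≤ ((n : ℝ) + 2) ^ 4 * κ ^ n := by
  induction n using Nat.twoStepInduction with
  | zero => simp [zonalDD, zonalD]; norm_num
  | one =>
    have : |c| ≤ κ := abs_le_of_sq_le_sq h hκ
    simp [zonalDD, zonalD, zonal, abs_mul]
    rw [show |(2 + 3 : ℝ)| = 5 by norm_num]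
    nlinarith [abs_nonneg c]
  | more n h0 h1 =>
    rw [show zonalDD (n + 2 + 2) c (κ ^ 2) = (2 * ((n + 2 : ℕ) : ℝ) + 3) * zonalD (n + 2 + 1) c (κ ^ 2)
      + κ ^ 2 * zonalDD (n + 2) c (κ ^ 2) from rfl]
    refine (abs_add_le _ _).trans ?_
    rw [abs_mul, abs_mul, abs_of_nonneg (by positivity : (0 : ℝ) ≤ 2 * ((n + 2 : ℕ) : ℝ) + 3),
      abs_of_nonneg (sq_nonneg κ)]
    calc _ ≤ (2 * ((n + 2 : ℕ) : ℝ) + 3) * ((((n + 2 : ℕ) : ℝ) + 1) ^ 2 * κ ^ (n + 2))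
            + κ ^ 2 * (((n : ℝ) + 2) ^ 4 * κ ^ n) := by
          gcongr
          exact abs_zonalD_succ_le hκ h _
      _ = ((2 * (n : ℝ) + 7) * ((n : ℝ) + 3) ^ 2 + ((n : ℝ) + 2) ^ 4) * κ ^ (n + 2) := by
          push_cast; ring
      _ ≤ _ := by
          gcongr
          push_cast
          have : (0 : ℝ) ≤ n := by positivity
          nlinarith [mul_nonneg this this, mul_nonneg this (mul_nonneg this this)]

/-! ### The terms of the expansion of the inverse distance and their derivatives -/

/-- The `n`-th term `ρ ^ n P_n (cos γ) / r ^ (n + 1)` of the expansion of `1 / |x - q|` about `S`. -/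
def multipole (n : ℕ) (S x q : E3) : ℝ :=
  ‖x - S‖⁻¹ * zonal n (inner ℝ (x - S) (q - S) * (‖x - S‖ ^ 2)⁻¹) (‖q - S‖ ^ 2 * (‖x - S‖ ^ 2)⁻¹)

/-- The directional derivative of `multipole n S x` at `q`. -/
def multipoleD (n : ℕ) (S x F q : E3) : ℝ :=
  (‖x - S‖ ^ 3)⁻¹ *
    (zonalD n (inner ℝ (x - S) (q - S) * (‖x - S‖ ^ 2)⁻¹) (‖q - S‖ ^ 2 * (‖x - S‖ ^ 2)⁻¹) *
        inner ℝ (x - S) F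
      - zonalD (n - 1) (inner ℝ (x - S) (q - S) * (‖x - S‖ ^ 2)⁻¹)
          (‖q - S‖ ^ 2 * (‖x - S‖ ^ 2)⁻¹) * inner ℝ (q - S) F)

/-- The second directional derivative of `multipole n S x` at `q`. -/
def multipoleDD (n : ℕ) (S x F E q : E3) : ℝ :=
  (‖x - S‖ ^ 3)⁻¹ *
    ((zonalDD n (inner ℝ (x - S) (q - S) * (‖x - S‖ ^ 2)⁻¹) (‖q - S‖ ^ 2 * (‖x - S‖ ^ 2)⁻¹) *
          inner ℝ (x - S) E
        - zonalDD (n - 1) (inner ℝ (x - S) (q - S) * (‖x - S‖ ^ 2)⁻¹)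
          (‖q - S‖ ^ 2 * (‖x - S‖ ^ 2)⁻¹) * inner ℝ (q - S) E) * (‖x - S‖ ^ 2)⁻¹ * inner ℝ (x - S) F
      - (zonalDD (n - 1) (inner ℝ (x - S) (q - S) * (‖x - S‖ ^ 2)⁻¹)
          (‖q - S‖ ^ 2 * (‖x - S‖ ^ 2)⁻¹) * inner ℝ (x - S) E
        - zonalDD (n - 2) (inner ℝ (x - S) (q - S) * (‖x - S‖ ^ 2)⁻¹)
          (‖q - S‖ ^ 2 * (‖x - S‖ ^ 2)⁻¹) * inner ℝ (q - S) E) * (‖x - S‖ ^ 2)⁻¹ * inner ℝ (q - S) F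
      - zonalD (n - 1) (inner ℝ (x - S) (q - S) * (‖x - S‖ ^ 2)⁻¹)
          (‖q - S‖ ^ 2 * (‖x - S‖ ^ 2)⁻¹) * inner ℝ E F)

theorem hasFDerivAt_inner_sub_mul (S y : E3) (a : ℝ) (q : E3) :
    HasFDerivAt (fun q : E3 => inner ℝ y (q - S) * a) (a • innerSL ℝ y) q := by
  have := ((innerSL ℝ y).hasFDerivAt.comp q ((hasFDerivAt_id q).sub_const S)).mul_const a
  simpa using this

theorem hasFDerivAt_norm_sub_sq_mul (S : E3) (a : ℝ) (q : E3) :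
    HasFDerivAt (fun q : E3 => ‖q - S‖ ^ 2 * a) (a • (2 : ℝ) • innerSL ℝ (q - S)) q := by
  have := (((hasFDerivAt_id q).sub_const S).norm_sq).mul_const a
  refine this.congr_fderiv ?_
  ext w
  simp

theorem hasFDerivAt_multipole (n : ℕ) (S x q : E3) : ∃ L : E3 →L[ℝ] ℝ,
    HasFDerivAt (multipole n S x) L q ∧ ∀ F, L F = multipoleD n S x F q := by
  refine ⟨_, (((hasFDerivAt_inner_sub_mul S (x - S) _ q).zonal
    (hasFDerivAt_norm_sub_sq_mul S _ q) n).const_mul _), fun F => ?_⟩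
  simp only [multipoleD, smul_apply, sub_apply, innerSL_apply_apply, smul_eq_mul]
  ring

theorem dipole_multipole (n : ℕ) (S x F q : E3) :
    dipole F (multipole n S x) q = multipoleD n S x F q := by
  obtain ⟨L, h1, h2⟩ := hasFDerivAt_multipole n S x q
  rw [dipole, h1.fderiv, h2]

theorem hasFDerivAt_multipoleD (n : ℕ) (S x F q : E3) : ∃ L : E3 →L[ℝ] ℝ,
    HasFDerivAt (multipoleD n S x F) L q ∧ ∀ E, L E = multipoleDD n S x F E q := by
  have hc := hasFDerivAt_inner_sub_mul S (x - S) (‖x - S‖ ^ 2)⁻¹ q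
  have hw := hasFDerivAt_norm_sub_sq_mul S (‖x - S‖ ^ 2)⁻¹ q
  have hF : HasFDerivAt (fun q : E3 => inner ℝ (q - S) F) (innerSL ℝ F) q := by
    have := (innerSL ℝ F).hasFDerivAt.comp q ((hasFDerivAt_id q).sub_const S)
    refine HasFDerivAt.congr_of_eventuallyEq (f := fun q => inner ℝ F (q - S)) ?_
      (.of_forall fun y => real_inner_comm _ _)
    simpa [Function.comp_def] using this
  refine ⟨_, (((hc.zonalD hw n).mul_const _).sub ((hc.zonalD hw (n - 1)).mul hF)).const_mul _,
    fun E => ?_⟩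
  simp only [multipoleDD, smul_apply, sub_apply, add_apply, innerSL_apply_apply, smul_eq_mul,
    Nat.sub_sub, Nat.reduceAdd, real_inner_comm E F]
  ring

theorem dipole_dipole_multipole (n : ℕ) (S x F E q : E3) :
    dipole E (fun y => dipole F (multipole n S x) y) q = multipoleDD n S x F E q := by
  simp_rw [dipole_multipole]
  obtain ⟨L, h1, h2⟩ := hasFDerivAt_multipoleD n S x F q
  rw [dipole, h1.fderiv, h2]

/-- A deliberately crude majorant, the same for first and second derivatives and for the shifts of
the index by 0, 1 and 2, so that one summable series serves for all of them. -/
theorem abs_zonalD_sub_le {c κ κ₀ : ℝ} (hκ : 0 ≤ κ) (h : c ^ 2 ≤ κ ^ 2) (hκ₀ : κ ≤ κ₀)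
    (h1 : κ₀ ≤ 1) (n i : ℕ) (hi : i ≤ 2) :
    |zonalD (n - i) c (κ ^ 2)| ≤ (n : ℝ) ^ 4 * κ₀ ^ (n - 4) := by
  have h0 : 0 ≤ κ₀ := hκ.trans hκ₀
  rcases hm : n - i with _ | m
  · simp [zonalD]; positivity
  · refine (abs_zonalD_succ_le hκ h m).trans ?_
    have hn : ((m : ℝ) + 1) ≤ n := by exact_mod_cast (by omega : m + 1 ≤ n)
    have hn1 : (1 : ℝ) ≤ n := by exact_mod_cast (by omega : 1 ≤ n)
    calc ((m : ℝ) + 1) ^ 2 * κ ^ m ≤ (n : ℝ) ^ 2 * κ₀ ^ m := by gcongr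
      _ ≤ (n : ℝ) ^ 4 * κ₀ ^ (n - 4) :=
        mul_le_mul (pow_le_pow_right₀ hn1 (by norm_num))
          (pow_le_pow_of_le_one h0 h1 (by omega)) (by positivity) (by positivity)

theorem abs_zonalDD_sub_le {c κ κ₀ : ℝ} (hκ : 0 ≤ κ) (h : c ^ 2 ≤ κ ^ 2) (hκ₀ : κ ≤ κ₀)
    (h1 : κ₀ ≤ 1) (n i : ℕ) (hi : i ≤ 2) :
    |zonalDD (n - i) c (κ ^ 2)| ≤ (n : ℝ) ^ 4 * κ₀ ^ (n - 4) := by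
  have h0 : 0 ≤ κ₀ := hκ.trans hκ₀
  rcases hm : n - i with _ | _ | m
  · simp [zonalDD]; positivity
  · simp [zonalDD]; positivity
  · refine (abs_zonalDD_add_two_le hκ h m).trans ?_
    have hn : ((m : ℝ) + 2) ≤ n := by exact_mod_cast (by omega : m + 2 ≤ n)
    calc ((m : ℝ) + 2) ^ 4 * κ ^ m ≤ (n : ℝ) ^ 4 * κ₀ ^ m := by gcongr
      _ ≤ (n : ℝ) ^ 4 * κ₀ ^ (n - 4) :=
        mul_le_mul_of_nonneg_left (pow_le_pow_of_le_one h0 h1 (by omega)) (by positivity)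

theorem summable_pow_four_mul_pow_sub {κ : ℝ} (h0 : 0 ≤ κ) (h1 : κ < 1) :
    Summable fun n : ℕ => (n : ℝ) ^ 4 * κ ^ (n - 4) := by
  rw [← summable_nat_add_iff 4]
  simp only [add_tsub_cancel_right]
  rcases h0.eq_or_lt with rfl | h0
  · refine summable_of_ne_finset_zero (s := {0}) fun n hn => ?_
    simp at hn
    simp [hn]
  have h := (summable_nat_add_iff 4).2
    (summable_pow_mul_geometric_of_norm_lt_one 4 (r := κ) (by rwa [Real.norm_of_nonneg h0.le]))
  refine (h.mul_right (κ ^ 4)⁻¹).congr fun n => ?_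
  field_simp
  ring

/-- Termwise differentiation on an open ball; the majorants are needed only on smaller concentric
balls, which is where the geometric ratio stays below `1`. -/
theorem hasSum_fderiv_of_hasSum {E : Type*} [NormedAddCommGroup E] [NormedSpace ℝ E]
    {g : ℕ → E → ℝ} {g' : ℕ → E → E →L[ℝ] ℝ} {k : E → ℝ} {S : E} {r : ℝ}
    (hg : ∀ n q, q ∈ Metric.ball S r → HasFDerivAt (g n) (g' n q) q)
    (hb : ∀ σ < r, 0 < σ → ∃ u : ℕ → ℝ, Summable u ∧ ∀ n, ∀ q ∈ Metric.ball S σ, ‖g' n q‖ ≤ u n)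
    (hk : ∀ q ∈ Metric.ball S r, HasSum (fun n => g n q) (k q)) {q : E}
    (hq : q ∈ Metric.ball S r) : HasSum (fun n => g' n q) (fderiv ℝ k q) := by
  obtain ⟨σ, h1, h2⟩ := exists_between (Metric.mem_ball.1 hq)
  have h0 : 0 < σ := dist_nonneg.trans_lt h1
  obtain ⟨u, hu, hbu⟩ := hb σ h2 h0
  have hsub : Metric.ball S σ ⊆ Metric.ball S r := Metric.ball_subset_ball h2.le
  have hqσ : q ∈ Metric.ball S σ := h1
  have hd := hasFDerivAt_tsum_of_isPreconnected hu Metric.isOpen_ball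
    (convex_ball S σ).isPreconnected (fun n y hy => hg n y (hsub hy)) hbu hqσ
    (hk q hq).summable hqσ
  have heq : k =ᶠ[𝓝 q] fun y => ∑' n, g n y := by
    filter_upwards [Metric.isOpen_ball.mem_nhds hqσ] with y hy
    exact (hk y (hsub hy)).tsum_eq.symm
  rw [(hd.congr_of_eventuallyEq heq).fderiv]
  exact (hu.of_norm_bounded fun n => hbu n q hqσ).hasSum

section bounds

variable {S x q : E3}

theorem inner_mul_sq_le (S x q : E3) :
    (inner ℝ (x - S) (q - S) * (‖x - S‖ ^ 2)⁻¹) ^ 2 ≤ (‖q - S‖ / ‖x - S‖) ^ 2 := by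
  rcases eq_or_ne ‖x - S‖ 0 with h | h
  · simp [h]
  · have h1 := abs_real_inner_le_norm (x - S) (q - S)
    rw [sq_le_sq, abs_mul, abs_div, abs_norm, abs_norm,
      abs_of_nonneg (by positivity : 0 ≤ (‖x - S‖ ^ 2)⁻¹)]
    have hp : 0 < ‖x - S‖ := lt_of_le_of_ne (norm_nonneg _) h.symm
    rw [← div_eq_mul_inv, div_le_div_iff₀ (by positivity) hp]
    nlinarith

theorem norm_sq_mul_inv (S x q : E3) :
    ‖q - S‖ ^ 2 * (‖x - S‖ ^ 2)⁻¹ = (‖q - S‖ / ‖x - S‖) ^ 2 := by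
  rw [div_pow, div_eq_mul_inv]

theorem abs_inner_le (y F : E3) {a : ℝ} (h : ‖y‖ ≤ a) : |inner ℝ y F| ≤ a * ‖F‖ :=
  (abs_real_inner_le_norm _ _).trans (by gcongr)

/-- The law of cosines: the argument of the root in the generating function is `(|x - q| / |x - S|)
^ 2`. -/
theorem hasSum_multipole (h : dist q S < dist x S) :
    HasSum (fun n => multipole n S x q) ‖x - q‖⁻¹ := by
  rw [dist_eq_norm, dist_eq_norm] at h
  have hr : 0 < ‖x - S‖ := (norm_nonneg _).trans_lt h
  have h1 := (hasSum_zonal (κ := ‖q - S‖ / ‖x - S‖) (by positivity) (by rwa [div_lt_one hr])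
    (inner_mul_sq_le S x q)).mul_left ‖x - S‖⁻¹
  simp_rw [← norm_sq_mul_inv] at h1
  have h2 : ‖x - S‖⁻¹ * (1 / √(1 - 2 * (inner ℝ (x - S) (q - S) * (‖x - S‖ ^ 2)⁻¹)
      + ‖q - S‖ ^ 2 * (‖x - S‖ ^ 2)⁻¹)) = ‖x - q‖⁻¹ := by
    have h3 := norm_sub_sq_real (x - S) (q - S)
    rw [sub_sub_sub_cancel_right] at h3
    have h4 : 1 - 2 * (inner ℝ (x - S) (q - S) * (‖x - S‖ ^ 2)⁻¹) + ‖q - S‖ ^ 2 * (‖x - S‖ ^ 2)⁻¹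
        = (‖x - q‖ / ‖x - S‖) ^ 2 := by
      rw [div_pow, h3]
      field_simp
    rw [h4, Real.sqrt_sq (by positivity)]
    field_simp
  rwa [h2] at h1

theorem norm_multipoleD_le {κ₀ : ℝ} (hκ : ‖q - S‖ / ‖x - S‖ ≤ κ₀) (h1 : κ₀ ≤ 1) (F : E3) (n : ℕ)
    (hqx : ‖q - S‖ ≤ ‖x - S‖) :
    |multipoleD n S x F q| ≤
      (‖x - S‖ ^ 3)⁻¹ * (2 * ‖x - S‖) * ((n : ℝ) ^ 4 * κ₀ ^ (n - 4)) * ‖F‖ := by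
  have hκ0 : 0 ≤ ‖q - S‖ / ‖x - S‖ := by positivity
  rw [multipoleD, norm_sq_mul_inv, abs_mul, abs_of_nonneg (by positivity : 0 ≤ (‖x - S‖ ^ 3)⁻¹)]
  have b0 := abs_zonalD_sub_le hκ0 (inner_mul_sq_le S x q) hκ h1 n 0 (by norm_num)
  have b1 := abs_zonalD_sub_le hκ0 (inner_mul_sq_le S x q) hκ h1 n 1 (by norm_num)
  rw [Nat.sub_zero] at b0
  set u := (n : ℝ) ^ 4 * κ₀ ^ (n - 4)
  calc _ ≤ (‖x - S‖ ^ 3)⁻¹ * (u * (‖x - S‖ * ‖F‖) + u * (‖x - S‖ * ‖F‖)) := by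
        gcongr
        refine (abs_sub _ _).trans ?_
        rw [abs_mul, abs_mul]
        gcongr
        · exact (abs_nonneg _).trans b0
        · exact abs_inner_le _ _ le_rfl
        · exact (abs_nonneg _).trans b0
        · exact abs_inner_le _ _ hqx
    _ = _ := by ring

theorem norm_multipoleDD_le {κ₀ : ℝ} (hκ : ‖q - S‖ / ‖x - S‖ ≤ κ₀) (h1 : κ₀ ≤ 1) (F E : E3) (n : ℕ)
    (hqx : ‖q - S‖ ≤ ‖x - S‖) (hx : 0 < ‖x - S‖) :
    |multipoleDD n S x F E q| ≤
      (‖x - S‖ ^ 3)⁻¹ * 5 * ((n : ℝ) ^ 4 * κ₀ ^ (n - 4)) * ‖F‖ * ‖E‖ := by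
  have hκ0 : 0 ≤ ‖q - S‖ / ‖x - S‖ := by positivity
  rw [multipoleDD, norm_sq_mul_inv, abs_mul, abs_of_nonneg (by positivity : 0 ≤ (‖x - S‖ ^ 3)⁻¹)]
  have b1 := abs_zonalD_sub_le hκ0 (inner_mul_sq_le S x q) hκ h1 n 1 (by norm_num)
  have c0 := abs_zonalDD_sub_le hκ0 (inner_mul_sq_le S x q) hκ h1 n 0 (by norm_num)
  have c1 := abs_zonalDD_sub_le hκ0 (inner_mul_sq_le S x q) hκ h1 n 1 (by norm_num)
  have c2 := abs_zonalDD_sub_le hκ0 (inner_mul_sq_le S x q) hκ h1 n 2 (by norm_num)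
  rw [Nat.sub_zero] at c0
  set u := (n : ℝ) ^ 4 * κ₀ ^ (n - 4)
  have hu : 0 ≤ u := (abs_nonneg _).trans b1
  have e1 := abs_inner_le (x - S) E le_rfl
  have e2 := abs_inner_le (q - S) E hqx
  have e3 := abs_inner_le (x - S) F le_rfl
  have e4 := abs_inner_le (q - S) F hqx
  have e5 : |inner ℝ E F| ≤ ‖E‖ * ‖F‖ := abs_inner_le _ _ le_rfl
  calc _ ≤ (‖x - S‖ ^ 3)⁻¹ * (
        (u * (‖x - S‖ * ‖E‖) + u * (‖x - S‖ * ‖E‖)) * (‖x - S‖ ^ 2)⁻¹ * (‖x - S‖ * ‖F‖)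
        + (u * (‖x - S‖ * ‖E‖) + u * (‖x - S‖ * ‖E‖)) * (‖x - S‖ ^ 2)⁻¹ * (‖x - S‖ * ‖F‖)
        + u * (‖E‖ * ‖F‖)) := by
        gcongr
        refine (abs_sub _ _).trans (add_le_add ((abs_sub _ _).trans (add_le_add ?_ ?_)) ?_)
        · rw [abs_mul, abs_mul, abs_of_nonneg (by positivity : 0 ≤ (‖x - S‖ ^ 2)⁻¹)]
          gcongr
          refine (abs_sub _ _).trans ?_
          rw [abs_mul, abs_mul]
          gcongr
        · rw [abs_mul, abs_mul, abs_of_nonneg (by positivity : 0 ≤ (‖x - S‖ ^ 2)⁻¹)]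
          gcongr
          refine (abs_sub _ _).trans ?_
          rw [abs_mul, abs_mul]
          gcongr
        · rw [abs_mul]
          gcongr
    _ = _ := by field_simp; ring

theorem exists_summable_bound {σ r : ℝ} (C : ℝ) (h0 : 0 < σ) (h : σ < r) :
    Summable fun n : ℕ => C * ((n : ℝ) ^ 4 * (σ / r) ^ (n - 4)) :=
  (summable_pow_four_mul_pow_sub (div_pos h0 (h0.trans h)).le
    ((div_lt_one (h0.trans h)).2 h)).mul_left _

theorem hasSum_dipole_multipole (h : dist q S < dist x S) (F : E3) :
    HasSum (fun n => dipole F (multipole n S x) q) (dipole F (fun y => ‖x - y‖⁻¹) q) := by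
  choose L hL1 hL2 using fun n q => hasFDerivAt_multipole n S x q
  have := hasSum_fderiv_of_hasSum (S := S) (r := dist x S) (fun n q _ => hL1 n q) ?_
    (fun q hq => hasSum_multipole hq) h
  · have h2 := (ContinuousLinearMap.apply ℝ ℝ F).hasSum this
    simp only [ContinuousLinearMap.apply_apply, hL2] at h2
    simp only [dipole_multipole]
    exact h2
  · intro σ hσ h0
    rw [dist_eq_norm] at hσ
    refine ⟨_, exists_summable_bound ((‖x - S‖ ^ 3)⁻¹ * (2 * ‖x - S‖)) h0 hσ, fun n q hq => ?_⟩
    rw [mem_ball_iff_norm] at hq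
    have hx := h0.trans hσ
    refine ContinuousLinearMap.opNorm_le_bound _ (by positivity) fun F => ?_
    rw [hL2]
    exact norm_multipoleD_le (by gcongr) ((div_lt_one hx).2 hσ).le F n (hq.trans hσ).le

theorem hasSum_dipole_dipole_multipole (h : dist q S < dist x S) (F E : E3) :
    HasSum (fun n => dipole E (fun z => dipole F (multipole n S x) z) q)
      (dipole E (fun z => dipole F (fun y => ‖x - y‖⁻¹) z) q) := by
  choose L hL1 hL2 using fun n q => hasFDerivAt_multipoleD n S x F q
  have := hasSum_fderiv_of_hasSum (S := S) (r := dist x S) (fun n q _ => hL1 n q) ?_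
    (k := fun z => dipole F (fun y => ‖x - y‖⁻¹) z)
    (fun q hq => by simpa only [dipole_multipole] using hasSum_dipole_multipole hq F) h
  · have h2 := (ContinuousLinearMap.apply ℝ ℝ E).hasSum this
    simp only [ContinuousLinearMap.apply_apply, hL2] at h2
    simp only [dipole_dipole_multipole]
    exact h2
  · intro σ hσ h0
    rw [dist_eq_norm] at hσ
    refine ⟨_, exists_summable_bound ((‖x - S‖ ^ 3)⁻¹ * 5 * ‖F‖) h0 hσ, fun n q hq => ?_⟩
    rw [mem_ball_iff_norm] at hq
    have hx := h0.trans hσ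
    refine ContinuousLinearMap.opNorm_le_bound _ (by positivity) fun E => ?_
    rw [hL2]
    refine (norm_multipoleDD_le (κ₀ := σ / ‖x - S‖) (by gcongr) ((div_lt_one hx).2 hσ).le F E n
      (hq.trans hσ).le hx).trans (le_of_eq ?_)
    ring

/-- Far-field decay of the terms of the expansion of a dipole. -/
theorem abs_dipole_multipole_le {b : ℝ} (hq : dist q S < b) (hx : b ≤ dist x S) (F : E3) (m : ℕ) :
    |dipole F (multipole (m + 2) S x) q| ≤
      2 * b * ‖F‖ * (((m + 2 : ℕ) : ℝ) ^ 4 * (dist q S / b) ^ m) / dist x S ^ 3 := by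
  rw [dipole_multipole, multipoleD, norm_sq_mul_inv, ← dist_eq_norm, ← dist_eq_norm]
  have hb : 0 < b := dist_nonneg.trans_lt hq
  have hr : 0 < dist x S := hb.trans_le hx
  have hsq := inner_mul_sq_le S x q
  rw [← dist_eq_norm, ← dist_eq_norm] at hsq
  set r := dist x S
  set ρ := dist q S with hρ
  set κ := ρ / r with hκ
  have hρ0 : 0 ≤ ρ := dist_nonneg
  have hκ0 : 0 ≤ κ := by positivity
  have d1 := abs_zonalD_succ_le hκ0 hsq (m + 1)
  have d0 := abs_zonalD_succ_le hκ0 hsq m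
  rw [show m + 2 - 1 = m + 1 by omega]
  have e1 := abs_inner_le (x - S) F (a := r) (dist_eq_norm x S).ge
  have e2 := abs_inner_le (q - S) F (a := ρ) (dist_eq_norm q S).ge
  rw [abs_mul, abs_of_nonneg (by positivity : 0 ≤ (r ^ 3)⁻¹)]
  calc _ ≤ (r ^ 3)⁻¹ * ((((m + 1 : ℕ) : ℝ) + 1) ^ 2 * κ ^ (m + 1) * (r * ‖F‖)
        + ((m : ℝ) + 1) ^ 2 * κ ^ m * (ρ * ‖F‖)) := by
        gcongr
        refine (abs_sub _ _).trans ?_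
        rw [abs_mul, abs_mul]
        gcongr
    -- Since `κ * r = ρ`, the extra power of `κ` in the first summand absorbs the factor `r`; both
    -- summands then decay like `r ^ (-3)`.
    _ = (r ^ 3)⁻¹ * ρ * ‖F‖ * ((((m : ℝ) + 2) ^ 2 + ((m : ℝ) + 1) ^ 2) * κ ^ m) := by
        have : κ * r = ρ := div_mul_cancel₀ _ hr.ne'
        rw [pow_succ, ← this]
        push_cast
        ring
    _ ≤ (r ^ 3)⁻¹ * b * ‖F‖ * ((2 * ((m : ℝ) + 2) ^ 4) * (ρ / b) ^ m) := by
        gcongr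
        · rw [two_mul]
          have h2 : (1 : ℝ) ≤ (m : ℝ) + 2 := by linarith [(Nat.cast_nonneg m : (0 : ℝ) ≤ m)]
          have h3 : ((m : ℝ) + 2) ^ 2 ≤ ((m : ℝ) + 2) ^ 4 := pow_le_pow_right₀ h2 (by norm_num)
          have h4 : ((m : ℝ) + 1) ^ 2 ≤ ((m : ℝ) + 2) ^ 2 := by gcongr; norm_num
          linarith
        · rw [hκ]
          gcongr
    _ = _ := by push_cast; ring

/-- Far-field decay of the terms of the expansion of a second derivative. -/
theorem abs_dipole_dipole_multipole_le {b : ℝ} (hq : dist q S < b) (hx : b ≤ dist x S) (F E : E3)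
    (m : ℕ) :
    |dipole E (fun y => dipole F (multipole (m + 2) S x) y) q| ≤
      5 * ‖F‖ * ‖E‖ * (((m + 2 : ℕ) : ℝ) ^ 4 * (dist q S / b) ^ m) / dist x S ^ 3 := by
  rw [dipole_dipole_multipole, multipoleDD, norm_sq_mul_inv, ← dist_eq_norm, ← dist_eq_norm]
  have hb : 0 < b := dist_nonneg.trans_lt hq
  have hr : 0 < dist x S := hb.trans_le hx
  have hsq := inner_mul_sq_le S x q
  rw [← dist_eq_norm, ← dist_eq_norm] at hsq
  set r := dist x S
  set ρ := dist q S with hρ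
  set κ := ρ / r with hκ
  have hρ0 : 0 ≤ ρ := dist_nonneg
  have hκ0 : 0 ≤ κ := by positivity
  have hκr : κ * r = ρ := div_mul_cancel₀ _ hr.ne'
  set c := inner ℝ (x - S) (q - S) * (r ^ 2)⁻¹
  set u := ((m : ℝ) + 2) ^ 4 * κ ^ m with hu
  have hm0 : (0 : ℝ) ≤ m := m.cast_nonneg
  have c0 : |zonalDD (m + 2) c (κ ^ 2)| ≤ u := abs_zonalDD_add_two_le hκ0 hsq m
  -- Each lowering of the index costs one power of `κ` in the bound for `zonalDD`; it is restored by
  -- the factor `ρ` in place of `r` coming from the inner product with `q - S`. The lowest cases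
  -- vanish.
  have c1 : |zonalDD (m + 1) c (κ ^ 2)| * κ ≤ u := by
    rcases m with _ | m
    · simp [zonalDD, hu]
    · calc _ ≤ ((m : ℝ) + 2) ^ 4 * κ ^ m * κ := by
            gcongr
            exact abs_zonalDD_add_two_le hκ0 hsq m
        _ = ((m : ℝ) + 2) ^ 4 * κ ^ (m + 1) := by ring
        _ ≤ _ := by rw [hu]; push_cast; gcongr; linarith
  have c2 : |zonalDD m c (κ ^ 2)| * κ ^ 2 ≤ u := by
    rcases m with _ | _ | m
    · simp [zonalDD, hu]
    · simp [zonalDD, hu]; positivity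
    · calc _ ≤ ((m : ℝ) + 2) ^ 4 * κ ^ m * κ ^ 2 := by
            gcongr
            exact abs_zonalDD_add_two_le hκ0 hsq m
        _ = ((m : ℝ) + 2) ^ 4 * κ ^ (m + 2) := by ring
        _ ≤ _ := by rw [hu]; push_cast; gcongr; linarith
  have d0 : |zonalD (m + 1) c (κ ^ 2)| ≤ u := by
    refine (abs_zonalD_succ_le hκ0 hsq m).trans ?_
    have h4 : ((m : ℝ) + 1) ^ 2 ≤ ((m : ℝ) + 2) ^ 2 := by gcongr; norm_num
    have h3 : ((m : ℝ) + 2) ^ 2 ≤ ((m : ℝ) + 2) ^ 4 :=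
      pow_le_pow_right₀ (by linarith) (by norm_num)
    rw [hu]
    gcongr
    exact h4.trans h3
  rw [show m + 2 - 1 = m + 1 by omega, show m + 2 - 2 = m by omega]
  have e1 := abs_inner_le (x - S) E (a := r) (dist_eq_norm x S).ge
  have e2 := abs_inner_le (q - S) E (a := ρ) (dist_eq_norm q S).ge
  have e3 := abs_inner_le (x - S) F (a := r) (dist_eq_norm x S).ge
  have e4 := abs_inner_le (q - S) F (a := ρ) (dist_eq_norm q S).ge
  have e5 : |inner ℝ E F| ≤ ‖E‖ * ‖F‖ := abs_inner_le _ _ le_rfl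
  have hri : (0 : ℝ) ≤ (r ^ 2)⁻¹ := by positivity
  -- A product of two inner products, bounded by `s` and `t` times the norms of `E` and `F`; `s` and
  -- `t` are `r` or `ρ`, so `k` is `1`, `κ` or `κ ^ 2`.
  have key : ∀ A α β s t k : ℝ, 0 ≤ s → 0 ≤ t → |α| ≤ s * ‖E‖ → |β| ≤ t * ‖F‖ →
      s * t * (r ^ 2)⁻¹ = k → |A| * k ≤ u → |A * α * (r ^ 2)⁻¹ * β| ≤ u * (‖E‖ * ‖F‖) := by
    intro A α β s t k hs ht hα hβ hk hA
    rw [abs_mul, abs_mul, abs_mul, abs_of_nonneg hri]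
    calc _ ≤ |A| * (s * ‖E‖) * (r ^ 2)⁻¹ * (t * ‖F‖) := by gcongr
      _ = (|A| * k) * (‖E‖ * ‖F‖) := by rw [← hk]; ring
      _ ≤ _ := by gcongr
  have t1 := key (zonalDD (m + 2) c (κ ^ 2)) _ _ r r 1 hr.le hr.le e1 e3 (by field_simp) (by rwa [mul_one])
  have t2 := key _ _ _ ρ r κ hρ0 hr.le e2 e3 (by rw [hκ]; field_simp) c1
  have t3 := key _ _ _ r ρ κ hr.le hρ0 e1 e4 (by rw [hκ]; field_simp) c1
  have t4 := key _ _ _ ρ ρ (κ ^ 2) hρ0 hρ0 e2 e4 (by rw [hκ]; field_simp) c2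
  have t5 : |zonalD (m + 1) c (κ ^ 2) * inner ℝ E F| ≤ u * (‖E‖ * ‖F‖) := by
    rw [abs_mul]; gcongr
  rw [abs_mul, abs_of_nonneg (by positivity : 0 ≤ (r ^ 3)⁻¹)]
  calc _ ≤ (r ^ 3)⁻¹ * (5 * (u * (‖E‖ * ‖F‖))) := by
        gcongr
        rw [abs_le] at t1 t2 t3 t4 t5 ⊢
        constructor <;> linarith
    _ ≤ (r ^ 3)⁻¹ * (5 * ((((m : ℝ) + 2) ^ 4 * (ρ / b) ^ m) * (‖E‖ * ‖F‖))) := by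
        rw [hu, hκ]
        gcongr
    _ = _ := by push_cast; ring

end bounds

/-! ### Spherical coordinates and solid harmonics -/

theorem E3.norm_sq (v : E3) : ‖v‖ ^ 2 = v 0 ^ 2 + v 1 ^ 2 + v 2 ^ 2 := by
  rw [EuclideanSpace.norm_sq_eq, Fin.sum_univ_three]
  simp

theorem E3.inner_eq (v w : E3) : inner ℝ v w = v 0 * w 0 + v 1 * w 1 + v 2 * w 2 := by
  rw [PiLp.inner_apply, Fin.sum_univ_three]
  simp [mul_comm]

theorem abs_apply_two_div_norm_le (v : E3) : |v 2 / ‖v‖| ≤ 1 := by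
  rw [abs_div, abs_norm]
  exact div_le_one_of_le₀ (by simpa using PiLp.norm_apply_le v 2) (norm_nonneg _)

theorem cos_polarAngle (v : E3) : Real.cos (polarAngle v) = v 2 / ‖v‖ := by
  have := abs_le.1 (abs_apply_two_div_norm_le v)
  exact Real.cos_arccos this.1 this.2

theorem norm_mul_apply_two_div (v : E3) : ‖v‖ * (v 2 / ‖v‖) = v 2 := by
  rcases eq_or_ne v 0 with rfl | h
  · simp
  · rw [mul_div_cancel₀]; exact norm_ne_zero_iff.2 h

theorem one_sub_sq_nonneg (v : E3) : 0 ≤ 1 - (v 2 / ‖v‖) ^ 2 := by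
  have := (sq_le_one_iff_abs_le_one _).2 (abs_apply_two_div_norm_le v)
  linarith

/-- The distance of `v` from the `x₃` axis in spherical coordinates. -/
theorem norm_mul_sqrt_one_sub_sq (v : E3) :
    ‖v‖ * √(1 - (v 2 / ‖v‖) ^ 2) = ‖(v 0 + v 1 * Complex.I : ℂ)‖ := by
  rw [← sq_eq_sq₀ (by positivity) (norm_nonneg _), mul_pow, Real.sq_sqrt (one_sub_sq_nonneg v),
    ← Complex.normSq_eq_norm_sq, Complex.normSq_add_mul_I]
  have h1 := norm_mul_apply_two_div v
  have h2 := E3.norm_sq v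
  rw [mul_sub, ← mul_pow, h1]
  linarith

theorem norm_mul_exp_azimuth (v : E3) :
    ((‖v‖ * √(1 - (v 2 / ‖v‖) ^ 2) : ℝ) : ℂ) * Complex.exp (Complex.I * azimuth v) =
      v 0 + v 1 * Complex.I := by
  rw [norm_mul_sqrt_one_sub_sq, azimuth, mul_comm Complex.I]
  exact Complex.norm_mul_exp_arg_mul_I _

theorem norm_mul_cos_azimuth (v : E3) :
    ‖v‖ * √(1 - (v 2 / ‖v‖) ^ 2) * Real.cos (azimuth v) = v 0 := by
  rw [norm_mul_sqrt_one_sub_sq, azimuth, Complex.norm_mul_cos_arg]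
  simp

theorem norm_mul_sin_azimuth (v : E3) :
    ‖v‖ * √(1 - (v 2 / ‖v‖) ^ 2) * Real.sin (azimuth v) = v 1 := by
  rw [norm_mul_sqrt_one_sub_sq, azimuth, Complex.norm_mul_sin_arg]
  simp

/-- The homogenization `v ^ (d / 2) p (c / √v)` of a polynomial of degree at most `d` and of the
parity of `d`. -/
def homEval (p : Polynomial ℝ) (d : ℕ) (c v : ℝ) : ℝ :=
  ∑ j ∈ Finset.range (d + 1), p.coeff j * c ^ j * v ^ ((d - j) / 2)

theorem homEval_mul_sq {p : Polynomial ℝ} {d : ℕ} (hd : p.natDegree ≤ d)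
    (hp : ∀ j, ¬ Even (d + j) → p.coeff j = 0) (κ t : ℝ) :
    homEval p d (κ * t) (κ ^ 2) = κ ^ d * p.eval t := by
  rw [homEval, Polynomial.eval_eq_sum_range' (n := d + 1) (by omega), Finset.mul_sum]
  refine Finset.sum_congr rfl fun j hj => ?_
  by_cases h : Even (d + j)
  · have : κ ^ d = κ ^ j * (κ ^ 2) ^ ((d - j) / 2) := by
      rw [← pow_mul, ← pow_add]
      congr 1
      rw [Finset.mem_range] at hj
      obtain ⟨k, hk⟩ := h
      omega
    rw [this]
    ring
  · rw [hp j h]; simp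

open Polynomial in
theorem homEval_iterate_derivative_legendreP {n k : ℕ} (hk : k ≤ n) (κ t : ℝ) :
    homEval (derivative^[k] (legendreP n)) (n - k) (κ * t) (κ ^ 2) =
      κ ^ (n - k) * (derivative^[k] (legendreP n)).eval t := by
  refine homEval_mul_sq ((natDegree_iterate_derivative _ _).trans
    (Nat.sub_le_sub_right (natDegree_legendreP_le n) k)) (fun j hj => ?_) κ t
  rw [coeff_iterate_derivative, legendreP_coeff_eq_zero, smul_zero]
  intro h
  apply hj
  obtain ⟨a, ha⟩ := h
  exact ⟨a - k, by omega⟩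

/-- The normalization factor of the spherical harmonics. -/
def sphNorm (n k : ℕ) : ℝ :=
  √((2 * n + 1) / (4 * Real.pi)) * √(((n - k).factorial : ℝ) / ((n + k).factorial : ℝ))

theorem sphNorm_mul_self (n k : ℕ) : sphNorm n k * sphNorm n k =
    (2 * n + 1) / (4 * Real.pi) * (((n - k).factorial : ℝ) / ((n + k).factorial : ℝ)) := by
  rw [sphNorm, mul_mul_mul_comm, Real.mul_self_sqrt (by positivity),
    Real.mul_self_sqrt (by positivity)]

-- The factor `ρ^k sin^k e^(±ikφ)` is `(h₁ ± i h₂)^k`, and by parity the remaining `ρ^(n-k)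
-- P_n^(k)(cos)` is a polynomial in `h₃` and `ρ²`. So the solid harmonic is smooth everywhere, even
-- at the axis and the center, where the angles are not.
open Polynomial in
theorem solidY_eq (S : E3) {n : ℕ} {m : ℤ} (hm : m.natAbs ≤ n) (q : E3) :
    solidY S n m q = ((sphNorm n m.natAbs * (-1) ^ m.natAbs *
      homEval (derivative^[m.natAbs] (legendreP n)) (n - m.natAbs) ((q - S) 2) (‖q - S‖ ^ 2) : ℝ) : ℂ)
      * ((q - S) 0 + (if 0 ≤ m then 1 else -1) * (q - S) 1 * Complex.I) ^ m.natAbs := by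
  set h := q - S with hh
  set k := m.natAbs with hk
  have h1 : ((h 0 : ℂ) + (if 0 ≤ m then 1 else -1) * h 1 * Complex.I) ^ k =
      ((‖h‖ * √(1 - (h 2 / ‖h‖) ^ 2) : ℝ) : ℂ) ^ k * Complex.exp (Complex.I * m * azimuth h) := by
    have h2 := norm_mul_exp_azimuth h
    split_ifs with h0
    · rw [one_mul, ← h2, mul_pow, ← Complex.exp_nat_mul]
      have : (m : ℂ) = (k : ℂ) := by
        have : m = k := by omega
        rw [this]; simp
      rw [this]
      congr 2
      ring
    · have h3 := congrArg (starRingEnd ℂ) h2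
      rw [map_mul, map_add, map_mul, Complex.conj_ofReal, Complex.conj_ofReal, Complex.conj_ofReal,
        Complex.conj_I, ← Complex.exp_conj, map_mul, Complex.conj_I, Complex.conj_ofReal] at h3
      rw [show (h 0 : ℂ) + -1 * h 1 * Complex.I = h 0 + h 1 * -Complex.I by ring, ← h3, mul_pow,
        ← Complex.exp_nat_mul]
      have : (m : ℂ) = -(k : ℂ) := by
        have : m = -(k : ℤ) := by omega
        rw [this]; simp
      rw [this]
      congr 2
      ring
  have h4 := homEval_iterate_derivative_legendreP hm ‖h‖ (h 2 / ‖h‖)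
  rw [norm_mul_apply_two_div] at h4
  rw [h1, h4, solidY, sphY, ← hh, assocLegendre, cos_polarAngle, sphNorm,
    show (‖h‖ : ℂ) ^ n = (‖h‖ : ℂ) ^ (n - k) * (‖h‖ : ℂ) ^ k by rw [← pow_add, Nat.sub_add_cancel hm]]
  push_cast
  ring

theorem contDiff_apply_sub (S : E3) (i : Fin 3) {m : WithTop ℕ∞} :
    ContDiff ℝ m fun q : E3 => (q - S) i :=
  (EuclideanSpace.proj (𝕜 := ℝ) i).contDiff.comp (contDiff_id.sub contDiff_const)

theorem contDiff_solidY (S : E3) {n : ℕ} {m : ℤ} (hm : m.natAbs ≤ n) {l : WithTop ℕ∞} :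
    ContDiff ℝ l (solidY S n m) := by
  rw [funext (solidY_eq S hm)]
  have hr : ∀ {f : E3 → ℝ}, ContDiff ℝ l f → ContDiff ℝ l fun q => (f q : ℂ) :=
    fun hf => Complex.ofRealCLM.contDiff.comp hf
  refine (hr (contDiff_const.mul (ContDiff.sum fun j _ => ?_))).mul (ContDiff.pow ?_ _)
  · exact (contDiff_const.mul ((contDiff_apply_sub S 2).pow _)).mul
      (((contDiff_id.sub contDiff_const).norm_sq ℝ).pow _)
  · exact (hr (contDiff_apply_sub S 0)).add
      ((contDiff_const.mul (hr (contDiff_apply_sub S 1))).mul contDiff_const)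

theorem contDiff_zonal (n : ℕ) {l : WithTop ℕ∞} {E : Type*} [NormedAddCommGroup E]
    [NormedSpace ℝ E] {f g : E → ℝ} (hf : ContDiff ℝ l f) (hg : ContDiff ℝ l g) :
    ContDiff ℝ l fun x => zonal n (f x) (g x) := by
  induction n using Nat.twoStepInduction with
  | zero => exact contDiff_const
  | one => exact hf
  | more n h0 h1 =>
    simp only [zonal]
    exact (((contDiff_const.mul hf).mul h1).sub ((contDiff_const.mul hg).mul h0)).div_const _

theorem contDiff_multipole (n : ℕ) (S x : E3) {l : WithTop ℕ∞} :
    ContDiff ℝ l (multipole n S x) :=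
  contDiff_const.mul (contDiff_zonal n
    (((innerSL ℝ (x - S)).contDiff.comp (contDiff_id.sub contDiff_const)).mul contDiff_const)
    (((contDiff_id.sub contDiff_const).norm_sq ℝ).mul contDiff_const))

open Polynomial in
/-- The addition theorem for spherical harmonics. -/
theorem sum_solidY_mul_sphY (n : ℕ) {S x : E3} (hx : x ≠ S) (q : E3) :
    ∑ m ∈ Finset.Icc (-(n : ℤ)) n, ((4 * Real.pi / (2 * n + 1) : ℝ) : ℂ) *
      (sphY n m (polarAngle (x - S)) (azimuth (x - S)) / (‖x - S‖ : ℂ) ^ (n + 1)) *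
      solidY S n (-m) q = multipole n S x q := by
  have hr : ‖x - S‖ ≠ 0 := norm_ne_zero_iff.2 (sub_ne_zero.2 hx)
  set y := x - S with hy
  set h := q - S with hh
  set u := h 2 / ‖h‖ with hu
  set v := y 2 / ‖y‖ with hv
  set s := √(1 - u ^ 2) * √(1 - v ^ 2) with hs
  have hs2 : s ^ 2 = (1 - u ^ 2) * (1 - v ^ 2) := by
    rw [hs, mul_pow, Real.sq_sqrt (one_sub_sq_nonneg h), Real.sq_sqrt (one_sub_sq_nonneg y)]
  -- The spherical law of cosines for the angle between `x - S` and `q - S`, in the form required by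
  -- the addition theorem.
  have hinner : inner ℝ y h = ‖h‖ * ‖y‖ * (u * v + s * Real.cos (azimuth y - azimuth h)) := by
    have a0 : ‖y‖ * √(1 - v ^ 2) * Real.cos (azimuth y) = y 0 := norm_mul_cos_azimuth y
    have a1 : ‖y‖ * √(1 - v ^ 2) * Real.sin (azimuth y) = y 1 := norm_mul_sin_azimuth y
    have a2 : ‖y‖ * v = y 2 := norm_mul_apply_two_div y
    have b0 : ‖h‖ * √(1 - u ^ 2) * Real.cos (azimuth h) = h 0 := norm_mul_cos_azimuth h
    have b1 : ‖h‖ * √(1 - u ^ 2) * Real.sin (azimuth h) = h 1 := norm_mul_sin_azimuth h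
    have b2 : ‖h‖ * u = h 2 := norm_mul_apply_two_div h
    rw [E3.inner_eq, Real.cos_sub, ← a0, ← a1, ← a2, ← b0, ← b1, ← b2, hs]
    ring
  have hmul : multipole n S x q = ‖h‖ ^ n / ‖y‖ ^ (n + 1) *
      (legendreP n).eval (u * v + s * Real.cos (azimuth y - azimuth h)) := by
    rw [multipole, ← hy, ← hh, hinner]
    have e1 : ‖h‖ * ‖y‖ * (u * v + s * Real.cos (azimuth y - azimuth h)) * (‖y‖ ^ 2)⁻¹ =
        (‖h‖ / ‖y‖) * (u * v + s * Real.cos (azimuth y - azimuth h)) := by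
      field_simp
    have e2 : ‖h‖ ^ 2 * (‖y‖ ^ 2)⁻¹ = (‖h‖ / ‖y‖) ^ 2 := by rw [div_pow, div_eq_mul_inv]
    rw [e1, e2, zonal_eq_legendreP, div_pow]
    field_simp
    ring
  rw [hmul]
  push_cast [legendreP_addition n u v s _ hs2]
  rw [Finset.mul_sum]
  refine Finset.sum_congr rfl fun m _ => ?_
  rw [solidY, sphY, sphY, ← hh, Int.natAbs_neg, assocLegendre, assocLegendre, cos_polarAngle,
    cos_polarAngle, ← hu, ← hv]
  set k := m.natAbs
  have hN := sphNorm_mul_self n k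
  rw [sphNorm] at hN
  set N := √((2 * n + 1) / (4 * Real.pi)) * √(((n - k).factorial : ℝ) / ((n + k).factorial : ℝ))
  have hNC : ((4 * Real.pi / (2 * n + 1) : ℝ) : ℂ) * ((N : ℂ) * N) =
      (((n - k).factorial : ℝ) / ((n + k).factorial : ℝ) : ℝ) := by
    rw [← Complex.ofReal_mul, ← Complex.ofReal_mul, hN]
    congr 1
    have := Real.pi_pos
    field_simp
  have hexp : Complex.exp (Complex.I * m * (azimuth y - azimuth h)) =
      Complex.exp (Complex.I * m * azimuth y) * Complex.exp (Complex.I * (-m : ℤ) * azimuth h) := by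
    rw [← Complex.exp_add]
    push_cast
    congr 1
    ring
  have hsk : (s : ℂ) ^ k = (√(1 - u ^ 2) : ℂ) ^ k * (√(1 - v ^ 2) : ℂ) ^ k := by
    rw [hs]; push_cast; ring
  -- The two Condon–Shortley signs cancel.
  have h1 : ((-1 : ℂ) ^ k) * (-1) ^ k = 1 := by rw [← mul_pow]; simp
  push_cast at hNC
  push_cast
  rw [hexp, hsk, ← hNC]
  push_cast
  linear_combination (4 * (Real.pi : ℂ) / (2 * n + 1)) * (N * N) * (‖h‖ : ℂ) ^ n / (‖y‖ : ℂ) ^ (n + 1)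
    * ((eval u (derivative^[k] (legendreP n)) : ℝ) : ℂ)
    * ((eval v (derivative^[k] (legendreP n)) : ℝ) : ℂ)
    * ((√(1 - u ^ 2) : ℂ) ^ k * (√(1 - v ^ 2) : ℂ) ^ k)
    * (Complex.exp (Complex.I * m * azimuth y) * Complex.exp (Complex.I * -m * azimuth h)) * h1

/-! ### Calculus along a vertical line: `c` is the squared horizontal distance, `s` the depth below
the image source -/

section vertical

variable {c s : ℝ}

theorem sqrt_add_sq_pos (hc : 0 ≤ c) (hs : 0 < s) : 0 < √(c + s ^ 2) :=
  Real.sqrt_pos.2 (by positivity)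

theorem hasDerivAt_sqrt_add_sq (hc : 0 ≤ c) (hs : 0 < s) :
    HasDerivAt (fun s => √(c + s ^ 2)) (s / √(c + s ^ 2)) s := by
  have h := ((hasDerivAt_pow 2 s).const_add c).sqrt (by positivity)
  refine h.congr_deriv ?_
  have := sqrt_add_sq_pos hc hs
  field_simp
  simp

theorem hasDerivAt_sqrt_add_sq_add (hc : 0 ≤ c) (hs : 0 < s) :
    HasDerivAt (fun s => √(c + s ^ 2) + s) ((√(c + s ^ 2) + s) / √(c + s ^ 2)) s := by
  refine ((hasDerivAt_sqrt_add_sq hc hs).add (hasDerivAt_id s)).congr_deriv ?_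
  have := sqrt_add_sq_pos hc hs
  field_simp
  ring

theorem hasDerivAt_log_sqrt_add (hc : 0 ≤ c) (hs : 0 < s) :
    HasDerivAt (fun s => Real.log (√(c + s ^ 2) + s)) (1 / √(c + s ^ 2)) s := by
  have h0 := sqrt_add_sq_pos hc hs
  refine ((hasDerivAt_sqrt_add_sq_add hc hs).log (by positivity)).congr_deriv ?_
  field_simp

theorem hasDerivAt_one_div_sqrt (hc : 0 ≤ c) (hs : 0 < s) :
    HasDerivAt (fun s => 1 / √(c + s ^ 2)) (-s / √(c + s ^ 2) ^ 3) s := by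
  have h0 := sqrt_add_sq_pos hc hs
  refine ((hasDerivAt_const s (1 : ℝ)).div (hasDerivAt_sqrt_add_sq hc hs) h0.ne').congr_deriv ?_
  field_simp
  ring

theorem hasDerivAt_neg_div_sqrt_pow (hc : 0 ≤ c) (hs : 0 < s) :
    HasDerivAt (fun s => -s / √(c + s ^ 2) ^ 3)
      (3 * s ^ 2 / √(c + s ^ 2) ^ 5 - 1 / √(c + s ^ 2) ^ 3) s := by
  have h0 := sqrt_add_sq_pos hc hs
  refine ((hasDerivAt_id s).neg.div ((hasDerivAt_sqrt_add_sq hc hs).pow 3)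
    (by positivity : √(c + s ^ 2) ^ 3 ≠ 0)).congr_deriv ?_
  simp
  field_simp
  ring

theorem hasDerivAt_one_div_sqrt_add (hc : 0 ≤ c) (hs : 0 < s) :
    HasDerivAt (fun s => 1 / (√(c + s ^ 2) + s))
      (-1 / (√(c + s ^ 2) * (√(c + s ^ 2) + s))) s := by
  have h0 := sqrt_add_sq_pos hc hs
  refine ((hasDerivAt_const s (1 : ℝ)).div (hasDerivAt_sqrt_add_sq_add hc hs)
    (by positivity)).congr_deriv ?_
  field_simp
  ring

theorem hasDerivAt_neg_one_div_sqrt_mul (hc : 0 ≤ c) (hs : 0 < s) :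
    HasDerivAt (fun s => -1 / (√(c + s ^ 2) * (√(c + s ^ 2) + s))) (1 / √(c + s ^ 2) ^ 3) s := by
  have h0 := sqrt_add_sq_pos hc hs
  refine ((hasDerivAt_const s (-1 : ℝ)).div ((hasDerivAt_sqrt_add_sq hc hs).mul
    (hasDerivAt_sqrt_add_sq_add hc hs))
    (by positivity : √(c + s ^ 2) * (√(c + s ^ 2) + s) ≠ 0)).congr_deriv ?_
  simp only [Pi.mul_apply]
  field_simp
  ring

theorem hasDerivAt_one_div_sqrt_mul_sq (hc : 0 ≤ c) (hs : 0 < s) :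
    HasDerivAt (fun s => 1 / (√(c + s ^ 2) * (√(c + s ^ 2) + s) ^ 2))
      (-(s + 2 * √(c + s ^ 2)) / (√(c + s ^ 2) ^ 3 * (√(c + s ^ 2) + s) ^ 2)) s := by
  have h0 := sqrt_add_sq_pos hc hs
  refine ((hasDerivAt_const s (1 : ℝ)).div ((hasDerivAt_sqrt_add_sq hc hs).mul
    ((hasDerivAt_sqrt_add_sq_add hc hs).pow 2))
    (by positivity : √(c + s ^ 2) * (√(c + s ^ 2) + s) ^ 2 ≠ 0)).congr_deriv ?_
  simp only [Pi.mul_apply, Pi.pow_apply]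
  field_simp
  ring

theorem hasDerivAt_neg_div_sqrt_mul_sq (hc : 0 ≤ c) (hs : 0 < s) :
    HasDerivAt (fun s => -(s + 2 * √(c + s ^ 2)) / (√(c + s ^ 2) ^ 3 * (√(c + s ^ 2) + s) ^ 2))
      (3 / √(c + s ^ 2) ^ 5) s := by
  have h0 := sqrt_add_sq_pos hc hs
  refine ((((hasDerivAt_id s).add ((hasDerivAt_sqrt_add_sq hc hs).const_mul 2)).neg).div
    (((hasDerivAt_sqrt_add_sq hc hs).pow 3).mul
    ((hasDerivAt_sqrt_add_sq_add hc hs).pow 2))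
    (by positivity : √(c + s ^ 2) ^ 3 * (√(c + s ^ 2) + s) ^ 2 ≠ 0)).congr_deriv ?_
  simp only [Pi.mul_apply, Pi.pow_apply, Pi.neg_apply, Pi.add_apply, id]
  field_simp
  ring

theorem tendsto_sqrt_add_sq (hc : 0 ≤ c) (s : ℝ) :
    Tendsto (fun t : ℝ => √(c + (s + t) ^ 2)) atTop atTop := by
  refine tendsto_atTop_mono (fun t => ?_) (tendsto_atTop_add_const_left atTop s tendsto_id)
  refine Real.le_sqrt_of_sq_le ?_
  simp
  linarith

theorem tendsto_one_div_sqrt (hc : 0 ≤ c) (s : ℝ) :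
    Tendsto (fun t : ℝ => 1 / √(c + (s + t) ^ 2)) atTop (𝓝 0) := by
  simp only [one_div]
  exact (tendsto_sqrt_add_sq hc s).inv_tendsto_atTop

theorem tendsto_sqrt_add_sq_add (hc : 0 ≤ c) (s : ℝ) :
    Tendsto (fun t : ℝ => √(c + (s + t) ^ 2) + (s + t)) atTop atTop :=
  (tendsto_sqrt_add_sq hc s).atTop_add_atTop (tendsto_atTop_add_const_left atTop s tendsto_id)

theorem tendsto_one_div_sqrt_add (hc : 0 ≤ c) (s : ℝ) :
    Tendsto (fun t : ℝ => 1 / (√(c + (s + t) ^ 2) + (s + t))) atTop (𝓝 0) := by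
  simp only [one_div]
  exact (tendsto_sqrt_add_sq_add hc s).inv_tendsto_atTop

theorem tendsto_one_div_sqrt_mul_sq (hc : 0 ≤ c) (s : ℝ) :
    Tendsto (fun t : ℝ => 1 / (√(c + (s + t) ^ 2) * (√(c + (s + t) ^ 2) + (s + t)) ^ 2))
      atTop (𝓝 0) := by
  have := ((tendsto_one_div_sqrt hc s).mul ((tendsto_one_div_sqrt_add hc s).pow 2))
  simp only [zero_mul] at this
  refine this.congr fun t => ?_
  rw [div_pow, one_pow, div_mul_div_comm, one_mul]

/-- The ratio of `√(c + (s + t)²) + (s + t)` to `2t` tends to `1`. This explains the factor `2` in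
the normalization by `log (2t)`. -/
theorem tendsto_log_sqrt_add (hc : 0 ≤ c) (s : ℝ) :
    Tendsto (fun t : ℝ => Real.log (√(c + (s + t) ^ 2) + (s + t)) - Real.log (2 * t))
      atTop (𝓝 0) := by
  have hinv : Tendsto (fun t : ℝ => t⁻¹) atTop (𝓝 0) := tendsto_inv_atTop_zero
  have h1 : Tendsto (fun t : ℝ => (√(c * t⁻¹ ^ 2 + (s * t⁻¹ + 1) ^ 2) + (s * t⁻¹ + 1)) / 2)
      atTop (𝓝 1) := by
    have h2 : Tendsto (fun t : ℝ => s * t⁻¹ + 1) atTop (𝓝 1) := by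
      simpa using (hinv.const_mul s).add_const 1
    have h3 : Tendsto (fun t : ℝ => c * t⁻¹ ^ 2 + (s * t⁻¹ + 1) ^ 2) atTop (𝓝 1) := by
      simpa using ((hinv.pow 2).const_mul c).add (h2.pow 2)
    have h4 := (h3.sqrt.add h2).div_const 2
    simpa using h4
  have h5 := h1.log one_ne_zero
  rw [Real.log_one] at h5
  refine h5.congr' ?_
  filter_upwards [eventually_gt_atTop 0, eventually_gt_atTop (-s)] with t ht hts
  have hst : 0 < s + t := by linarith
  rw [← Real.log_div (by positivity) (by positivity)]
  congr 1
  have h6 : √(c * t⁻¹ ^ 2 + (s * t⁻¹ + 1) ^ 2) = √(c + (s + t) ^ 2) / t := by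
    rw [eq_div_iff ht.ne', ← Real.sqrt_sq ht.le, ← Real.sqrt_mul (by positivity),
      Real.sqrt_sq ht.le]
    congr 1
    field_simp
  rw [h6]
  field_simp

end vertical

/-! ### Derivatives of `𝓑` and of the inverse distance in the image point -/

theorem E3.norm_sub_eq (x q : E3) :
    ‖x - q‖ = √((x 0 - q 0) ^ 2 + (x 1 - q 1) ^ 2 + (q 2 - x 2) ^ 2) := by
  rw [← Real.sqrt_sq (norm_nonneg _), E3.norm_sq]
  simp only [PiLp.sub_apply]
  congr 1
  ring

theorem hasFDerivAt_norm_sub {x q : E3} (h : x ≠ q) : ∃ L : E3 →L[ℝ] ℝ,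
    HasFDerivAt (fun q => ‖x - q‖) L q ∧ ∀ F, L F = -inner ℝ (x - q) F / ‖x - q‖ := by
  have h0 : ‖x - q‖ ≠ 0 := norm_ne_zero_iff.2 (sub_ne_zero.2 h)
  have h1 := (((hasFDerivAt_id q).const_sub x).norm_sq).sqrt (by simpa using h0)
  refine ⟨_, h1.congr_of_eventuallyEq (.of_forall fun y => ?_), fun F => ?_⟩
  · simp [Real.sqrt_sq]
  · simp [Real.sqrt_sq]
    field_simp
    rw [inner_sub_left]
    ring

theorem dipole_inv_norm {x q : E3} (h : x ≠ q) (F : E3) :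
    dipole F (fun y => ‖x - y‖⁻¹) q = inner ℝ (x - q) F / ‖x - q‖ ^ 3 := by
  have h0 : ‖x - q‖ ≠ 0 := norm_ne_zero_iff.2 (sub_ne_zero.2 h)
  obtain ⟨L, h1, h2⟩ := hasFDerivAt_norm_sub h
  have h3 := (hasDerivAt_inv h0).comp_hasFDerivAt q h1
  rw [dipole, HasFDerivAt.fderiv (f := fun y => ‖x - y‖⁻¹) h3, smul_apply, h2, smul_eq_mul]
  field_simp

theorem dipole_dipole_inv_norm {x q : E3} (h : x ≠ q) (F E : E3) :
    dipole E (fun z => dipole F (fun y => ‖x - y‖⁻¹) z) q =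
      3 * inner ℝ (x - q) E * inner ℝ (x - q) F / ‖x - q‖ ^ 5 - inner ℝ E F / ‖x - q‖ ^ 3 := by
  have h0 : ‖x - q‖ ≠ 0 := norm_ne_zero_iff.2 (sub_ne_zero.2 h)
  obtain ⟨L, h1, h2⟩ := hasFDerivAt_norm_sub h
  have hev : (fun z => dipole F (fun y => ‖x - y‖⁻¹) z) =ᶠ[𝓝 q]
      fun z => inner ℝ (x - z) F * (‖x - z‖ ^ 3)⁻¹ := by
    filter_upwards [isOpen_ne.mem_nhds h.symm] with z hz
    rw [dipole_inv_norm (Ne.symm hz), div_eq_mul_inv]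
  have hF : HasFDerivAt (fun z : E3 => inner ℝ (x - z) F) (-innerSL ℝ F) q := by
    have := (innerSL ℝ F).hasFDerivAt.comp q ((hasFDerivAt_id q).const_sub x)
    refine HasFDerivAt.congr_of_eventuallyEq (f := fun z => inner ℝ F (x - z)) ?_
      (.of_forall fun y => real_inner_comm _ _)
    simpa [Function.comp_def] using this
  have h3 := ((hasDerivAt_pow 3 ‖x - q‖).fun_inv (pow_ne_zero 3 h0)).comp_hasFDerivAt q h1
  rw [dipole, (((hF.mul h3).congr_of_eventuallyEq hev)).fderiv]
  simp only [add_apply, smul_apply, h2, neg_apply, smul_eq_mul, innerSL_apply_apply,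
    Function.comp_apply, real_inner_comm E F]
  field_simp
  ring

theorem E3.ne_of_lt {x q : E3} (h : x 2 < q 2) : x ≠ q := by
  rintro rfl; exact lt_irrefl _ h

theorem norm_sub_pos_of_lt {x q : E3} (h : x 2 < q 2) : 0 < ‖x - q‖ :=
  norm_pos_iff.2 (sub_ne_zero.2 (E3.ne_of_lt h))

theorem imageB_eq (x q : E3) :
    imageB x q = (q 2 - x 2) * Real.log (‖x - q‖ + (q 2 - x 2)) - ‖x - q‖ := by
  rw [imageB, potB, E3.norm_sub_eq]

theorem hasFDerivAt_apply_sub (x q : E3) (i : Fin 3) :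
    HasFDerivAt (fun z : E3 => x i - z i) (-EuclideanSpace.proj (𝕜 := ℝ) i) q :=
  ((EuclideanSpace.proj (𝕜 := ℝ) i).hasFDerivAt (x := q)).const_sub (x i)

theorem hasFDerivAt_norm_sub_add {x q : E3} (h : x 2 < q 2) : ∃ L : E3 →L[ℝ] ℝ,
    HasFDerivAt (fun z => ‖x - z‖ + (z 2 - x 2)) L q ∧
      ∀ F, L F = -inner ℝ (x - q) F / ‖x - q‖ + F 2 := by
  obtain ⟨L, h1, h2⟩ := hasFDerivAt_norm_sub (E3.ne_of_lt h)
  refine ⟨_, h1.add (((EuclideanSpace.proj (𝕜 := ℝ) (2 : Fin 3)).hasFDerivAt (x := q)).sub_const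
    (x 2)), fun F => ?_⟩
  rw [add_apply, h2]
  simp

/-- In the variables of `𝓑`, `∂₃𝓑 = log (R + R₃)` and `∂ᵢ𝓑 = -Rᵢ / (R + R₃)` for the horizontal
directions; there the sign changes because `Rᵢ = xᵢ - qᵢ`. -/
theorem dipole_imageB {x q : E3} (h : x 2 < q 2) (F : E3) :
    dipole F (imageB x) q = ((x 0 - q 0) * F 0 + (x 1 - q 1) * F 1) * (‖x - q‖ + (q 2 - x 2))⁻¹
      + F 2 * Real.log (‖x - q‖ + (q 2 - x 2)) := by
  have h0 := norm_sub_pos_of_lt h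
  have h0' : 0 < q 2 - x 2 := sub_pos.2 h
  obtain ⟨L, h1, h2⟩ := hasFDerivAt_norm_sub (E3.ne_of_lt h)
  obtain ⟨L', h1', h2'⟩ := hasFDerivAt_norm_sub_add h
  have h3 := ((((EuclideanSpace.proj (𝕜 := ℝ) (2 : Fin 3)).hasFDerivAt (x := q)).sub_const
    (x 2)).mul (h1'.log (by positivity))).sub h1
  rw [dipole, (h3.congr_of_eventuallyEq (f₁ := imageB x) (.of_forall (imageB_eq x))).fderiv]
  simp only [add_apply, sub_apply, smul_apply, h2, h2', smul_eq_mul, E3.inner_eq, PiLp.sub_apply,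
    EuclideanSpace.coe_proj]
  field_simp
  ring

theorem dipole_dipole_imageB {x q : E3} (h : x 2 < q 2) (F E : E3) :
    dipole E (fun z => dipole F (imageB x) z) q =
      -(E 0 * F 0 + E 1 * F 1) * (‖x - q‖ + (q 2 - x 2))⁻¹
      + (((x 0 - q 0) * F 0 + (x 1 - q 1) * F 1) * -(‖x - q‖ + (q 2 - x 2))⁻¹
        + F 2) * (-inner ℝ (x - q) E / ‖x - q‖ + E 2) * (‖x - q‖ + (q 2 - x 2))⁻¹ := by
  have h0 := norm_sub_pos_of_lt h
  have h0' : 0 < q 2 - x 2 := sub_pos.2 h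
  obtain ⟨L', h1', h2'⟩ := hasFDerivAt_norm_sub_add h
  have hpos : ‖x - q‖ + (q 2 - x 2) ≠ 0 := by positivity
  have hinv := (hasDerivAt_inv hpos).comp_hasFDerivAt q h1'
  have h3 := ((((hasFDerivAt_apply_sub x q 0).mul_const (F 0)).add
    ((hasFDerivAt_apply_sub x q 1).mul_const (F 1))).mul hinv).add ((h1'.log hpos).const_mul (F 2))
  have h4 := h3.congr_of_eventuallyEq (f₁ := fun z => dipole F (imageB x) z) (by
    filter_upwards [(isOpen_lt continuous_const (EuclideanSpace.proj (𝕜 := ℝ)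
      (2 : Fin 3)).continuous).mem_nhds h] with z hz
    exact dipole_imageB hz F)
  rw [dipole, h4.fderiv]
  simp only [add_apply, neg_apply, smul_apply, h2', smul_eq_mul, Function.comp_apply,
    EuclideanSpace.coe_proj, Pi.add_apply]
  field_simp
  ring

/-! ### The second vertical derivative of the image potentials -/

/-- `f` is the second vertical derivative of `Φ` in the lower half-space and is continuous along
vertical lines, and `Φ` is asymptotic to a multiple of the logarithm of twice the depth. -/
def VerticalData (Φ f : E3 → ℝ) : Prop :=
  ∃ Φ' : E3 → ℝ,
    (∀ x : E3, x 2 < 0 → HasDerivAt (fun τ : ℝ => Φ (x + τ • vert)) (Φ' x) 0 ∧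
      HasDerivAt (fun τ : ℝ => Φ' (x + τ • vert)) (f x) 0) ∧
    (∀ x : E3, x 2 < 0 → ContinuousAt (fun τ : ℝ => f (x + τ • vert)) 0) ∧
    (∀ x : E3, x 2 < 0 → ∃ c : ℝ,
      Tendsto (fun t : ℝ => Φ (x - t • vert) - c * Real.log (2 * t)) atTop (𝓝 0))

theorem add_smul_vert_zero (x : E3) (τ : ℝ) : (x + τ • vert) 0 = x 0 := by
  simp [vert]

theorem add_smul_vert_one (x : E3) (τ : ℝ) : (x + τ • vert) 1 = x 1 := by
  simp [vert]

theorem add_smul_vert_two (x : E3) (τ : ℝ) : (x + τ • vert) 2 = x 2 + τ := by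
  simp [vert]

/-- Reduction to functions of the depth `s = a - x₃`, with the horizontal coordinates as parameters.
The first vertical derivative changes sign, the second does not. -/
theorem verticalData_of_hasDerivAt {a : ℝ} (ha : 0 < a) {Φ f : E3 → ℝ} (φ φ₁ φ₂ : ℝ → ℝ → ℝ → ℝ)
    (h1 : ∀ y z s, 0 < s → HasDerivAt (φ y z) (φ₁ y z s) s)
    (h2 : ∀ y z s, 0 < s → HasDerivAt (φ₁ y z) (φ₂ y z s) s)
    (h3 : ∀ y z s, 0 < s → ContinuousAt (φ₂ y z) s)
    (hΦ : ∀ x : E3, x 2 < a → Φ x = φ (x 0) (x 1) (a - x 2))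
    (hf : ∀ x : E3, x 2 < a → f x = φ₂ (x 0) (x 1) (a - x 2))
    (hlim : ∀ y z s, ∃ c : ℝ,
      Tendsto (fun t => φ y z (s + t) - c * Real.log (2 * t)) atTop (𝓝 0)) :
    VerticalData Φ f := by
  have hlin : ∀ x : E3, HasDerivAt (fun τ : ℝ => a - (x 2 + τ)) (-1) 0 := fun x => by
    simpa using ((hasDerivAt_id (0 : ℝ)).const_add (x 2)).const_sub a
  have hev : ∀ x : E3, x 2 < 0 → ∀ᶠ τ : ℝ in 𝓝 0, (x + τ • vert) 2 < a := by
    intro x hx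
    filter_upwards [gt_mem_nhds (show (0 : ℝ) < a - x 2 by linarith)] with τ hτ
    rw [add_smul_vert_two]
    linarith
  refine ⟨fun x => -φ₁ (x 0) (x 1) (a - x 2), fun x hx => ⟨?_, ?_⟩, fun x hx => ?_, fun x hx => ?_⟩
  · have h := HasDerivAt.comp (0 : ℝ) (h₂ := φ (x 0) (x 1))
      (by simpa using h1 (x 0) (x 1) (a - x 2) (by linarith)) (hlin x)
    refine (h.congr_of_eventuallyEq ?_).congr_deriv ?_
    · filter_upwards [hev x hx] with τ hτ
      rw [hΦ _ hτ]
      simp only [add_smul_vert_zero, add_smul_vert_one, add_smul_vert_two, Function.comp_apply]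
    · simp
  · have h := (HasDerivAt.comp (0 : ℝ) (h₂ := φ₁ (x 0) (x 1))
      (by simpa using h2 (x 0) (x 1) (a - x 2) (by linarith)) (hlin x)).neg
    refine (h.congr_of_eventuallyEq ?_).congr_deriv ?_
    · refine .of_forall fun τ => ?_
      simp only [add_smul_vert_zero, add_smul_vert_one, add_smul_vert_two, Function.comp_apply,
        Pi.neg_apply]
    · rw [hf x (by linarith)]
      simp
  · have h := ContinuousAt.comp (x := (0 : ℝ)) (g := φ₂ (x 0) (x 1))
      (by simpa using h3 (x 0) (x 1) (a - x 2) (by linarith)) (hlin x).continuousAt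
    refine h.congr ?_
    filter_upwards [hev x hx] with τ hτ
    rw [hf _ hτ]
    simp only [add_smul_vert_zero, add_smul_vert_one, add_smul_vert_two, Function.comp_apply]
  · obtain ⟨c, hc⟩ := hlim (x 0) (x 1) (a - x 2)
    refine ⟨c, hc.congr' ?_⟩
    filter_upwards [eventually_ge_atTop 0] with t ht
    have hxt : x - t • vert = x + (-t) • vert := by rw [neg_smul, sub_eq_add_neg]
    rw [hxt, hΦ _ (by rw [add_smul_vert_two]; linarith)]
    simp only [add_smul_vert_zero, add_smul_vert_one, add_smul_vert_two]
    rw [show a - (x 2 + -t) = a - x 2 + t by ring]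

/-- This is `∂₃²𝓑 = 1/R` after one derivative in `q`. That derivative also removes the `t log t`
growth of `𝓑`; only a logarithm with coefficient `F 2` remains. -/
theorem verticalData_dipole {q : E3} (hq : 0 < q 2) (F : E3) :
    VerticalData (fun x => dipole F (imageB x) q) (fun x => dipole F (fun y => ‖x - y‖⁻¹) q) := by
  have hc : ∀ y z : ℝ, 0 ≤ (y - q 0) ^ 2 + (z - q 1) ^ 2 := fun y z => by positivity
  refine verticalData_of_hasDerivAt hq
    (fun y z s => ((y - q 0) * F 0 + (z - q 1) * F 1) *
        (1 / (√((y - q 0) ^ 2 + (z - q 1) ^ 2 + s ^ 2) + s))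
      + F 2 * Real.log (√((y - q 0) ^ 2 + (z - q 1) ^ 2 + s ^ 2) + s)) _ _
    (fun y z s hs => ((hasDerivAt_one_div_sqrt_add (hc y z) hs).const_mul _).add
      ((hasDerivAt_log_sqrt_add (hc y z) hs).const_mul _))
    (fun y z s hs => ((hasDerivAt_neg_one_div_sqrt_mul (hc y z) hs).const_mul _).add
      ((hasDerivAt_one_div_sqrt (hc y z) hs).const_mul _)) ?_ ?_ ?_ ?_
  · intro y z s hs
    have := (sqrt_add_sq_pos (hc y z) hs).ne'
    fun_prop (disch := positivity)
  · intro x hx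
    rw [dipole_imageB hx, E3.norm_sub_eq, one_div]
  · intro x hx
    rw [dipole_inv_norm (E3.ne_of_lt hx), E3.norm_sub_eq, E3.inner_eq]
    simp only [PiLp.sub_apply]
    ring
  · intro y z s
    refine ⟨F 2, ?_⟩
    have := ((tendsto_one_div_sqrt_add (hc y z) s).const_mul
      ((y - q 0) * F 0 + (z - q 1) * F 1)).add ((tendsto_log_sqrt_add (hc y z) s).const_mul (F 2))
    simp only [mul_zero, add_zero] at this
    refine this.congr fun t => ?_
    ring

/-- The double-layer operator contains no mixed horizontal-vertical derivative, so this case and the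
purely vertical one suffice. Both potentials vanish at infinite depth, so the logarithm has
coefficient `0`. -/
theorem verticalData_dipole_dipole_horizontal {q : E3} (hq : 0 < q 2) {E F : E3} (hE : E 2 = 0)
    (hF : F 2 = 0) :
    VerticalData (fun x => dipole E (fun z => dipole F (imageB x) z) q)
      (fun x => dipole E (fun z => dipole F (fun y => ‖x - y‖⁻¹) z) q) := by
  have hc : ∀ y z : ℝ, 0 ≤ (y - q 0) ^ 2 + (z - q 1) ^ 2 := fun y z => by positivity
  refine verticalData_of_hasDerivAt hq
    (fun y z s => -(E 0 * F 0 + E 1 * F 1) *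
        (1 / (√((y - q 0) ^ 2 + (z - q 1) ^ 2 + s ^ 2) + s))
      + ((y - q 0) * F 0 + (z - q 1) * F 1) * ((y - q 0) * E 0 + (z - q 1) * E 1) *
        (1 / (√((y - q 0) ^ 2 + (z - q 1) ^ 2 + s ^ 2) *
          (√((y - q 0) ^ 2 + (z - q 1) ^ 2 + s ^ 2) + s) ^ 2))) _ _
    (fun y z s hs => ((hasDerivAt_one_div_sqrt_add (hc y z) hs).const_mul _).add
      ((hasDerivAt_one_div_sqrt_mul_sq (hc y z) hs).const_mul _))
    (fun y z s hs => ((hasDerivAt_neg_one_div_sqrt_mul (hc y z) hs).const_mul _).add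
      ((hasDerivAt_neg_div_sqrt_mul_sq (hc y z) hs).const_mul _)) ?_ ?_ ?_ ?_
  · intro y z s hs
    have := (sqrt_add_sq_pos (hc y z) hs).ne'
    fun_prop (disch := positivity)
  · intro x hx
    have h0 := norm_sub_pos_of_lt hx
    have h0' : 0 < q 2 - x 2 := sub_pos.2 hx
    rw [dipole_dipole_imageB hx, E3.inner_eq, ← E3.norm_sub_eq, hE, hF]
    simp only [PiLp.sub_apply]
    field_simp
    ring
  · intro x hx
    rw [dipole_dipole_inv_norm (E3.ne_of_lt hx), ← E3.norm_sub_eq, E3.inner_eq, E3.inner_eq,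
      E3.inner_eq, hE, hF]
    simp only [PiLp.sub_apply]
    ring
  · intro y z s
    refine ⟨0, ?_⟩
    have := ((tendsto_one_div_sqrt_add (hc y z) s).const_mul (-(E 0 * F 0 + E 1 * F 1))).add
      ((tendsto_one_div_sqrt_mul_sq (hc y z) s).const_mul
      (((y - q 0) * F 0 + (z - q 1) * F 1) * ((y - q 0) * E 0 + (z - q 1) * E 1)))
    simp only [mul_zero, add_zero] at this
    refine this.congr fun t => ?_
    ring

theorem verticalData_dipole_dipole_vert {q : E3} (hq : 0 < q 2) :
    VerticalData (fun x => dipole vert (fun z => dipole vert (imageB x) z) q)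
      (fun x => dipole vert (fun z => dipole vert (fun y => ‖x - y‖⁻¹) z) q) := by
  have hc : ∀ y z : ℝ, 0 ≤ (y - q 0) ^ 2 + (z - q 1) ^ 2 := fun y z => by positivity
  have v0 : vert 0 = 0 := by simp [vert]
  have v1 : vert 1 = 0 := by simp [vert]
  have v2 : vert 2 = 1 := by simp [vert]
  refine verticalData_of_hasDerivAt hq
    (fun y z s => 1 / √((y - q 0) ^ 2 + (z - q 1) ^ 2 + s ^ 2)) _ _
    (fun y z s hs => hasDerivAt_one_div_sqrt (hc y z) hs)
    (fun y z s hs => hasDerivAt_neg_div_sqrt_pow (hc y z) hs) ?_ ?_ ?_ ?_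
  · intro y z s hs
    have := (sqrt_add_sq_pos (hc y z) hs).ne'
    fun_prop (disch := positivity)
  · intro x hx
    have h0 := norm_sub_pos_of_lt hx
    have h0' : 0 < q 2 - x 2 := sub_pos.2 hx
    rw [dipole_dipole_imageB hx, E3.inner_eq, ← E3.norm_sub_eq, v0, v1, v2]
    simp only [PiLp.sub_apply]
    field_simp
    ring
  · intro x hx
    rw [dipole_dipole_inv_norm (E3.ne_of_lt hx), ← E3.norm_sub_eq, E3.inner_eq, E3.inner_eq, v0, v1,
      v2]
    simp only [PiLp.sub_apply]
    ring
  · intro y z s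
    refine ⟨0, ?_⟩
    simpa using tendsto_one_div_sqrt (hc y z) s

/-! ### Antiderivatives that vanish at minus infinity -/

open MeasureTheory Set in
theorem integrableOn_Iic_div_sub_pow {w t : ℝ} (h : t < w) {j : ℕ} (hj : 0 < j) :
    IntegrableOn (fun τ : ℝ => (j : ℝ) / (w - τ) ^ (j + 1)) (Iic t) ∧
      ∫ τ in Iic t, (j : ℝ) / (w - τ) ^ (j + 1) = ((w - t) ^ j)⁻¹ := by
  have hd : ∀ τ ∈ Iic t, HasDerivAt (fun τ : ℝ => ((w - τ) ^ j)⁻¹)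
      ((j : ℝ) / (w - τ) ^ (j + 1)) τ := by
    intro τ hτ
    have h0 : 0 < w - τ := by linarith [mem_Iic.1 hτ]
    have h1 : HasDerivAt (fun τ : ℝ => w - τ) (-1) τ := by
      simpa using (hasDerivAt_id τ).const_sub w
    refine ((h1.pow j).fun_inv (pow_ne_zero j h0.ne')).congr_deriv ?_
    obtain ⟨k, rfl⟩ : ∃ k, j = k + 1 := ⟨j - 1, by omega⟩
    simp only [Pi.pow_apply, Nat.add_sub_cancel]
    field_simp
    ring
  have hlim : Tendsto (fun τ : ℝ => ((w - τ) ^ j)⁻¹) atBot (𝓝 0) := by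
    refine Tendsto.inv_tendsto_atTop ((tendsto_pow_atTop hj.ne').comp ?_)
    exact tendsto_atTop_add_const_left atBot w tendsto_neg_atBot_atTop
  have hpos : ∀ τ ∈ Iic t, 0 ≤ (j : ℝ) / (w - τ) ^ (j + 1) := by
    intro τ hτ
    have h0 : 0 < w - τ := by linarith [mem_Iic.1 hτ]
    positivity
  have hcont : ContinuousOn (fun τ : ℝ => (j : ℝ) / (w - τ) ^ (j + 1)) (Iic t) := by
    refine continuousOn_const.div (by fun_prop) fun τ hτ => ?_
    exact pow_ne_zero _ (by linarith [mem_Iic.1 hτ])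
  have hint : IntegrableOn (fun τ : ℝ => (j : ℝ) / (w - τ) ^ (j + 1)) (Iic t) := by
    refine integrableOn_Iic_of_intervalIntegral_norm_bounded (l := atBot) (a := id)
      ((w - t) ^ j)⁻¹ t (fun i => ?_) tendsto_id ?_
    · exact ((hcont.mono Icc_subset_Iic_self).integrableOn_compact isCompact_Icc).mono_set
        Ioc_subset_Icc_self
    · filter_upwards [eventually_le_atBot t] with i hi
      have hsub : uIcc i t ⊆ Iic t := by rw [uIcc_of_le hi]; exact Icc_subset_Iic_self
      have h1 := intervalIntegral.integral_eq_sub_of_hasDerivAt (fun τ hτ => hd τ (hsub hτ))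
        ((hcont.mono hsub).intervalIntegrable)
      have h2 : ∫ τ in i..t, ‖(j : ℝ) / (w - τ) ^ (j + 1)‖ =
          ∫ τ in i..t, (j : ℝ) / (w - τ) ^ (j + 1) :=
        intervalIntegral.integral_congr fun τ hτ => Real.norm_of_nonneg (hpos τ (hsub hτ))
      rw [id, h2, h1]
      have h0 : 0 < w - i := by linarith
      have : 0 ≤ ((w - i) ^ j)⁻¹ := by positivity
      linarith
  exact ⟨hint, by rw [integral_Iic_of_hasDerivAt_of_tendsto' hd hint hlim, sub_zero]⟩

-- The antiderivative is the integral from `-∞`. A decay bound on some lower half-line makes it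
-- exist, while the estimate at `t` is stated for any `A` valid below `t`: near the center `S` no
-- bound on the remainder is available.
open MeasureTheory Set in
theorem exists_antideriv_of_norm_le {e : ℝ → ℂ} {c w : ℝ} (hcw : c ≤ w)
    (he : ContinuousOn e (Iio c)) {j : ℕ} (hj : 0 < j)
    (hb : ∃ t < c, ∃ A : ℝ, ∀ τ ≤ t, ‖e τ‖ ≤ A * (j / (w - τ) ^ (j + 1))) :
    ∃ W : ℝ → ℂ, (∀ t < c, HasDerivAt W (e t) t) ∧ ∀ t < c, ∀ A : ℝ,
      (∀ τ ≤ t, ‖e τ‖ ≤ A * (j / (w - τ) ^ (j + 1))) → ‖W t‖ ≤ A * ((w - t) ^ j)⁻¹ := by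
  obtain ⟨t₀, ht₀, A₀, hA₀⟩ := hb
  have hint₀ : IntegrableOn e (Iic t₀) := by
    refine Integrable.mono' ((integrableOn_Iic_div_sub_pow (ht₀.trans_le hcw) hj).1.const_mul A₀)
      ((he.mono (Iic_subset_Iio.2 ht₀)).aestronglyMeasurable measurableSet_Iic) ?_
    exact (ae_restrict_iff' measurableSet_Iic).2 (.of_forall fun τ hτ => hA₀ τ hτ)
  have hint : ∀ t < c, IntegrableOn e (Iic t) := by
    intro t ht
    have h1 : IntegrableOn e (Icc t₀ t) :=
      (he.mono fun τ hτ => lt_of_le_of_lt hτ.2 ht).integrableOn_compact isCompact_Icc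
    refine (hint₀.union h1).mono_set fun τ hτ => ?_
    rcases le_total τ t₀ with h | h
    · exact Or.inl h
    · exact Or.inr ⟨h, hτ⟩
  refine ⟨fun t => ∫ τ in Iic t, e τ, fun t ht => ?_, fun t ht A hA => ?_⟩
  · have hmem : Iio c ∈ 𝓝 t := Iio_mem_nhds ht
    obtain ⟨a, hat⟩ := exists_lt t
    have hac : a < c := hat.trans ht
    have h1 : HasDerivAt (fun u => ∫ τ in a..u, e τ) (e t) t := by
      refine intervalIntegral.integral_hasDerivAt_right ?_
        (he.stronglyMeasurableAtFilter isOpen_Iio t ht) (he.continuousAt hmem)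
      refine (he.mono ?_).intervalIntegrable
      rw [uIcc_of_le hat.le]
      exact fun τ hτ => lt_of_le_of_lt hτ.2 ht
    refine (h1.add_const (∫ τ in Iic a, e τ)).congr_of_eventuallyEq ?_
    filter_upwards [hmem] with u hu
    rw [← intervalIntegral.integral_Iic_sub_Iic (hint a hac) (hint u hu), sub_add_cancel]
  · have h1 := integrableOn_Iic_div_sub_pow (ht.trans_le hcw) hj
    rw [← h1.2, ← integral_const_mul]
    refine norm_integral_le_of_norm_le (h1.1.const_mul A) ?_
    exact (ae_restrict_iff' measurableSet_Iic).2 (.of_forall fun τ hτ => hA τ hτ)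

theorem exists_second_antideriv {e : ℝ → ℂ} {c w : ℝ} (hcw : c ≤ w)
    (he : ContinuousOn e (Set.Iio c))
    (hb : ∃ t < c, ∃ A : ℝ, ∀ τ ≤ t, ‖e τ‖ ≤ A / (w - τ) ^ 3) :
    ∃ W W₁ : ℝ → ℂ, (∀ t < c, HasDerivAt W (W₁ t) t ∧ HasDerivAt W₁ (e t) t) ∧
      Tendsto W atBot (𝓝 0) ∧
      ∀ t < c, ∀ A : ℝ, (∀ τ ≤ t, ‖e τ‖ ≤ A / (w - τ) ^ 3) → ‖W t‖ ≤ A / (2 * (w - t)) := by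
  -- Rewrites the cubic decay as the exact derivative of an inverse square; the two integrations use
  -- `j = 2` and then `j = 1`.
  have hconv : ∀ A τ : ℝ, A / (w - τ) ^ 3 = A / 2 * ((2 : ℕ) / (w - τ) ^ (2 + 1)) := fun A τ => by
    push_cast; ring
  have hconv' : ∀ A τ : ℝ, A * ((w - τ) ^ 2)⁻¹ = A * ((1 : ℕ) / (w - τ) ^ (1 + 1)) := fun A τ => by
    push_cast; ring
  obtain ⟨t₀, ht₀, A₀, hA₀⟩ := hb
  obtain ⟨W₁, h1, h2⟩ := exists_antideriv_of_norm_le hcw he two_pos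
    ⟨t₀, ht₀, A₀ / 2, fun τ hτ => (hA₀ τ hτ).trans_eq (hconv A₀ τ)⟩
  have h3 : ∀ t < c, ∀ A : ℝ, (∀ τ ≤ t, ‖e τ‖ ≤ A / (w - τ) ^ 3) →
      ∀ τ ≤ t, ‖W₁ τ‖ ≤ A / 2 * ((1 : ℕ) / (w - τ) ^ (1 + 1)) := fun t ht A hA τ hτ => by
    rw [← hconv']
    exact h2 τ (hτ.trans_lt ht) _ fun σ hσ => (hA σ (hσ.trans hτ)).trans_eq (hconv A σ)
  obtain ⟨W, h4, h5⟩ := exists_antideriv_of_norm_le hcw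
    (fun t ht => (h1 t ht).continuousAt.continuousWithinAt) one_pos
    ⟨t₀, ht₀, A₀ / 2, h3 t₀ ht₀ A₀ hA₀⟩
  have h6 : ∀ t < c, ∀ A : ℝ, (∀ τ ≤ t, ‖e τ‖ ≤ A / (w - τ) ^ 3) →
      ‖W t‖ ≤ A / (2 * (w - t)) := fun t ht A hA => by
    refine (h5 t ht (A / 2) (h3 t ht A hA)).trans_eq ?_
    rw [pow_one, div_mul_eq_div_div, div_eq_mul_inv (A / 2)]
  refine ⟨W, W₁, fun t ht => ⟨h4 t ht, h1 t ht⟩, ?_, h6⟩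
  refine squeeze_zero_norm' (a := fun t => A₀ / (2 * (w - t))) ?_ ?_
  · filter_upwards [eventually_le_atBot t₀] with t ht
    exact h6 t (ht.trans_lt ht₀) A₀ fun τ hτ => hA₀ τ (hτ.trans ht)
  · refine Tendsto.const_div_atTop ?_ _
    exact Tendsto.const_mul_atTop two_pos
      (tendsto_atTop_add_const_left atBot w tendsto_neg_atBot_atTop)

/-! ### Uniqueness of the normalized second antiderivative -/

/-- The functions `t log t`, `t`, `log t`, `1` are of strictly decreasing order. Dividing by the
leading one in turn eliminates `c₁`, `k` and `c₂`, and then `a` is the limit. -/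
theorem eq_zero_of_tendsto_affine_sub {a k c₁ c₂ : ℂ}
    (h : Tendsto (fun t : ℝ => a - k * (t : ℂ) -
      (c₁ * ((t * Real.log (2 * t) - t : ℝ) : ℂ) + c₂ * ((Real.log (2 * t) : ℝ) : ℂ)))
      atTop (𝓝 0)) : a = 0 := by
  have hlog : Tendsto (fun t : ℝ => Real.log (2 * t)) atTop atTop :=
    Real.tendsto_log_atTop.comp (tendsto_id.const_mul_atTop two_pos)
  have hL : Tendsto (fun t : ℝ => (((Real.log (2 * t))⁻¹ : ℝ) : ℂ)) atTop (𝓝 0) := by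
    rw [← Complex.ofReal_zero]
    exact (Complex.continuous_ofReal.tendsto 0).comp hlog.inv_tendsto_atTop
  have hT : Tendsto (fun t : ℝ => ((t⁻¹ : ℝ) : ℂ)) atTop (𝓝 0) := by
    rw [← Complex.ofReal_zero]
    exact (Complex.continuous_ofReal.tendsto 0).comp tendsto_inv_atTop_zero
  have hLT : Tendsto (fun t : ℝ => ((Real.log (2 * t) * t⁻¹ : ℝ) : ℂ)) atTop (𝓝 0) := by
    rw [← Complex.ofReal_zero]
    refine (Complex.continuous_ofReal.tendsto 0).comp ?_
    have h1 := ((Real.isLittleO_log_id_atTop).tendsto_div_nhds_zero.comp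
      (tendsto_id.const_mul_atTop (two_pos (α := ℝ)))).mul_const 2
    rw [zero_mul] at h1
    refine h1.congr fun t => ?_
    simp only [Function.comp_apply, id]
    field_simp
  have hpos : ∀ᶠ t : ℝ in atTop, t ≠ 0 ∧ Real.log (2 * t) ≠ 0 := by
    filter_upwards [eventually_gt_atTop 0, hlog.eventually_gt_atTop 0] with t h1 h2
    exact ⟨h1.ne', h2.ne'⟩
  have hc₁ : c₁ = 0 := by
    have e1 := (h.mul hL).mul hT
    have e2 := ((((hL.mul hT).const_mul a).sub (hL.const_mul k)).sub
      ((hL.const_sub 1).const_mul c₁)).sub (hT.const_mul c₂)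
    have := tendsto_nhds_unique (e1.congr' ?_) e2
    · simpa using this
    · filter_upwards [hpos] with t ht
      have h1 : (t : ℂ) ≠ 0 := Complex.ofReal_ne_zero.2 ht.1
      have h2 : ((Real.log (2 * t) : ℝ) : ℂ) ≠ 0 := Complex.ofReal_ne_zero.2 ht.2
      push_cast at h2 ⊢
      field_simp
      ring
  subst hc₁
  have hk : k = 0 := by
    have e1 := h.mul hT
    have e2 := ((hT.const_mul a).sub_const k).sub (hLT.const_mul c₂)
    have := tendsto_nhds_unique (e1.congr' ?_) e2
    · simpa using this
    · filter_upwards [hpos] with t ht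
      have h1 : (t : ℂ) ≠ 0 := Complex.ofReal_ne_zero.2 ht.1
      push_cast
      field_simp
      ring
  subst hk
  have hc₂ : c₂ = 0 := by
    have e1 := h.mul hL
    have e2 := (hL.const_mul a).sub_const c₂
    have := tendsto_nhds_unique (e1.congr' ?_) e2
    · simpa using this
    · filter_upwards [hpos] with t ht
      have h2 : ((Real.log (2 * t) : ℝ) : ℂ) ≠ 0 := Complex.ofReal_ne_zero.2 ht.2
      push_cast at h2 ⊢
      field_simp
      ring
  subst hc₂
  simp only [zero_mul, add_zero, sub_zero] at h
  exact tendsto_nhds_unique tendsto_const_nhds h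

theorem hasDerivAt_along_vert {G : E3 → ℂ} {G' : ℂ} {x : E3} {t : ℝ}
    (h : HasDerivAt (fun τ : ℝ => G (x + t • vert + τ • vert)) G' 0) :
    HasDerivAt (fun τ : ℝ => G (x + τ • vert)) G' t := by
  have h1 := HasDerivAt.comp_sub_const t t (by simpa using h)
  refine h1.congr_of_eventuallyEq (.of_forall fun τ => ?_)
  simp only [add_assoc, ← add_smul]
  rw [add_sub_cancel]

theorem exists_affine_of_hasDerivAt {D D₁ : ℝ → ℂ} {c : ℝ}
    (h : ∀ t < c, HasDerivAt D (D₁ t) t ∧ HasDerivAt D₁ 0 t) :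
    ∃ a k : ℂ, ∀ t < c, D t = a + k * t := by
  obtain ⟨k, hk⟩ := isOpen_Iio.exists_is_const_of_deriv_eq_zero isPreconnected_Iio
    (fun t ht => (h t ht).2.differentiableAt.differentiableWithinAt)
    (fun t (ht : t < c) => (h t ht).2.deriv)
  have hd : ∀ t < c, HasDerivAt (fun t : ℝ => D t - k * t) 0 t := fun t ht => by
    have h1 := (h t ht).1.sub ((Complex.ofRealCLM.hasDerivAt (x := t)).const_mul k)
    refine h1.congr_deriv ?_
    rw [hk t ht]
    simp
  obtain ⟨a, ha⟩ := isOpen_Iio.exists_is_const_of_deriv_eq_zero isPreconnected_Iio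
    (fun t ht => (hd t ht).differentiableAt.differentiableWithinAt)
    (fun t (ht : t < c) => (hd t ht).deriv)
  exact ⟨a, k, fun t ht => by rw [← ha t ht]; ring⟩

/-- On each vertical half-line the difference of two antiderivatives is affine, and both growth
conditions together force its constant term, the difference at the point itself, to vanish. -/
theorem IsInvD3Sq.eqOn {d : ℝ} {f G H : E3 → ℂ} (hG : IsInvD3Sq {x | x 2 < 0 ∧ x 2 < d} f G)
    (hH : IsInvD3Sq {x | x 2 < 0 ∧ x 2 < d} f H) : Set.EqOn G H {x | x 2 < 0 ∧ x 2 < d} := by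
  intro x hx
  obtain ⟨⟨G', hG'⟩, hG2⟩ := hG
  obtain ⟨⟨H', hH'⟩, hH2⟩ := hH
  have hmem : ∀ t : ℝ, t < min 0 d - x 2 → x + t • vert ∈ {x : E3 | x 2 < 0 ∧ x 2 < d} := by
    intro t ht
    have h1 := min_le_left 0 d
    have h2 := min_le_right 0 d
    rw [Set.mem_ofPred_eq, add_smul_vert_two]
    constructor <;> linarith
  have hc : 0 < min 0 d - x 2 := sub_pos.2 (lt_min hx.1 hx.2)
  obtain ⟨a, k, hak⟩ := exists_affine_of_hasDerivAt
    (D := fun t => G (x + t • vert) - H (x + t • vert))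
    (D₁ := fun t => G' (x + t • vert) - H' (x + t • vert)) (c := min 0 d - x 2) fun t ht => by
      obtain ⟨g1, g2⟩ := hG' _ (hmem t ht)
      obtain ⟨h1, h2⟩ := hH' _ (hmem t ht)
      exact ⟨(hasDerivAt_along_vert g1).sub (hasDerivAt_along_vert h1),
        ((hasDerivAt_along_vert g2).sub (hasDerivAt_along_vert h2)).congr_deriv (sub_self _)⟩
  obtain ⟨c₁, c₂, h1⟩ := hG2 x hx
  obtain ⟨c₁', c₂', h2⟩ := hH2 x hx
  have h0 := hak 0 hc
  have ha : a = 0 := by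
    refine eq_zero_of_tendsto_affine_sub (k := k) (c₁ := c₁ - c₁') (c₂ := c₂ - c₂') ?_
    have h3 := h1.sub h2
    rw [sub_zero] at h3
    refine h3.congr' ?_
    filter_upwards [eventually_ge_atTop 0] with t ht
    have h4 := hak (-t) (by linarith)
    simp only [neg_smul, ← sub_eq_add_neg] at h4
    push_cast at h4 ⊢
    linear_combination h4
  rw [ha] at h0
  simpa [sub_eq_zero] using h0

/-! ### Derivatives and continuity of the multipole terms -/

section

variable {X : Type*} [TopologicalSpace X] {f g : X → ℝ} {x : X}

theorem ContinuousAt.zonal (hf : ContinuousAt f x) (hg : ContinuousAt g x) (n : ℕ) :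
    ContinuousAt (fun x => zonal n (f x) (g x)) x := by
  induction n using Nat.twoStepInduction with
  | zero => exact continuousAt_const
  | one => exact hf
  | more n h0 h1 =>
    simp only [_root_.zonal]
    fun_prop

theorem ContinuousAt.zonalD (hf : ContinuousAt f x) (hg : ContinuousAt g x) (n : ℕ) :
    ContinuousAt (fun x => zonalD n (f x) (g x)) x := by
  induction n using Nat.twoStepInduction with
  | zero => exact continuousAt_const
  | one => exact continuousAt_const
  | more n h0 h1 =>
    have := hf.zonal hg (n + 1)
    simp only [_root_.zonalD]
    fun_prop

theorem ContinuousAt.zonalDD (hf : ContinuousAt f x) (hg : ContinuousAt g x) (n : ℕ) :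
    ContinuousAt (fun x => zonalDD n (f x) (g x)) x := by
  induction n using Nat.twoStepInduction with
  | zero => exact continuousAt_const
  | one => exact continuousAt_const
  | more n h0 h1 =>
    have := hf.zonalD hg (n + 1)
    simp only [_root_.zonalDD]
    fun_prop

end

theorem continuousAt_multipoleD (n : ℕ) {S x : E3} (hx : x ≠ S) (F q : E3) :
    ContinuousAt (fun x => multipoleD n S x F q) x := by
  have h0 : ‖x - S‖ ≠ 0 := norm_ne_zero_iff.2 (sub_ne_zero.2 hx)
  have hv : ContinuousAt (fun x : E3 => (‖x - S‖ ^ 2)⁻¹) x := by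
    fun_prop (disch := positivity)
  have h3 : ContinuousAt (fun x : E3 => (‖x - S‖ ^ 3)⁻¹) x := by
    fun_prop (disch := positivity)
  have hc : ContinuousAt (fun x : E3 => inner ℝ (x - S) (q - S) * (‖x - S‖ ^ 2)⁻¹) x := by
    fun_prop
  have hw : ContinuousAt (fun x : E3 => ‖q - S‖ ^ 2 * (‖x - S‖ ^ 2)⁻¹) x := by fun_prop
  have hD := hc.zonalD hw
  have hD0 := hD n
  have hD1 := hD (n - 1)
  unfold multipoleD
  fun_prop

theorem continuousAt_multipoleDD (n : ℕ) {S x : E3} (hx : x ≠ S) (F E q : E3) :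
    ContinuousAt (fun x => multipoleDD n S x F E q) x := by
  have h0 : ‖x - S‖ ≠ 0 := norm_ne_zero_iff.2 (sub_ne_zero.2 hx)
  have hv : ContinuousAt (fun x : E3 => (‖x - S‖ ^ 2)⁻¹) x := by
    fun_prop (disch := positivity)
  have h3 : ContinuousAt (fun x : E3 => (‖x - S‖ ^ 3)⁻¹) x := by
    fun_prop (disch := positivity)
  have hc : ContinuousAt (fun x : E3 => inner ℝ (x - S) (q - S) * (‖x - S‖ ^ 2)⁻¹) x := by
    fun_prop
  have hw : ContinuousAt (fun x : E3 => ‖q - S‖ ^ 2 * (‖x - S‖ ^ 2)⁻¹) x := by fun_prop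
  have hD1 := hc.zonalD hw (n - 1)
  have hDD0 := hc.zonalDD hw n
  have hDD1 := hc.zonalDD hw (n - 1)
  have hDD2 := hc.zonalDD hw (n - 2)
  unfold multipoleDD
  fun_prop

theorem dipole_sum_mul {ι : Type*} (s : Finset ι) (A : ι → ℂ) {g : ι → E3 → ℂ}
    (hg : ∀ i ∈ s, Differentiable ℝ (g i)) (F q : E3) :
    dipole F (fun y => ∑ i ∈ s, A i * g i y) q = ∑ i ∈ s, A i * dipole F (g i) q := by
  have h : HasFDerivAt (fun y => ∑ i ∈ s, A i * g i y) (∑ i ∈ s, A i • fderiv ℝ (g i) q) q :=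
    HasFDerivAt.fun_sum fun i hi => (hg i hi q).hasFDerivAt.const_mul (A i)
  rw [dipole, h.fderiv, sum_apply]
  rfl

theorem dipole_ofReal {g : E3 → ℝ} (hg : Differentiable ℝ g) (F q : E3) :
    dipole F (fun y => (g y : ℂ)) q = (dipole F g q : ℝ) := by
  have h := Complex.ofRealCLM.hasFDerivAt.comp q (hg q).hasFDerivAt
  rw [dipole, HasFDerivAt.fderiv (f := fun y => (g y : ℂ)) h]
  rfl

theorem ContDiff.differentiable_dipole {V : Type*} [NormedAddCommGroup V] [NormedSpace ℝ V]
    {g : E3 → V} (hg : ContDiff ℝ 2 g) (F : E3) : Differentiable ℝ fun y => dipole F g y :=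
  ((hg.fderiv_right (m := 1) (by norm_num)).clm_apply contDiff_const).differentiable (by norm_num)

theorem natAbs_neg_le_of_mem_Icc {n : ℕ} {m : ℤ} (hm : m ∈ Finset.Icc (-(n : ℤ)) n) :
    (-m).natAbs ≤ n := by
  rw [Finset.mem_Icc] at hm
  omega

/-- The addition theorem differentiated in `q`. It identifies the degree-`n` part of the multipole
sum with the derivative of the `n`-th term of the expansion. -/
theorem sum_dipole_solidY_mul_sphY (n : ℕ) {S x : E3} (hx : x ≠ S) (F q : E3) :
    ∑ m ∈ Finset.Icc (-(n : ℤ)) n, ((4 * Real.pi / (2 * n + 1) : ℝ) : ℂ) *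
      (sphY n m (polarAngle (x - S)) (azimuth (x - S)) / (‖x - S‖ : ℂ) ^ (n + 1)) *
      dipole F (solidY S n (-m)) q = (dipole F (multipole n S x) q : ℝ) := by
  rw [← dipole_ofReal ((contDiff_multipole n S x).differentiable one_ne_zero) F q,
    ← dipole_sum_mul _ (fun m => ((4 * Real.pi / (2 * n + 1) : ℝ) : ℂ) *
      (sphY n m (polarAngle (x - S)) (azimuth (x - S)) / (‖x - S‖ : ℂ) ^ (n + 1)))
      (g := fun m => solidY S n (-m)) (fun m hm =>
        (contDiff_solidY S (natAbs_neg_le_of_mem_Icc hm)).differentiable one_ne_zero)]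
  simp only [sum_solidY_mul_sphY n hx]

theorem sum_dipole_dipole_solidY_mul_sphY (n : ℕ) {S x : E3} (hx : x ≠ S) (F E q : E3) :
    ∑ m ∈ Finset.Icc (-(n : ℤ)) n, ((4 * Real.pi / (2 * n + 1) : ℝ) : ℂ) *
      (sphY n m (polarAngle (x - S)) (azimuth (x - S)) / (‖x - S‖ : ℂ) ^ (n + 1)) *
      dipole E (fun y => dipole F (solidY S n (-m)) y) q =
        (dipole E (fun y => dipole F (multipole n S x) y) q : ℝ) := by
  rw [← dipole_ofReal ((contDiff_multipole n S x).differentiable_dipole F) E q,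
    ← dipole_sum_mul _ (fun m => ((4 * Real.pi / (2 * n + 1) : ℝ) : ℂ) *
      (sphY n m (polarAngle (x - S)) (azimuth (x - S)) / (‖x - S‖ : ℂ) ^ (n + 1)))
      (g := fun m y => dipole F (solidY S n (-m)) y) (fun m hm =>
        (contDiff_solidY S (natAbs_neg_le_of_mem_Icc hm)).differentiable_dipole F)]
  simp only [sum_dipole_solidY_mul_sphY n hx]

/-! ### Potentials with a multipole expansion of their second vertical derivative -/

/-- `Φ` has a second vertical derivative that is, at distance at least `b` from `S`, the sum of the
multipole expansion with coefficients `M`, with an estimate for the terms. -/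
def FarData (S : E3) (b : ℝ) (Φ : E3 → ℝ) (M : ℕ → ℤ → ℂ) : Prop :=
  ∃ (f : E3 → ℝ) (t : ℕ → E3 → ℝ) (u : ℕ → ℝ), VerticalData Φ f ∧
    (∀ x, t 0 x = 0) ∧
    (∀ n x, x ≠ S → ContinuousAt (t n) x) ∧
    (∀ (n : ℕ) (x : E3), x ≠ S → ∑ m ∈ Finset.Icc (-(n : ℤ)) n, M n m *
      (sphY n m (polarAngle (x - S)) (azimuth (x - S)) / (‖x - S‖ : ℂ) ^ (n + 1)) = t n x) ∧
    Summable u ∧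
    (∀ n x, b ≤ dist x S → |t (n + 2) x| ≤ u n / dist x S ^ 3) ∧
    (∀ x, x 2 < 0 → b ≤ dist x S → HasSum (fun n => t n x) (f x))

theorem VerticalData.add {Φ Ψ f g : E3 → ℝ} (hΦ : VerticalData Φ f) (hΨ : VerticalData Ψ g) :
    VerticalData (fun x => Φ x + Ψ x) (fun x => f x + g x) := by
  obtain ⟨Φ', h1, h2, h3⟩ := hΦ
  obtain ⟨Ψ', k1, k2, k3⟩ := hΨ
  refine ⟨fun x => Φ' x + Ψ' x, fun x hx => ⟨(h1 x hx).1.add (k1 x hx).1,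
    (h1 x hx).2.add (k1 x hx).2⟩, fun x hx => (h2 x hx).add (k2 x hx), fun x hx => ?_⟩
  obtain ⟨c, hc⟩ := h3 x hx
  obtain ⟨d, hd⟩ := k3 x hx
  refine ⟨c + d, ?_⟩
  have := hc.add hd
  rw [add_zero] at this
  exact this.congr fun t => by ring

theorem VerticalData.const_mul {Φ f : E3 → ℝ} (h : VerticalData Φ f) (a : ℝ) :
    VerticalData (fun x => a * Φ x) (fun x => a * f x) := by
  obtain ⟨Φ', h1, h2, h3⟩ := h
  refine ⟨fun x => a * Φ' x, fun x hx => ⟨(h1 x hx).1.const_mul a, (h1 x hx).2.const_mul a⟩,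
    fun x hx => (h2 x hx).const_mul a, fun x hx => ?_⟩
  obtain ⟨c, hc⟩ := h3 x hx
  refine ⟨a * c, ?_⟩
  have := hc.const_mul a
  rw [mul_zero] at this
  exact this.congr fun t => by ring

theorem VerticalData.zero : VerticalData (fun _ => 0) (fun _ => 0) :=
  ⟨fun _ => 0, fun _ _ => ⟨hasDerivAt_const _ _, hasDerivAt_const _ _⟩,
    fun _ _ => continuousAt_const, fun _ _ => ⟨0, by simp⟩⟩

section

variable {S : E3} {b : ℝ}

theorem FarData.zero : FarData S b (fun _ => 0) (fun _ _ => 0) :=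
  ⟨fun _ => 0, fun _ _ => 0, fun _ => 0, .zero, by simp, fun _ _ _ => continuousAt_const, by simp,
    summable_zero, by simp, fun _ _ _ => hasSum_zero⟩

theorem FarData.add {Φ Ψ : E3 → ℝ} {M L : ℕ → ℤ → ℂ} (hΦ : FarData S b Φ M)
    (hΨ : FarData S b Ψ L) : FarData S b (fun x => Φ x + Ψ x) (fun n m => M n m + L n m) := by
  obtain ⟨f, t, u, h1, h2, h3, h4, h5, h6, h7⟩ := hΦ
  obtain ⟨g, s, v, k1, k2, k3, k4, k5, k6, k7⟩ := hΨ
  refine ⟨fun x => f x + g x, fun n x => t n x + s n x, fun n => u n + v n, h1.add k1,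
    fun x => by simp [h2, k2], fun n x hx => (h3 n x hx).add (k3 n x hx), fun n x hx => ?_,
    h5.add k5, fun n x hx => ?_, fun x hx hb => (h7 x hx hb).add (k7 x hx hb)⟩
  · simp only [add_mul, Finset.sum_add_distrib, h4 n x hx, k4 n x hx, Complex.ofReal_add]
  · rw [add_div]
    exact (abs_add_le _ _).trans (add_le_add (h6 n x hx) (k6 n x hx))

theorem FarData.smul {Φ : E3 → ℝ} {M : ℕ → ℤ → ℂ} (hΦ : FarData S b Φ M) (a : ℝ) :
    FarData S b (fun x => a * Φ x) (fun n m => a * M n m) := by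
  obtain ⟨f, t, u, h1, h2, h3, h4, h5, h6, h7⟩ := hΦ
  refine ⟨fun x => a * f x, fun n x => a * t n x, fun n => |a| * u n, h1.const_mul a,
    fun x => by simp [h2], fun n x hx => (h3 n x hx).const_mul a, fun n x hx => ?_,
    h5.mul_left _, fun n x hx => ?_, fun x hx hb => (h7 x hx hb).mul_left a⟩
  · simp only [mul_assoc, ← Finset.mul_sum, h4 n x hx, Complex.ofReal_mul]
  · rw [abs_mul, mul_div_assoc]
    exact mul_le_mul_of_nonneg_left (h6 n x hx) (abs_nonneg a)

theorem FarData.sum {ι : Type*} (s : Finset ι) {Φ : ι → E3 → ℝ} {M : ι → ℕ → ℤ → ℂ}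
    (h : ∀ i, FarData S b (Φ i) (M i)) :
    FarData S b (fun x => ∑ i ∈ s, Φ i x) (fun n m => ∑ i ∈ s, M i n m) := by
  classical
  induction s using Finset.induction_on with
  | empty => simpa using FarData.zero
  | insert i s hi ih => simpa [Finset.sum_insert hi] using (h i).add ih

theorem summable_pow_four_mul_pow {κ : ℝ} (h0 : 0 ≤ κ) (h1 : κ < 1) :
    Summable fun n : ℕ => ((n + 2 : ℕ) : ℝ) ^ 4 * κ ^ n := by
  have h := (summable_nat_add_iff 4).2 (summable_pow_four_mul_pow_sub h0 h1)
  refine (summable_nat_add_iff 2).1 ((h.mul_right (κ ^ 2)).congr fun n => ?_)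
  rw [Nat.add_sub_cancel, mul_assoc, ← pow_add]

theorem farData_dipole {q : E3} (hq : 0 < q 2) (hb : dist q S < b) (F : E3) :
    FarData S b (fun x => dipole F (imageB x) q) (fun n m =>
      ((4 * Real.pi / (2 * n + 1) : ℝ) : ℂ) * dipole F (solidY S n (-m)) q) := by
  have hb0 : 0 < b := dist_nonneg.trans_lt hb
  refine ⟨_, fun n x => dipole F (multipole n S x) q, fun n => 2 * b * ‖F‖ *
    (((n + 2 : ℕ) : ℝ) ^ 4 * (dist q S / b) ^ n), verticalData_dipole hq F, fun x => ?_,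
    fun n x hx => ?_, fun n x hx => ?_, ?_, fun n x hx => abs_dipole_multipole_le hb hx F n,
    fun x _ hx => hasSum_dipole_multipole (hb.trans_le hx) F⟩
  · simp only [dipole_multipole, multipoleD]
    simp [zonalD]
  · simp only [dipole_multipole]
    exact continuousAt_multipoleD n hx F q
  · rw [← sum_dipole_solidY_mul_sphY n hx F q]
    exact Finset.sum_congr rfl fun m _ => by ring
  · exact (summable_pow_four_mul_pow (by positivity) ((div_lt_one hb0).2 hb)).mul_left _

theorem farData_dipole_dipole {q : E3} (hb : dist q S < b) {F E : E3}
    (h : VerticalData (fun x => dipole E (fun z => dipole F (imageB x) z) q)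
      (fun x => dipole E (fun z => dipole F (fun y => ‖x - y‖⁻¹) z) q)) :
    FarData S b (fun x => dipole E (fun z => dipole F (imageB x) z) q) (fun n m =>
      ((4 * Real.pi / (2 * n + 1) : ℝ) : ℂ) *
        dipole E (fun z => dipole F (solidY S n (-m)) z) q) := by
  have hb0 : 0 < b := dist_nonneg.trans_lt hb
  refine ⟨_, fun n x => dipole E (fun z => dipole F (multipole n S x) z) q, fun n =>
    5 * ‖F‖ * ‖E‖ *
    (((n + 2 : ℕ) : ℝ) ^ 4 * (dist q S / b) ^ n), h, fun x => ?_,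
    fun n x hx => ?_, fun n x hx => ?_, ?_,
    fun n x hx => abs_dipole_dipole_multipole_le hb hx F E n,
    fun x _ hx => hasSum_dipole_dipole_multipole (hb.trans_le hx) F E⟩
  · simp only [dipole_dipole_multipole, multipoleDD]
    simp [zonalD, zonalDD]
  · simp only [dipole_dipole_multipole]
    exact continuousAt_multipoleDD n hx F E q
  · rw [← sum_dipole_dipole_solidY_mul_sphY n hx F E q]
    exact Finset.sum_congr rfl fun m _ => by ring
  · exact (summable_pow_four_mul_pow (by positivity) ((div_lt_one hb0).2 hb)).mul_left _

theorem farData_quadrupole {q : E3} (hq : 0 < q 2) (hb : dist q S < b) (lam mu : ℝ) (D ν : E3) :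
    FarData S b (fun x => quadrupole lam mu D ν (imageB x) q) (fun n m =>
      ((4 * Real.pi / (2 * n + 1) : ℝ) : ℂ) * quadrupole lam mu D ν (solidY S n (-m)) q) := by
  have hor : ∀ j k : Fin 3, j ≠ 2 → k ≠ 2 → FarData S b (fun x => partial2 j k (imageB x) q)
      (fun n m => ((4 * Real.pi / (2 * n + 1) : ℝ) : ℂ) * partial2 j k (solidY S n (-m)) q) :=
    fun j k hj hk => farData_dipole_dipole hb (verticalData_dipole_dipole_horizontal hq
      (by simp [hj.symm]) (by simp [hk.symm]))
  have h22 : FarData S b (fun x => partial2 2 2 (imageB x) q)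
      (fun n m => ((4 * Real.pi / (2 * n + 1) : ℝ) : ℂ) * partial2 2 2 (solidY S n (-m)) q) :=
    farData_dipole_dipole hb (verticalData_dipole_dipole_vert hq)
  -- The two vertical contributions, from `D₃ν₃` and from the Lamé coefficient `lam`, are merged
  -- into one coefficient.
  have h := ((((hor 0 0 (by decide) (by decide)).smul (2 * mu * (D 0 * ν 0))).add
    ((hor 1 1 (by decide) (by decide)).smul (2 * mu * (D 1 * ν 1)))).add
    ((hor 0 1 (by decide) (by decide)).smul (2 * mu * (D 1 * ν 0 + D 0 * ν 1)))).add
    (h22.smul (-(2 * mu * (D 2 * ν 2)) - 2 * lam * (ν 0 * D 0 + ν 1 * D 1 + ν 2 * D 2)))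
  convert h using 1
  · funext x
    simp only [quadrupole, smul_eq_mul]
    ring
  · funext n m
    simp only [quadrupole, Complex.real_smul]
    push_cast
    ring

end

/-! ### Vertical integration of the remainder -/

theorem sub_apply_two_le_dist (x S : E3) : S 2 - x 2 ≤ dist x S := by
  rw [dist_comm, dist_eq_norm]
  exact (le_abs_self _).trans (by simpa using PiLp.norm_apply_le (S - x) 2)

theorem hasD3Sq_of_vertical {S : E3} {w w₁ : E3 → ℝ → ℂ} {e : E3 → ℂ}
    (h : ∀ a : E3, a 2 = 0 → ∀ t < min 0 (S 2), HasDerivAt (w a) (w₁ a t) t ∧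
      HasDerivAt (w₁ a) (e (a + t • vert)) t) :
    HasD3Sq {x | x 2 < 0 ∧ x 2 < S 2} (fun x => w (x - x 2 • vert) (x 2)) e := by
  have hbase : ∀ (x : E3) (τ : ℝ),
      x + τ • vert - (x 2 + τ) • vert = x - x 2 • vert := fun x τ => by
    rw [add_smul]; abel
  refine ⟨fun x => w₁ (x - x 2 • vert) (x 2), fun x hx => ?_⟩
  have ha : (x - x 2 • vert) 2 = 0 := by simp [vert]
  obtain ⟨h1, h2⟩ := h _ ha (x 2) (lt_min hx.1 hx.2)
  rw [sub_add_cancel] at h2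
  simp only [add_smul_vert_two, hbase]
  exact ⟨HasDerivAt.comp_const_add (x 2) 0 (by simpa using h1),
    HasDerivAt.comp_const_add (x 2) 0 (by simpa using h2)⟩

/-- A field decaying like the inverse cube of the distance has a second vertical antiderivative that
vanishes at infinity. -/
theorem exists_hasD3Sq_of_norm_le {S : E3} {b A : ℝ} (hb : 0 < b) {e : E3 → ℂ}
    (hcont : ∀ x : E3, x 2 < 0 → x 2 < S 2 → ContinuousAt (fun τ : ℝ => e (x + τ • vert)) 0)
    (hA : ∀ x : E3, x 2 < 0 → b ≤ dist x S → ‖e x‖ ≤ A / dist x S ^ 3) :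
    ∃ W : E3 → ℂ, HasD3Sq {x | x 2 < 0 ∧ x 2 < S 2} W e ∧
      (∀ x : E3, Tendsto (fun t : ℝ => W (x - t • vert)) atTop (𝓝 0)) ∧
      ∀ x : E3, x 2 < 0 → x 2 < S 2 → b ≤ dist x S → ‖W x‖ ≤ 4 * |A| / b := by
  have hbound : ∀ x : E3, x 2 < 0 → x 2 < S 2 → b ≤ dist x S →
      ‖e x‖ ≤ 8 * |A| / (b + S 2 - x 2) ^ 3 := by
    intro x h1 h2 h3
    have h4 := sub_apply_two_le_dist x S
    have h5 : 0 < b + S 2 - x 2 := by linarith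
    -- The distance is at least `b` and at least `S 2 - x 2`, hence at least their mean. The shift
    -- by `b` keeps the estimate finite up to the plane through `S`; the halving accounts for the
    -- factor `8`.
    have h6 : (b + S 2 - x 2) / 2 ≤ dist x S := by linarith
    calc ‖e x‖ ≤ A / dist x S ^ 3 := hA x h1 h3
      _ ≤ |A| / dist x S ^ 3 := by gcongr; exact le_abs_self A
      _ ≤ |A| / ((b + S 2 - x 2) / 2) ^ 3 := by gcongr
      _ = 8 * |A| / (b + S 2 - x 2) ^ 3 := by field_simp; norm_num
  have h0 : min 0 (S 2) ≤ 0 := min_le_left _ _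
  have hS : min 0 (S 2) ≤ S 2 := min_le_right _ _
  have key : ∀ a : E3, ∃ w w₁ : ℝ → ℂ, a 2 = 0 →
      (∀ t < min 0 (S 2), HasDerivAt w (w₁ t) t ∧ HasDerivAt w₁ (e (a + t • vert)) t) ∧
      Tendsto w atBot (𝓝 0) ∧ ∀ t < min 0 (S 2), ∀ A : ℝ,
        (∀ τ ≤ t, ‖e (a + τ • vert)‖ ≤ A / (b + S 2 - τ) ^ 3) → ‖w t‖ ≤ A / (2 * (b + S 2 - t)) := by
    intro a
    by_cases ha : a 2 = 0
    · have ha2 : ∀ τ : ℝ, (a + τ • vert) 2 = τ := fun τ => by rw [add_smul_vert_two, ha, zero_add]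
      have hcont' : ContinuousOn (fun τ : ℝ => e (a + τ • vert)) (Set.Iio (min 0 (S 2))) := by
        intro t ht
        have ht' : t < min 0 (S 2) := ht
        have h1 := hcont (a + t • vert) (by rw [ha2]; linarith) (by rw [ha2]; linarith)
        have h2 : ContinuousAt (fun τ : ℝ => τ - t) t := by fun_prop
        have h3 := ContinuousAt.comp (g := fun τ : ℝ => e (a + t • vert + τ • vert))
          (by simpa using h1) h2
        refine (h3.congr (.of_forall fun τ => ?_)).continuousWithinAt
        simp only [Function.comp_apply, add_assoc, ← add_smul]
        rw [add_sub_cancel]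
      -- At depth at least `b` below `S` the point is automatically outside the ball of radius `b`,
      -- whatever its horizontal position.
      have hdecay : ∀ τ ≤ min (S 2 - b) (min 0 (S 2) - 1),
          ‖e (a + τ • vert)‖ ≤ 8 * |A| / (b + S 2 - τ) ^ 3 := fun τ hτ => by
        have h1 := hτ.trans (min_le_left _ _)
        have h2 := hτ.trans (min_le_right _ _)
        have h3 := hbound (a + τ • vert) (by rw [ha2]; linarith) (by rw [ha2]; linarith)
          (le_trans (by rw [ha2]; linarith) (sub_apply_two_le_dist _ _))
        rwa [ha2] at h3
      obtain ⟨w, w₁, h⟩ := exists_second_antideriv (w := b + S 2) (by linarith) hcont'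
        ⟨_, (min_le_right _ _).trans_lt (by linarith), 8 * |A|, hdecay⟩
      exact ⟨w, w₁, fun _ => h⟩
    · exact ⟨0, 0, fun h => absurd h ha⟩
  choose w w₁ hw using key
  have hbase : ∀ x : E3, (x - x 2 • vert) 2 = 0 := fun x => by simp [vert]
  refine ⟨fun x => w (x - x 2 • vert) (x 2), hasD3Sq_of_vertical fun a ha => (hw a ha).1,
    fun x => ?_, fun x h1 h2 h3 => ?_⟩
  · have h4 := (hw _ (hbase x)).2.1.comp
      (tendsto_atBot_add_const_left atTop (x 2) tendsto_neg_atTop_atBot)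
    refine h4.congr fun t => ?_
    have h5 : x - t • vert = x + (-t) • vert := by rw [neg_smul, sub_eq_add_neg]
    simp only [h5, add_smul_vert_two, Function.comp_apply]
    rw [add_smul, add_sub_add_right_eq_sub]
  · refine ((hw _ (hbase x)).2.2 (x 2) (lt_min h1 h2) (8 * |A|) fun τ hτ => ?_).trans ?_
    · have h4 : (x - x 2 • vert + τ • vert) 2 = τ := by rw [add_smul_vert_two, hbase, zero_add]
      -- Descending from a point below `S` increases the distance to `S`, so the half-line stays
      -- outside the ball.
      have h5 : b ≤ dist (x - x 2 • vert + τ • vert) S := by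
        refine h3.trans ?_
        rw [dist_eq_norm, dist_eq_norm, E3.norm_sub_eq, E3.norm_sub_eq, h4]
        refine Real.sqrt_le_sqrt ?_
        have e0 : (x - x 2 • vert + τ • vert) 0 = x 0 := by simp [vert]
        have e1 : (x - x 2 • vert + τ • vert) 1 = x 1 := by simp [vert]
        rw [e0, e1]
        have : (S 2 - x 2) ^ 2 ≤ (S 2 - τ) ^ 2 := by gcongr
        linarith
      have h6 := hbound (x - x 2 • vert + τ • vert) (by rw [h4]; linarith) (by rw [h4]; linarith) h5
      rwa [h4] at h6
    · calc 8 * |A| / (2 * (b + S 2 - x 2)) ≤ 8 * |A| / (2 * b) := by gcongr; linarith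
        _ = 4 * |A| / b := by field_simp; ring

theorem multipoleSum_eq {M : ℕ → ℤ → ℂ} {S x : E3} {t : ℕ → E3 → ℝ}
    (h : ∀ n : ℕ, ∑ m ∈ Finset.Icc (-(n : ℤ)) n, M n m *
      (sphY n m (polarAngle (x - S)) (azimuth (x - S)) / (‖x - S‖ : ℂ) ^ (n + 1)) = t n x) (p : ℕ) :
    multipoleSum M S p x = ((∑ n ∈ Finset.range (p + 1), t n x : ℝ) : ℂ) := by
  rw [multipoleSum, Complex.ofReal_sum]
  exact Finset.sum_congr rfl fun n _ => h n

theorem VerticalData.hasD3Sq {Φ f : E3 → ℝ} (h : VerticalData Φ f) :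
    HasD3Sq {x | x 2 < 0} (fun x => (Φ x : ℂ)) fun x => (f x : ℂ) := by
  obtain ⟨Φ', h1, -⟩ := h
  exact ⟨fun x => Φ' x, fun x hx => ⟨(h1 x hx).1.ofReal_comp, (h1 x hx).2.ofReal_comp⟩⟩

/-- The case `p = 0` is separate: the remainder would include degree 1, for which the bound
`O(r^(-3))` is not provided. But the degree-0 term vanishes, so the antiderivative is `0`. -/
theorem FarData.exists_isInvD3Sq_zero {S : E3} {b : ℝ} {Φ : E3 → ℝ} {M : ℕ → ℤ → ℂ}
    (h : FarData S b Φ M) :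
    ∃ G : E3 → ℂ, IsInvD3Sq {x : E3 | x 2 < 0 ∧ x 2 < S 2} (multipoleSum M S 0) G := by
  obtain ⟨f, t, u, -, h2, -, h4, -⟩ := h
  have h0 : ∀ x : E3, x 2 < S 2 → multipoleSum M S 0 x = 0 := fun x hx => by
    rw [multipoleSum_eq (fun n => h4 n x (E3.ne_of_lt hx))]
    simp [h2]
  refine ⟨fun _ => 0, ⟨fun _ => 0, fun x hx => ?_⟩, fun x _ => ⟨0, 0, by simp⟩⟩
  rw [h0 x hx.2]
  exact ⟨hasDerivAt_const _ _, hasDerivAt_const _ _⟩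

theorem FarData.exists_bound {S : E3} {b : ℝ} (hb : 0 < b) {Φ : E3 → ℝ} {M : ℕ → ℤ → ℂ}
    (h : FarData S b Φ M) : ∃ (f : E3 → ℝ) (ε : ℕ → ℝ), VerticalData Φ f ∧
      Tendsto ε atTop (𝓝 0) ∧
      (∀ (p : ℕ) (x : E3), x 2 < 0 → x 2 < S 2 →
        ContinuousAt (fun τ : ℝ => (f (x + τ • vert) : ℂ) - multipoleSum M S p (x + τ • vert)) 0) ∧
      ∀ (k : ℕ) (x : E3), x 2 < 0 → b ≤ dist x S →
        ‖(f x : ℂ) - multipoleSum M S (k + 1) x‖ ≤ ε k / dist x S ^ 3 := by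
  obtain ⟨f, t, u, h1, h2, h3, h4, h5, h6, h7⟩ := h
  refine ⟨f, fun k => ∑' n, u (n + k), h1, tendsto_sum_nat_add u, fun p x hx hxS => ?_,
    fun k x hx hxb => ?_⟩
  · have hc : ContinuousAt (fun τ : ℝ => x + τ • vert) 0 := by fun_prop
    have hx0 : x + (0 : ℝ) • vert = x := by simp
    have hne := E3.ne_of_lt hxS
    have h8 : ContinuousAt (fun τ : ℝ => f (x + τ • vert) -
        ∑ n ∈ Finset.range (p + 1), t n (x + τ • vert)) 0 := by
      refine (h1.choose_spec.2.1 x hx).sub (tendsto_finsetSum _ fun n _ => ?_)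
      exact ContinuousAt.comp (g := t n) (by rw [hx0]; exact h3 n x hne) hc
    refine ((Complex.continuous_ofReal.continuousAt).comp h8).congr ?_
    filter_upwards [hc.eventually_ne (by rw [hx0]; exact hne)] with τ hτ
    rw [multipoleSum_eq (fun n => h4 n _ hτ)]
    simp
  · have hne : x ≠ S := dist_pos.1 (hb.trans_le hxb)
    rw [multipoleSum_eq (fun n => h4 n x hne), ← Complex.ofReal_sub, Complex.norm_real]
    -- The sum up to degree `k + 1` has `k + 2` terms, so the tail starts at degree `k + 2`, exactly
    -- where the cubic bounds begin.
    have h8 := (hasSum_nat_add_iff' (k + 1 + 1)).2 (h7 x hx hxb)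
    rw [← h8.tsum_eq]
    have h9 : Summable fun n => u (n + k) / dist x S ^ 3 :=
      ((summable_nat_add_iff k).2 h5).div_const _
    rw [← tsum_div_const]
    exact tsum_of_norm_bounded h9.hasSum fun n => h6 (n + k) x hxb

/-! ### The far-field representation -/

theorem FarData.hasFarField {S : E3} {b : ℝ} (hb : 0 < b) {Φ : E3 → ℝ} {M : ℕ → ℤ → ℂ}
    (h : FarData S b Φ M) : HasFarField Φ M S b := by
  obtain ⟨f, ε, h1, h2, h3, h4⟩ := h.exists_bound hb
  have hG : ∀ k : ℕ, ∃ G : E3 → ℂ,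
      IsInvD3Sq {x : E3 | x 2 < 0 ∧ x 2 < S 2} (multipoleSum M S (k + 1)) G ∧
      ∀ x : E3, x 2 < 0 → x 2 < S 2 → b ≤ dist x S → ‖(Φ x : ℂ) - G x‖ ≤ 4 * |ε k| / b := by
    intro k
    obtain ⟨W, ⟨W', hW'⟩, hW2, hW3⟩ := exists_hasD3Sq_of_norm_le hb
      (e := fun x => (f x : ℂ) - multipoleSum M S (k + 1) x) (h3 (k + 1)) (h4 k)
    obtain ⟨Φ', hΦ'⟩ := h1.hasD3Sq
    -- Subtracting the double integral `W` of the remainder from `Φ` leaves the truncated sum as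
    -- second derivative. As `W` vanishes at infinity, the asymptotics are those of `Φ`, with no `t
    -- log (2t) - t` part.
    refine ⟨fun x => Φ x - W x, ⟨⟨fun x => Φ' x - W' x, fun x hx => ⟨?_, ?_⟩⟩, fun x hx => ?_⟩,
      fun x hx hxS hxb => ?_⟩
    · exact (hΦ' x hx.1).1.sub (hW' x hx).1
    · exact ((hΦ' x hx.1).2.sub (hW' x hx).2).congr_deriv (sub_sub_cancel _ _)
    · obtain ⟨c, hc⟩ := h1.choose_spec.2.2 x hx.1
      refine ⟨0, c, ?_⟩
      have h5 := ((Complex.continuous_ofReal.tendsto 0).comp hc).sub (hW2 x)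
      rw [Complex.ofReal_zero, sub_zero] at h5
      refine h5.congr fun t => ?_
      simp only [Function.comp_apply]
      push_cast
      ring
    · rw [sub_sub_cancel]
      exact hW3 x hx hxS hxb
  choose G hG1 hG2 using hG
  refine ⟨fun p => ?_, fun H hH => ?_, fun x => f x, h1.hasD3Sq, ?_⟩
  · cases p with
    | zero => exact h.exists_isInvD3Sq_zero
    | succ k => exact ⟨G k, hG1 k⟩
  · rw [Metric.tendstoUniformlyOn_iff]
    intro δ hδ
    have hlim : Tendsto (fun k => 4 * |ε k| / b) atTop (𝓝 0) := by
      simpa using (h2.abs.const_mul 4).div_const b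
    have h5 := (hlim.eventually_lt_const hδ)
    filter_upwards [(tendsto_sub_atTop_nat 1).eventually h5, eventually_ge_atTop 1] with p hp hp1 x hx
    obtain ⟨k, rfl⟩ : ∃ k, p = k + 1 := ⟨p - 1, by omega⟩
    -- By uniqueness any given antiderivative is the constructed one, to which the estimate applies.
    rw [(hH (k + 1)).eqOn (hG1 k) ⟨hx.1, hx.2.1⟩, dist_eq_norm]
    exact (hG2 k x hx.1 hx.2.1 hx.2.2).trans_lt hp
  · rw [Metric.tendstoUniformlyOn_iff]
    intro δ hδ
    have hlim : Tendsto (fun k => |ε k| / b ^ 3) atTop (𝓝 0) := by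
      simpa using h2.abs.div_const (b ^ 3)
    have h5 := (hlim.eventually_lt_const hδ)
    filter_upwards [(tendsto_sub_atTop_nat 1).eventually h5, eventually_ge_atTop 1] with p hp hp1 x hx
    obtain ⟨k, rfl⟩ : ∃ k, p = k + 1 := ⟨p - 1, by omega⟩
    rw [dist_eq_norm]
    refine lt_of_le_of_lt ?_ hp
    calc ‖(f x : ℂ) - multipoleSum M S (k + 1) x‖ ≤ ε k / dist x S ^ 3 := h4 k x hx.1 hx.2
      _ ≤ |ε k| / dist x S ^ 3 := by
        have := hb.trans_le hx.2
        gcongr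
        exact le_abs_self _
      _ ≤ |ε k| / b ^ 3 := by gcongr; exact hx.2

/-- Covers the absence of sources, where nothing forces `b` to be positive. -/
theorem hasFarField_zero (S : E3) (b : ℝ) : HasFarField (fun _ => 0) (fun _ _ => 0) S b := by
  have h0 : ∀ p x, multipoleSum (fun _ _ => 0) S p x = 0 := fun p x => by simp [multipoleSum]
  have hD : ∀ U, HasD3Sq U (fun _ => 0) fun _ => 0 := fun U =>
    ⟨fun _ => 0, fun _ _ => ⟨hasDerivAt_const _ _, hasDerivAt_const _ _⟩⟩
  have hG : ∀ p U, IsInvD3Sq U (multipoleSum (fun _ _ => 0) S p) fun _ => 0 := fun p U => by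
    rw [funext (h0 p)]
    exact ⟨hD U, fun x _ => ⟨0, 0, by simp⟩⟩
  refine ⟨fun p => ⟨_, hG p _⟩, fun H hH => ?_, fun _ => 0, by simpa using hD _, ?_⟩
  · rw [Metric.tendstoUniformlyOn_iff]
    refine fun δ hδ => .of_forall fun p x hx => ?_
    rw [(hH p).eqOn (hG p _) ⟨hx.1, hx.2.1⟩]
    simpa using hδ
  · rw [Metric.tendstoUniformlyOn_iff]
    refine fun δ hδ => .of_forall fun p x hx => ?_
    rw [h0]
    simpa using hδ

theorem hasFarField_of_forall_farData {N : ℕ} {S : E3} {b : ℝ} (hb : ∀ _ : Fin N, 0 < b)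
    {Φ : Fin N → E3 → ℝ} {M : Fin N → ℕ → ℤ → ℂ} (h : ∀ i, FarData S b (Φ i) (M i)) :
    HasFarField (fun x => ∑ i, Φ i x) (fun n m => ∑ i, M i n m) S b := by
  rcases isEmpty_or_nonempty (Fin N) with hN | ⟨⟨i⟩⟩
  · simpa using hasFarField_zero S b
  · exact (FarData.sum _ h).hasFarField (hb i)

theorem lemma3p6 {N : ℕ} (ξ : Fin N → E3) (hξ : ∀ i, ξ i 2 < 0) (S : E3)
    (b : ℝ) (hb : ∀ i, dist (imagePt (ξ i)) S < b) :
    (∀ F : Fin N → E3, HasFarField (PhiB F ξ) (coeffSingle F ξ S) S b) ∧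
    (∀ (lam mu : ℝ) (D ν : Fin N → E3),
      HasFarField (PhiBDouble lam mu D ν ξ) (coeffDouble lam mu D ν ξ S) S b) := by
  have hpos : ∀ i, 0 < imagePt (ξ i) 2 := fun i => by simpa [imagePt] using hξ i
  have hb0 : ∀ _ : Fin N, 0 < b := fun i => dist_nonneg.trans_lt (hb i)
  refine ⟨fun F => ?_, fun lam mu D ν => ?_⟩
  · have h := hasFarField_of_forall_farData hb0 fun i => farData_dipole (hpos i) (hb i) (F i)
    simp only [← Finset.mul_sum] at h
    exact h
  · have h := hasFarField_of_forall_farData hb0 fun i =>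
      farData_quadrupole (hpos i) (hb i) lam mu (D i) (ν i)
    simp only [← Finset.mul_sum] at h
    exact h

end
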